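/- \textbf{Setting.} Let $\mathcal P$ be a finite set of processes, $\mathrm{Ch}=\{pq : p\neq q\in\mathcal P\}$ the set of channels, $\Sigma$ a finite alphabet and $\lightning\notin\Sigma$ a crash message. A \emph{FIFO system} $S$ over $\Sigma\uplus\{\lightning\}$ consists, for each $p\in\mathcal P$, of a finite set $Q_p$ of control states, an initial state, and a finite transition relation $\delta_p\subseteq Q_p\times \mathrm{Act}_p\times Q_p$, where the actions of $p$ are the sends $pq!m$, the receptions $qp?m$ ($q\ne p$, $m\in\Sigma\uplus\{\lightning\}$), and internal actions of $p$, one of which is $\mathit{crash}_p$. A configuration consists of a control state for each process and a word for each channel; initially all channels are empty. A send appends its message to the end of its channel, a reception $pq?m$ removes $m$ from the front of $pq$, an internal action leaves the channels unchanged (the channels are perfect). A configuration is \emph{$k$-bounded} if each channel holds at most $k$ messages; $\to_k$ is the step relation between $k$-bounded configurations, and $RS_k(S)$ is the set of configurations reachable from the initial one by $\to_k$-steps. A state is \emph{sending} (\emph{receiving}) if all communications leaving it are sends (receptions), internal actions being disregarded; a \emph{session automaton} is a deterministic automaton in which each state is sending or receiving. $S$ is \emph{$k$-weakly multiparty compatible}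 ($k$-WMC) if for all $\gamma\in RS_k(S)$ and all channels $pq$: (i) if the content of $pq$ in $\gamma$ begins with $m$, then $\gamma\to_k^*\xrightarrow{pq?m}_k$; (ii) if the state $q_p$ of $p$ in $\gamma$ is sending, then $\gamma\to_k^*\xrightarrow{pq!m}_k$ for each transition $(q_p,pq!m,q_p')\in\delta_p$. Let $\mathcal R\subseteq\mathcal P$ be a set of reliable processes and $Q_p=Q_{p,1}\uplus Q_{p,2}\uplus Q_{p,3}$ a division of the control states for each $p$. Let $\delta_{p,1}$ be the set of the transitions in $\delta_p$ that send or receive a message of $\Sigma$, and $\delta_{p,2}=\delta_p\setminus\delta_{p,1}$. $S$ is \emph{crash-handling} if for each $p$ the transitions in $\delta_{p,1}$ lead from $Q_{p,1}$ to $Q_{p,1}\cup Q_{p,2}$, and $\delta_{p,2}$ is, with respect to inclusion, a minimal set such that: (1) for each $(q,rp?a,q')\in\delta_{p,1}$ with $r\notin\mathcal R$ such that $q$ is the state of $p$ in some reachable configuration of $S$, there is $q''\in Q_{p,1}\cup Q_{p,2}$ with $(q,rp?\lightning,q'')\in\delta_{p,2}$; (2) if $p\notin\mathcal R$, then from each $q\in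 Q_{p,1}$ there is a path in $\delta_{p,2}$ to some state of $Q_{p,2}$, labelled by $\mathit{crash}_p$ followed by one send of $\lightning$ to each other process, in some order, with all intermediate states in $Q_{p,3}$; (3) $(q,rp?\lightning,q)\in\delta_{p,2}$ for all $q\in Q_{p,2}$ and $r\neq p$. It is \emph{generated from communicating session automata} if each automaton with the transitions $\delta_{p,1}$ only is a session automaton. \textbf{Theorem.} Given a crash-handling system $S$ generated from communicating session automata and a number $k$ in unary, it is decidable whether $S$ is $k$-WMC, and this can be done in PSPACE. That is, there is one decidable language $L$, belonging to PSPACE, such that for all such $S$ and all $k\in\mathbb N$, the word that encodes $(S,k)$ is in $L$ if and only if $S$ is $k$-WMC. (The encoding lists the finite sets of processes, messages, internal action names and control states explicitly, and the transitions of each automaton; its length is polynomially related to the size of $S$ plus $k$.) -/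

import Mathlib

/-! # FIFO systems -/

/-- The unidirectional channels between `n` processes: ordered pairs of distinct processes. -/
abbrev Channel (n : ℕ) : Type := {c : Fin n × Fin n // c.1 ≠ c.2}

/-- The sender of a channel. -/
def Channel.src {n : ℕ} (c : Channel n) : Fin n := c.1.1

/-- The receiver of a channel. -/
def Channel.dst {n : ℕ} (c : Channel n) : Fin n := c.1.2

/-- Messages: `m` ordinary messages (the alphabet `Σ`) and the crash message `↯`. -/
inductive Msg (m : ℕ) : Type
  | ordinary (a : Fin m) : Msg m
  | crash : Msg m
deriving DecidableEq

/-- Names of internal actions: `t` ordinary names and the reserved name `crash`. -/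
inductive IntName (t : ℕ) : Type
  | ordinary (a : Fin t) : IntName t
  | crash : IntName t
deriving DecidableEq

/-- Actions: sending on a channel, receiving from a channel, and an internal action of a process. -/
inductive FIFOAction (n m t : ℕ) : Type
  | send (c : Channel n) (a : Msg m) : FIFOAction n m t
  | recv (c : Channel n) (a : Msg m) : FIFOAction n m t
  | internal (p : Fin n) (i : IntName t) : FIFOAction n m t
deriving DecidableEq

/-- The process that performs an action. -/
def FIFOAction.actor {n m t : ℕ} : FIFOAction n m t → Fin n
  | .send c _ => c.src
  | .recv c _ => c.dst
  | .internal p _ => p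

/-- The crash action of a process. -/
abbrev FIFOAction.crashOf {n m t : ℕ} (p : Fin n) : FIFOAction n m t := .internal p .crash

/-- A FIFO system of `n` automata. All finite sets are initial segments of `ℕ`, and the (generally
nondeterministic) transition relation of each automaton is given by a list of its elements. The
automaton of `p` has only actions performed by `p`. -/
structure FIFOSystem (n m t : ℕ) : Type where
  /-- number of control states of each automaton -/
  numStates : Fin n → ℕ
  /-- initial control states -/
  init : ∀ p, Fin (numStates p)
  /-- transitions `(q, a, q')` -/
  trans : ∀ p, List (Fin (numStates p) × FIFOAction n m t × Fin (numStates p))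
  /-- a process fires only its own actions -/
  actor_eq : ∀ p, ∀ τ ∈ trans p, τ.2.1.actor = p

namespace FIFOSystem

variable {n m t : ℕ}

/-- The control states of process `p`. -/
abbrev State (S : FIFOSystem n m t) (p : Fin n) : Type := Fin (S.numStates p)

/-- The type of candidate transitions of process `p`. -/
abbrev Trans (S : FIFOSystem n m t) (p : Fin n) : Type :=
  S.State p × FIFOAction n m t × S.State p

/-- The transition relation of process `p`. -/
def delta (S : FIFOSystem n m t) (p : Fin n) : Set (S.Trans p) := {τ | τ ∈ S.trans p}

/-! ## Semantics (perfect channels) -/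

/-- A configuration: a control state for each process and a word for each channel. -/
@[ext] structure Config (S : FIFOSystem n m t) : Type where
  /-- the global state -/
  state : ∀ p, S.State p
  /-- the channel contents, the oldest message first -/
  chan : Channel n → List (Msg m)

/-- The initial configuration. -/
def initConfig (S : FIFOSystem n m t) : S.Config := ⟨S.init, fun _ => []⟩

/-- The effect of an action on the channel contents: `w` before, `w'` after. -/
def ChanEffect : FIFOAction n m t → (Channel n → List (Msg m)) → (Channel n → List (Msg m)) → Prop
  | .send c a, w, w' => w' = Function.update w c (w c ++ [a])
  | .recv c a, w, w' => w c = a :: w' c ∧ ∀ d, d ≠ c → w' d = w d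
  | .internal _ _, w, w' => w' = w

/-- `γ'` is the successor of `γ` by firing a transition with action `a`. -/
def Step (S : FIFOSystem n m t) (γ : S.Config) (a : FIFOAction n m t) (γ' : S.Config) : Prop :=
  ∃ q' : S.State a.actor,
    (γ.state a.actor, a, q') ∈ S.delta a.actor ∧
    γ'.state = Function.update γ.state a.actor q' ∧
    ChanEffect a γ.chan γ'.chan

/-- `γ` is reachable from the initial configuration. -/
def Reachable (S : FIFOSystem n m t) (γ : S.Config) : Prop :=
  Relation.ReflTransGen (fun γ₁ γ₂ => ∃ a, S.Step γ₁ a γ₂) S.initConfig γ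

/-- All channels hold at most `k` messages. -/
def Config.Bounded {S : FIFOSystem n m t} (k : ℕ) (γ : S.Config) : Prop :=
  ∀ c, (γ.chan c).length ≤ k

/-- A step between `k`-bounded configurations. -/
def KStep (S : FIFOSystem n m t) (k : ℕ) (γ : S.Config) (a : FIFOAction n m t) (γ' : S.Config) :
    Prop :=
  γ.Bounded k ∧ S.Step γ a γ' ∧ γ'.Bounded k

/-- `γ'` can be reached from `γ` by a (possibly empty) sequence of `k`-bounded steps. -/
def KReaches (S : FIFOSystem n m t) (k : ℕ) : S.Config → S.Config → Prop :=
  Relation.ReflTransGen (fun γ₁ γ₂ => ∃ a, S.KStep k γ₁ a γ₂)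

/-- The `k`-reachability set. -/
def RS (S : FIFOSystem n m t) (k : ℕ) : Set S.Config := {γ | S.KReaches k S.initConfig γ}

/-! ## Sending states, session automata -/

/-- `q` is a sending state of the automaton with transitions `D`: the communications that leave `q`
are sends. Internal actions do not count as communications. -/
def IsSending (S : FIFOSystem n m t) {p : Fin n} (D : Set (S.Trans p)) (q : S.State p) : Prop :=
  ∀ c a q', (q, FIFOAction.recv c a, q') ∉ D

/-- `q` is a receiving state of the automaton with transitions `D`: the communications that leave
`q` are receptions. -/
def IsReceiving (S : FIFOSystem n m t) {p : Fin n} (D : Set (S.Trans p)) (q : S.State p) : Prop :=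
  ∀ c a q', (q, FIFOAction.send c a, q') ∉ D

/-- The automaton with transitions `D` is a session automaton: it is deterministic, and no state is
mixed. -/
def IsSessionAutomaton (S : FIFOSystem n m t) {p : Fin n} (D : Set (S.Trans p)) : Prop :=
  (∀ q a q' q'', (q, a, q') ∈ D → (q, a, q'') ∈ D → q' = q'') ∧
  ∀ q, S.IsSending D q ∨ S.IsReceiving D q

/-! ## `k`-weak multiparty compatibility -/

/-- `k`-eventual reception. -/
def EventualReception (S : FIFOSystem n m t) (k : ℕ) : Prop :=
  ∀ γ ∈ S.RS k, ∀ (c : Channel n) (a : Msg m) (u : List (Msg m)), γ.chan c = a :: u →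
    ∃ γ₁ γ₂, S.KReaches k γ γ₁ ∧ S.KStep k γ₁ (.recv c a) γ₂

/-- `k`-exhaustivity. -/
def Exhaustive (S : FIFOSystem n m t) (k : ℕ) : Prop :=
  ∀ γ ∈ S.RS k, ∀ c : Channel n, S.IsSending (S.delta c.src) (γ.state c.src) →
    ∀ (a : Msg m) (q' : S.State c.src),
      (γ.state c.src, FIFOAction.send c a, q') ∈ S.delta c.src →
        ∃ γ₁ γ₂, S.KReaches k γ γ₁ ∧ S.KStep k γ₁ (.send c a) γ₂

/-- `k`-weak multiparty compatibility. -/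
def IsKWMC (S : FIFOSystem n m t) (k : ℕ) : Prop :=
  S.EventualReception k ∧ S.Exhaustive k

end FIFOSystem

/-! # Crash-handling systems -/

/-- An action that communicates an ordinary message. -/
def FIFOAction.IsOrdinary {n m t : ℕ} : FIFOAction n m t → Prop
  | .send _ (.ordinary _) => True
  | .recv _ (.ordinary _) => True
  | _ => False

/-- Names of the three classes into which the control states of each process are divided. -/
inductive StateClass : Type
  | one | two | three
deriving DecidableEq

namespace FIFOSystem

variable {n m t : ℕ}

/-- `δ₁`: the transitions that communicate ordinary messages. -/
def delta1 (S : FIFOSystem n m t) (p : Fin n) : Set (S.Trans p) :=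
  {τ | τ ∈ S.delta p ∧ τ.2.1.IsOrdinary}

/-- `δ₂`: the other transitions (a communication of the crash message, or an internal action). -/
def delta2 (S : FIFOSystem n m t) (p : Fin n) : Set (S.Trans p) :=
  {τ | τ ∈ S.delta p ∧ ¬ τ.2.1.IsOrdinary}

/-- `D` contains a path from `s` to `q'` that sends the crash message to the processes in the list
one after the other, and whose states before `q'` have class `three`. -/
def CrashBroadcast (S : FIFOSystem n m t) (cls : ∀ p, S.State p → StateClass) {p : Fin n}
    (D : Set (S.Trans p)) : S.State p → List {r : Fin n // p ≠ r} → S.State p → Prop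
  | s, [], q' => s = q'
  | s, r :: rs, q' => cls p s = .three ∧
      ∃ s', (s, FIFOAction.send ⟨(p, r.1), r.2⟩ .crash, s') ∈ D ∧ S.CrashBroadcast cls D s' rs q'

/-- Crash handling: at a reachable state, a reception from an unreliable process has a crash
branch in `D`. -/
def CrashHandlingCond (S : FIFOSystem n m t) (R : Set (Fin n))
    (cls : ∀ p, S.State p → StateClass) (p : Fin n) (D : Set (S.Trans p)) : Prop :=
  ∀ (c : Channel n) (a : Fin m) (q q' : S.State p),
    (q, FIFOAction.recv c (.ordinary a), q') ∈ S.delta1 p →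
    (∃ γ, S.Reachable γ ∧ γ.state p = q) → c.src ∉ R →
      ∃ q'', (cls p q'' = .one ∨ cls p q'' = .two) ∧ (q, FIFOAction.recv c .crash, q'') ∈ D

/-- Crash broadcast: if `p` is unreliable, then from each state of class `one` it can crash and
then send the crash message once to each other process, through states of class `three` to a state
of class `two`. -/
def CrashBroadcastCond (S : FIFOSystem n m t) (R : Set (Fin n))
    (cls : ∀ p, S.State p → StateClass) (p : Fin n) (D : Set (S.Trans p)) : Prop :=
  p ∉ R → ∀ q, cls p q = .one →
    ∃ (s qEnd : S.State p) (rs : List {r : Fin n // p ≠ r}),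
      rs.Nodup ∧ (∀ r, r ∈ rs) ∧ cls p qEnd = .two ∧
      (q, FIFOAction.crashOf p, s) ∈ D ∧ S.CrashBroadcast cls D s rs qEnd

/-- Crash redundancy: at states of class `two`, crash messages are consumed. -/
def CrashRedundancyCond (S : FIFOSystem n m t)
    (cls : ∀ p, S.State p → StateClass) (p : Fin n) (D : Set (S.Trans p)) : Prop :=
  ∀ q, cls p q = .two → ∀ r : {r : Fin n // r ≠ p},
    (q, FIFOAction.recv ⟨(r.1, p), r.2⟩ .crash, q) ∈ D

/-- `S` is crash-handling, with respect to the set `R` of reliable processes and the division `cls`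
of the control states into three classes: `δ₁` leads from class `one` to the classes `one` and
`two`, and `δ₂` is a smallest set of transitions with the three crash conditions. -/
def IsCrashHandling (S : FIFOSystem n m t) (R : Set (Fin n))
    (cls : ∀ p, S.State p → StateClass) : Prop :=
  ∀ p,
    (∀ τ ∈ S.delta1 p, cls p τ.1 = .one ∧ (cls p τ.2.2 = .one ∨ cls p τ.2.2 = .two)) ∧
    Minimal (fun D : Set (S.Trans p) =>
      S.CrashHandlingCond R cls p D ∧ S.CrashBroadcastCond R cls p D ∧
        S.CrashRedundancyCond cls p D) (S.delta2 p)

/-- The crash-free automata, with the transitions `δ₁`, are session automata: the system is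
obtained from communicating session automata by adding the transitions `δ₂`. -/
def GeneratedFromCSA (S : FIFOSystem n m t) : Prop :=
  ∀ p, S.IsSessionAutomaton (S.delta1 p)

end FIFOSystem

/-! # Inputs as words -/

/-- The number of a message. -/
def Msg.code {m : ℕ} : Msg m → ℕ
  | .crash => 0
  | .ordinary a => a + 1

/-- The number of an internal action name. -/
def IntName.code {t : ℕ} : IntName t → ℕ
  | .crash => 0
  | .ordinary a => a + 1

/-- The description of an action by four numbers. -/
def FIFOAction.code {n m t : ℕ} : FIFOAction n m t → List ℕ
  | .send c a => [0, c.src, c.dst, a.code]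
  | .recv c a => [1, c.src, c.dst, a.code]
  | .internal p i => [2, p, p, i.code]

/-- The description of a system by a list of numbers: the sizes, and for each process the number of
control states, the initial state, and the list of transitions, preceded by its length. -/
def FIFOSystem.code {n m t : ℕ} (S : FIFOSystem n m t) : List ℕ :=
  n :: m :: t :: (List.finRange n).flatMap fun p =>
    S.numStates p :: (S.init p : ℕ) :: (S.trans p).length ::
      (S.trans p).flatMap fun τ => (τ.1 : ℕ) :: (τ.2.1.code ++ [(τ.2.2 : ℕ)])

/-- A list of numbers as a word: each number in unary, followed by a separator. -/
def unaryWord (l : List ℕ) : List Bool :=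
  l.flatMap fun i => List.replicate i true ++ [false]

/-- The input word for a system and a bound `k`; both the (explicitly listed) finite sets of the
system and the bound `k` contribute their full size to the length of the word. -/
def FIFOSystem.inputWord {n m t : ℕ} (S : FIFOSystem n m t) (k : ℕ) : List Bool :=
  unaryWord (k :: S.code)

/-! # Decidability and polynomial space, for Mathlib's multi-stack Turing machines -/

/-- A deterministic machine with input and output alphabet `Bool`. -/
abbrev Machine : Type 1 := Turing.TM2ComputableAux Bool Bool

/-- The initial configuration of a machine on an input word. -/
def Machine.start (M : Machine) (x : List Bool) : M.tm.Cfg :=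
  Turing.initList M.tm (x.map M.inputAlphabet.invFun)

/-- On input `x` the machine halts with output `b`. -/
def Machine.Outputs (M : Machine) (x : List Bool) (b : Bool) : Prop :=
  Nonempty (Turing.TM2Outputs M.tm (x.map M.inputAlphabet.invFun)
    (some ((Computability.encodeBool b).map M.outputAlphabet.invFun)))

/-- The machine halts on each input word, and its output tells whether the word is in `L`. -/
def Machine.Decides (M : Machine) (L : Language Bool) : Prop :=
  ∀ x, (x ∈ L → M.Outputs x true) ∧ (x ∉ L → M.Outputs x false)

/-- The space used by a configuration: the number of symbols on all stacks. -/
def Machine.cfgSpace (M : Machine) (c : M.tm.Cfg) : ℕ :=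
  letI := M.tm.kFin
  ∑ i : M.tm.K, (c.stk i).length

/-- The machine works in space `s`: on an input of length `l` each configuration of the run uses at
most `s l` cells. -/
def Machine.WorksInSpace (M : Machine) (s : ℕ → ℕ) : Prop :=
  ∀ x c, StateTransition.Reaches M.tm.step (M.start x) c → M.cfgSpace c ≤ s x.length

/-- The decidable languages. -/
def DecidableLanguages : Set (Language Bool) := {L | ∃ M : Machine, M.Decides L}

/-- The complexity class PSPACE: the languages decided by a deterministic machine that works in
polynomial space. -/
def PSPACE : Set (Language Bool) :=
  {L | ∃ (M : Machine) (s : Polynomial ℕ), M.Decides L ∧ M.WorksInSpace fun l => s.eval l}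

/-! # Structured programs over stacks of bits -/

/-! A `k`-bounded configuration is a table with `n` control states and `n * n * k` channel cells,
and since `k` is given in unary, this table has polynomial size. It can thus be read as a number
with polynomially many digits. The step relation becomes an edge relation `NumEdge` on the numbers
below an exponentially large bound `numBound`, and deciding an edge needs only arithmetic and
bounded quantifiers. Both conditions of `k`-WMC quantify over such numbers and ask for reachability
between them, and by Savitch's theorem reachability in an exponentially large graph takes only
polynomial space. The language consists of the words whose number satisfies `NumReception` and
`NumExhaustive`.

To obtain an actual machine, small structured programs on stacks of bits are compiled to multi-stack
Turing machines (`Exec.reaches`). The class `PS` of functions between tuples of numbers that such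
programs compute in polynomial space is closed under composition and under iteration with
polynomially long intermediate values (`PS.iterate_aux`). The counter of an iteration is stored in
base two, so the number of rounds may be exponential. Hence `PS` admits recursion, arithmetic, and
quantifiers over exponentially large ranges. The recursion in Savitch's argument is unfolded into an
iteration of `midpointStep`, whose call stack is itself a number (`PSp.reflTransGen`).

Correctness rests on the relation `Represents` between numbers and bounded configurations: steps can
be transferred in both directions (`NumStep.exists_fires`, `Fires.numStep`), therefore also runs,
and finally the two conditions (`numReception_iff`, `numExhaustive_iff`). -/

namespace StackProg

/-- Structured programs over registers that hold stacks of bits. -/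
inductive Cmd : Type
  /-- do nothing -/
  | skip : Cmd
  /-- push a bit on a register -/
  | push (i : ℕ) (b : Bool) : Cmd
  /-- pop a bit from a register, and continue according to whether the register was empty, or the
  bit was `false` or `true` -/
  | pop (i : ℕ) (e f t : Cmd) : Cmd
  /-- one program after the other -/
  | seq (c d : Cmd) : Cmd
  /-- repeat while the register is nonempty -/
  | loop (i : ℕ) (c : Cmd) : Cmd

/-- Contents of the registers. -/
abbrev Store : Type := ℕ → List Bool

/-- All registers hold at most `B` bits. -/
def Store.Bdd (B : ℕ) (s : Store) : Prop := ∀ i, (s i).length ≤ B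

/-- Program `c` leads from `s` to `s'`, and no register ever holds more than `B` bits. -/
inductive Exec (B : ℕ) : Cmd → Store → Store → Prop
  | skip {s : Store} : s.Bdd B → Exec B .skip s s
  | push {s : Store} {i b} : s.Bdd B → Store.Bdd B (Function.update s i (b :: s i)) →
      Exec B (.push i b) s (Function.update s i (b :: s i))
  | popE {s s' : Store} {i e f t} : s i = [] → Exec B e s s' → Exec B (.pop i e f t) s s'
  | popF {s s' : Store} {i e f t l} : s i = false :: l → s.Bdd B → Exec B f (Function.update s i l) s' →
      Exec B (.pop i e f t) s s'
  | popT {s s' : Store} {i e f t l} : s i = true :: l → s.Bdd B → Exec B t (Function.update s i l) s' →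
      Exec B (.pop i e f t) s s'
  | seq {s s' s'' : Store} {c d} : Exec B c s s' → Exec B d s' s'' → Exec B (.seq c d) s s''
  | loopE {s : Store} {i c} : s i = [] → s.Bdd B → Exec B (.loop i c) s s
  | loopN {s s' s'' : Store} {i c} : s i ≠ [] → Exec B c s s' → Exec B (.loop i c) s' s'' →
      Exec B (.loop i c) s s''

theorem Exec.bdd_left {B c s s'} (h : Exec B c s s') : s.Bdd B := by
  induction h <;> assumption

theorem Exec.bdd_right {B c s s'} (h : Exec B c s s') : s'.Bdd B := by
  induction h <;> assumption

namespace Cmd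

/-- The program points. -/
def Lab : Cmd → Type
  | skip => Unit
  | push _ _ => Unit
  | pop _ e f t => Unit ⊕ e.Lab ⊕ f.Lab ⊕ t.Lab
  | seq c d => c.Lab ⊕ d.Lab
  | loop _ c => Unit ⊕ c.Lab

/-- The first program point. -/
def entry : (c : Cmd) → c.Lab
  | skip => ()
  | push _ _ => ()
  | pop _ _ _ _ => .inl ()
  | seq c _ => .inl c.entry
  | loop _ _ => .inl ()

/-- There are finitely many program points. -/
instance fintypeLab : (c : Cmd) → Fintype c.Lab
  | skip => inferInstanceAs (Fintype Unit)
  | push _ _ => inferInstanceAs (Fintype Unit)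
  | pop _ e f t =>
    letI := fintypeLab e
    letI := fintypeLab f
    letI := fintypeLab t
    inferInstanceAs (Fintype (Unit ⊕ e.Lab ⊕ f.Lab ⊕ t.Lab))
  | seq c d =>
    letI := fintypeLab c
    letI := fintypeLab d
    inferInstanceAs (Fintype (c.Lab ⊕ d.Lab))
  | loop _ c =>
    letI := fintypeLab c
    inferInstanceAs (Fintype (Unit ⊕ c.Lab))

/-- A number above all registers used. -/
def width : Cmd → ℕ
  | skip => 0
  | push i _ => i + 1
  | pop i e f t => max (i + 1) (max e.width (max f.width t.width))
  | seq c d => max c.width d.width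
  | loop i c => max (i + 1) c.width

/-- The stack for register `i` of a machine with `r + 1` stacks. -/
def _root_.StackProg.reg (r i : ℕ) : Fin (r + 1) := Fin.ofNat (r + 1) i

/-- The machine statement at a program point, where `emb` embeds the program points into the labels
of a machine, which goes on with label `x` after the program. -/
def stmt {Λ : Type} (r : ℕ) : (c : Cmd) → (c.Lab → Λ) → Λ → c.Lab →
    Turing.TM2.Stmt (fun _ : Fin (r + 1) => Bool) Λ (Option Bool)
  | skip, _, x, _ => .goto fun _ => x
  | push i b, _, x, _ => .push (reg r i) (fun _ => b) (.goto fun _ => x)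
  | pop i e f t, emb, _, .inl _ =>
    .pop (reg r i) (fun _ o => o) (.goto fun o => match o with
      | none => emb (.inr (.inl e.entry))
      | some false => emb (.inr (.inr (.inl f.entry)))
      | some true => emb (.inr (.inr (.inr t.entry))))
  | pop _ e _ _, emb, x, .inr (.inl l) => e.stmt r (fun l => emb (.inr (.inl l))) x l
  | pop _ _ f _, emb, x, .inr (.inr (.inl l)) =>
    f.stmt r (fun l => emb (.inr (.inr (.inl l)))) x l
  | pop _ _ _ t, emb, x, .inr (.inr (.inr l)) =>
    t.stmt r (fun l => emb (.inr (.inr (.inr l)))) x l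
  | seq c d, emb, _, .inl l => c.stmt r (fun l => emb (.inl l)) (emb (.inr d.entry)) l
  | seq _ d, emb, x, .inr l => d.stmt r (fun l => emb (.inr l)) x l
  | loop i c, emb, x, .inl _ =>
    .peek (reg r i) (fun _ o => o) (.goto fun o => match o with
      | none => x
      | some _ => emb (.inr c.entry))
  | loop _ c, emb, _, .inr l => c.stmt r (fun l => emb (.inr l)) (emb (.inl ())) l

end Cmd

/-! ### Simulation of programs by machines -/

/-- A step between machine configurations with at most `B` symbols on each stack. -/
def BStep {r : ℕ} {Λ : Type} (B : ℕ)
    (M : Λ → Turing.TM2.Stmt (fun _ : Fin (r + 1) => Bool) Λ (Option Bool))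
    (a b : Turing.TM2.Cfg (fun _ : Fin (r + 1) => Bool) Λ (Option Bool)) : Prop :=
  Turing.TM2.step M a = some b ∧ (∀ k, (a.stk k).length ≤ B) ∧ ∀ k, (b.stk k).length ≤ B

/-- The registers as the stacks of a machine. -/
def Store.stk (r : ℕ) (s : Store) : Fin (r + 1) → List Bool := fun k => s k

theorem Store.stk_update {r : ℕ} (s : Store) {i : ℕ} (hi : i < r + 1) (l : List Bool) :
    Store.stk r (Function.update s i l) =
      Function.update (Store.stk r s) (reg r i) l := by
  funext k
  by_cases h : k = reg r i
  · subst h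
    simp [Store.stk, reg, Nat.mod_eq_of_lt hi]
  · have : (k : ℕ) ≠ i := fun h' => h (by ext; simp [h', reg, Nat.mod_eq_of_lt hi])
    rw [Function.update_of_ne h]
    simp [Store.stk, this]

theorem Store.stk_apply {r : ℕ} (s : Store) {i : ℕ} (hi : i < r + 1) :
    Store.stk r s (reg r i) = s i := by
  simp [Store.stk, reg, Nat.mod_eq_of_lt hi]

theorem step_eq {r : ℕ} {Λ : Type}
    {M : Λ → Turing.TM2.Stmt (fun _ : Fin (r + 1) => Bool) Λ (Option Bool)} {l : Λ}
    {q : Turing.TM2.Stmt (fun _ : Fin (r + 1) => Bool) Λ (Option Bool)} (h : M l = q)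
    (v : Option Bool) (S : Fin (r + 1) → List Bool) :
    Turing.TM2.step M ⟨some l, v, S⟩ = some (Turing.TM2.stepAux q v S) := by
  rw [← h, Turing.TM2.step]

/-- A machine that contains the statements of a program simulates it. -/
theorem Exec.reaches {B c s s'} (h : Exec B c s s') {r : ℕ} (hr : c.width ≤ r + 1) {Λ : Type}
    (M : Λ → Turing.TM2.Stmt (fun _ : Fin (r + 1) => Bool) Λ (Option Bool)) (emb : c.Lab → Λ)
    (x : Λ) (hM : ∀ l, M (emb l) = c.stmt r emb x l) (v : Option Bool) :
    ∃ v', Relation.ReflTransGen (BStep B M) ⟨some (emb c.entry), v, Store.stk r s⟩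
      ⟨some x, v', Store.stk r s'⟩ := by
  -- The exit label varies: the first half of a sequence exits to the entry of the second half, and
  -- a loop body exits to the loop test. The internal value is the bit read last, which carries no
  -- information between program points.
  induction h generalizing x v with
  | skip hb =>
    refine ⟨v, .single ⟨?_, fun k => hb k, fun k => hb k⟩⟩
    refine (step_eq (hM ()) _ _).trans ?_
    simp [Cmd.stmt]
  | @push s i b hb hb' =>
    refine ⟨v, .single ⟨?_, fun k => hb k, fun k => hb' k⟩⟩
    have hi : i < r + 1 := hr
    refine (step_eq (hM ()) _ _).trans ?_
    simp [Cmd.stmt, Store.stk_update _ hi, Store.stk_apply _ hi]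
  | @popE s s' i e f t hs h ih =>
    simp only [Cmd.width, max_le_iff] at hr
    have hi : i < r + 1 := hr.1
    obtain ⟨v', hv⟩ := ih hr.2.1 (fun l => emb (.inr (.inl l))) x (fun l => hM _) none
    refine ⟨v', .head ⟨?_, fun k => h.bdd_left k, fun k => h.bdd_left k⟩ hv⟩
    refine (step_eq (hM (.inl ())) _ _).trans ?_
    -- A pop from an empty stack still writes back the tail, which is empty; after the rewriting,
    -- `hu` says that this changes nothing.
    have hu := Store.stk_update s hi []
    rw [← hs, Function.update_eq_self, hs] at hu
    simp [Cmd.stmt, Store.stk_apply _ hi, hs, ← hu]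
  | @popF s s' i e f t l hs hb h ih =>
    simp only [Cmd.width, max_le_iff] at hr
    have hi : i < r + 1 := hr.1
    obtain ⟨v', hv⟩ := ih hr.2.2.1 (fun l => emb (.inr (.inr (.inl l)))) x (fun l => hM _)
      (some false)
    refine ⟨v', .head ⟨?_, fun k => hb k, fun k => h.bdd_left k⟩ hv⟩
    refine (step_eq (hM (.inl ())) _ _).trans ?_
    simp [Cmd.stmt, Store.stk_update _ hi, Store.stk_apply _ hi, hs]
  | @popT s s' i e f t l hs hb h ih =>
    simp only [Cmd.width, max_le_iff] at hr
    have hi : i < r + 1 := hr.1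
    obtain ⟨v', hv⟩ := ih hr.2.2.2 (fun l => emb (.inr (.inr (.inr l)))) x (fun l => hM _)
      (some true)
    refine ⟨v', .head ⟨?_, fun k => hb k, fun k => h.bdd_left k⟩ hv⟩
    refine (step_eq (hM (.inl ())) _ _).trans ?_
    simp [Cmd.stmt, Store.stk_update _ hi, Store.stk_apply _ hi, hs]
  | @seq s s' s'' c d h₁ h₂ ih₁ ih₂ =>
    simp only [Cmd.width, max_le_iff] at hr
    obtain ⟨v₁, hv₁⟩ := ih₁ hr.1 (fun l => emb (.inl l)) (emb (.inr d.entry)) (fun l => hM _) v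
    obtain ⟨v₂, hv₂⟩ := ih₂ hr.2 (fun l => emb (.inr l)) x (fun l => hM _) v₁
    exact ⟨v₂, hv₁.trans hv₂⟩
  | @loopE s i c hs hb =>
    simp only [Cmd.width, max_le_iff] at hr
    have hi : i < r + 1 := hr.1
    refine ⟨none, .single ⟨?_, fun k => hb k, fun k => hb k⟩⟩
    refine (step_eq (hM (.inl ())) _ _).trans ?_
    simp [Cmd.stmt, Store.stk_apply _ hi, hs]
  | @loopN s s' s'' i c hs h₁ h₂ ih₁ ih₂ =>
    have hr' := hr
    simp only [Cmd.width, max_le_iff] at hr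
    have hi : i < r + 1 := hr.1
    obtain ⟨b, l, hs⟩ := List.exists_cons_of_ne_nil hs
    obtain ⟨v₁, hv₁⟩ := ih₁ hr.2 (fun l => emb (.inr l)) (emb (.inl ())) (fun l => hM _) (some b)
    obtain ⟨v₂, hv₂⟩ := ih₂ hr' emb x hM v₁
    refine ⟨v₂, .head ⟨?_, fun k => h₁.bdd_left k, fun k => h₁.bdd_left k⟩ (hv₁.trans hv₂)⟩
    refine (step_eq (hM (.inl ())) _ _).trans ?_
    simp [Cmd.stmt, Store.stk_apply _ hi, hs]

/-! ## Machines -/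

/-- The machine that runs a program. The input is in register `2`, the output in register `3`. -/
def machine (c : Cmd) : Machine where
  tm :=
    -- The added constant guarantees the input stack 2 and the output stack 3, whatever registers
    -- the program uses.
    { K := Fin (c.width + 3 + 1)
      k₀ := reg (c.width + 3) 2
      k₁ := reg (c.width + 3) 3
      Γ := fun _ => Bool
      Λ := Option c.Lab
      main := some c.entry
      σ := Option Bool
      initialState := none
      Γk₀Fin := inferInstanceAs (Fintype Bool)
      m := fun l => match l with
        -- A halting configuration in the sense of `Turing.haltList` has the initial internal value,
        -- so the bit read last is erased first.
        | none => .load (fun _ => none) .halt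
        | some l => c.stmt (c.width + 3) some none l }
  inputAlphabet := Equiv.refl _
  outputAlphabet := Equiv.refl _

/-- The store with one nonempty register. -/
def single (i : ℕ) (l : List Bool) : Store := Function.update (fun _ => []) i l

theorem machine_start (c : Cmd) (x : List Bool) :
    (machine c).start x = ⟨some (some c.entry), none, Store.stk (c.width + 3) (single 2 x)⟩ := by
  unfold Machine.start Turing.initList
  congr 1
  refine funext fun (k : Fin (c.width + 3 + 1)) => ?_
  have h2 : (2 : ℕ) < c.width + 3 + 1 := by omega
  refine Eq.trans ?_ (congrFun (Store.stk_update (fun _ => []) h2 x) k).symm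
  by_cases h : k = reg (c.width + 3) 2
  · subst h
    refine Eq.trans (dif_pos rfl) ?_
    simp [machine]
    rfl
  · rw [Function.update_of_ne h]
    exact dif_neg h

theorem machine_haltList (c : Cmd) (x : List Bool) :
    Turing.haltList (machine c).tm (x.map (machine c).outputAlphabet.invFun) =
      ⟨none, none, Store.stk (c.width + 3) (single 3 x)⟩ := by
  unfold Turing.haltList
  congr 1
  refine funext fun (k : Fin (c.width + 3 + 1)) => ?_
  have h2 : (3 : ℕ) < c.width + 3 + 1 := by omega
  refine Eq.trans ?_ (congrFun (Store.stk_update (fun _ => []) h2 x) k).symm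
  by_cases h : k = reg (c.width + 3) 3
  · subst h
    refine Eq.trans (dif_pos rfl) ?_
    simp [machine]
    rfl
  · rw [Function.update_of_ne h]
    exact dif_neg h

theorem machine_run {c : Cmd} {x y : List Bool} {B : ℕ} (h : Exec B c (single 2 x) (single 3 y)) :
    Relation.ReflTransGen (BStep B (machine c).tm.m) ((machine c).start x)
      ⟨none, none, Store.stk (c.width + 3) (single 3 y)⟩ := by
  obtain ⟨v, hv⟩ := h.reaches (r := c.width + 3) (by omega) (machine c).tm.m some none
    (fun l => rfl) none
  rw [machine_start]
  exact hv.tail ⟨rfl, fun k => h.bdd_right k, fun k => h.bdd_right k⟩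

theorem evalsTo_of_reflTransGen {σ : Type*} {f : σ → Option σ} {R : σ → σ → Prop}
    (hR : ∀ a b, R a b → f a = some b) {a b : σ} (h : Relation.ReflTransGen R a b) :
    Nonempty (StateTransition.EvalsTo f a (some b)) := by
  induction h with
  | refl => exact ⟨.refl _ _⟩
  | tail _ h ih => exact ih.map fun e => e.trans _ _ _ _ ⟨1, hR _ _ h⟩

theorem machine_outputs {c : Cmd} {x : List Bool} {b : Bool} {B : ℕ}
    (h : Exec B c (single 2 x) (single 3 [b])) : (machine c).Outputs x b := by
  unfold Machine.Outputs Turing.TM2Outputs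
  simp only [Option.map_some]
  rw [machine_haltList]
  exact evalsTo_of_reflTransGen (fun _ _ h => h.1) (machine_run h)

/-- Along a deterministic run to a halting state, an invariant of the run holds everywhere. -/
theorem forall_reaches_of_run {σ : Type*} {f : σ → Option σ} {P : σ → Prop} {a b : σ}
    (h : Relation.ReflTransGen (fun a b => f a = some b ∧ P a ∧ P b) a b) (hb : f b = none)
    (hP : P b) {c : σ} (hc : StateTransition.Reaches f a c) : P c := by
  induction h using Relation.ReflTransGen.head_induction_on with
  | refl =>
    rcases Relation.ReflTransGen.cases_head hc with rfl | ⟨d, hd, -⟩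
    · exact hP
    · simp [hb] at hd
  | head h _ ih =>
    rcases Relation.ReflTransGen.cases_head hc with rfl | ⟨d, hd, hd'⟩
    · exact h.2.1
    · rw [Option.mem_def, h.1, Option.some.injEq] at hd
      exact ih (hd ▸ hd')

/-- By determinism each reachable configuration lies on the run from `machine_run`, and there each
of the `c.width + 4` stacks holds at most `B` symbols. -/
theorem machine_space {c : Cmd} {x y : List Bool} {B : ℕ}
    (h : Exec B c (single 2 x) (single 3 y)) {d : (machine c).tm.Cfg}
    (hd : StateTransition.Reaches (machine c).tm.step ((machine c).start x) d) :
    (machine c).cfgSpace d ≤ (c.width + 4) * B := by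
  have := forall_reaches_of_run (f := (machine c).tm.step)
    (P := fun d => ∀ k : Fin (c.width + 3 + 1), (d.stk k).length ≤ B) (machine_run h) rfl
    (fun k => h.bdd_right k) hd
  refine (Finset.sum_le_card_nsmul _ _ B fun k _ => this k).trans (le_of_eq ?_)
  change Fintype.card (Fin (c.width + 3 + 1)) * B = _
  rw [Fintype.card_fin]

/-- A language is in PSPACE if a structured program decides it, with a polynomial bound on the
number of bits in each register. -/
theorem mem_PSPACE_of_exec {L : Language Bool} (c : Cmd) (P : Polynomial ℕ)
    (h₁ : ∀ x ∈ L, Exec (P.eval x.length) c (single 2 x) (single 3 [true]))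
    (h₀ : ∀ x ∉ L, Exec (P.eval x.length) c (single 2 x) (single 3 [false])) : L ∈ PSPACE := by
  refine ⟨machine c, Polynomial.C (c.width + 4) * P, fun x => ⟨fun hx => machine_outputs (h₁ x hx),
    fun hx => machine_outputs (h₀ x hx)⟩, fun x d hd => ?_⟩
  simp only [Polynomial.eval_mul, Polynomial.eval_C]
  by_cases hx : x ∈ L
  · exact machine_space (h₁ x hx) hd
  · exact machine_space (h₀ x hx) hd

theorem mem_DecidableLanguages_of_mem_PSPACE {L : Language Bool} (h : L ∈ PSPACE) :
    L ∈ DecidableLanguages :=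
  let ⟨M, _, hM, _⟩ := h
  ⟨M, hM⟩

/-! ## Numbers in bijective base two -/

/-- Successor of a number in bijective base two, least significant digit first; the digits `1` and
`2` are `false` and `true`. -/
def incL : List Bool → List Bool
  | [] => [false]
  | false :: l => true :: l
  | true :: l => false :: incL l

/-- The value of a word in bijective base two. -/
def val : List Bool → ℕ
  | [] => 0
  | false :: l => 2 * val l + 1
  | true :: l => 2 * val l + 2

/-- The word for a number in bijective base two. -/
def enc : ℕ → List Bool
  | 0 => []
  | n + 1 => incL (enc n)

theorem val_incL (l : List Bool) : val (incL l) = val l + 1 := by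
  induction l with
  | nil => rfl
  | cons b l ih => cases b <;> simp [incL, val, ih]; omega

@[simp] theorem val_enc (n : ℕ) : val (enc n) = n := by
  induction n with
  | zero => rfl
  | succ n ih => rw [enc, val_incL, ih]

/-- Bijective base two has no leading zeros, so words and numbers correspond one to one. An input
word therefore is a number without loss of information, and a register is empty exactly when its
number is zero, which makes `loop` a test for zero. -/
theorem val_injective : Function.Injective val := by
  intro l
  induction l with
  | nil => intro l' h; rcases l' with _ | ⟨_ | _, _⟩ <;> simp [val] at h ⊢
  | cons b l ih =>
    intro l' h
    rcases l' with _ | ⟨b', l'⟩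
    · cases b <;> simp [val] at h
    · cases b <;> cases b' <;> simp [val] at h ⊢
      · exact ih h
      · omega
      · omega
      · exact ih h

@[simp] theorem enc_val (l : List Bool) : enc (val l) = l := val_injective (val_enc _)

/-- The number of digits of a number in bijective base two. -/
def blen (n : ℕ) : ℕ := (enc n).length

/-- The words of length `r` denote exactly the numbers from `2 ^ r - 1` to `2 ^ (r + 1) - 2`. -/
theorem two_pow_length_le (l : List Bool) :
    2 ^ l.length ≤ val l + 1 ∧ val l + 2 ≤ 2 ^ (l.length + 1) := by
  induction l with
  | nil => simp [val]
  | cons b l ih =>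
    cases b <;> simp only [val, List.length_cons, pow_succ] at ih ⊢ <;> omega

theorem two_pow_blen_le (n : ℕ) : 2 ^ blen n ≤ n + 1 := by
  simpa [blen] using (two_pow_length_le (enc n)).1

theorem lt_two_pow_blen (n : ℕ) : n + 1 < 2 ^ (blen n + 1) := by
  have := (two_pow_length_le (enc n)).2
  rw [val_enc] at this
  exact this

theorem blen_le_of_lt {n k : ℕ} (h : n < 2 ^ k) : blen n ≤ k :=
  (Nat.pow_le_pow_iff_right (by norm_num)).1 ((two_pow_blen_le n).trans h)

theorem blen_mono {m n : ℕ} (h : m ≤ n) : blen m ≤ blen n := by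
  have h₁ := two_pow_blen_le m
  have h₂ := lt_two_pow_blen n
  have : 2 ^ blen m < 2 ^ (blen n + 1) := by omega
  have := (Nat.pow_lt_pow_iff_right (by norm_num : 1 < 2)).1 this
  omega

theorem blen_le_self (n : ℕ) : blen n ≤ n := blen_le_of_lt n.lt_two_pow_self

theorem enc_succ_ne_nil (n : ℕ) : enc (n + 1) ≠ [] := by
  intro h
  have := val_enc (n + 1)
  simp [h, val] at this

/-! ## Basic programs -/

theorem Store.Bdd.update {B : ℕ} {s : Store} (h : s.Bdd B) (i : ℕ) {l : List Bool}
    (hl : l.length ≤ B) : Store.Bdd B (Function.update s i l) := by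
  intro j
  rw [Function.update_apply]
  split_ifs
  exacts [hl, h j]

theorem Store.Bdd.of_cons {B : ℕ} {s : Store} (h : s.Bdd B) {i : ℕ} {b : Bool} {l : List Bool}
    (hl : s i = b :: l) : l.length + 1 ≤ B := by
  simpa [hl] using h i

theorem Exec.congr {B c s t t'} (h : Exec B c s t) (ht : t = t') : Exec B c s t' := ht ▸ h

/-- Empty a register. -/
def clear (i : ℕ) : Cmd := .loop i (.pop i .skip .skip .skip)

theorem exec_clear {B : ℕ} (i : ℕ) {s : Store} (h : s.Bdd B) :
    Exec B (clear i) s (Function.update s i []) := by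
  generalize hl : s i = l
  induction l generalizing s with
  | nil => exact (Exec.loopE hl h).congr (by rw [← hl, Function.update_eq_self])
  | cons b l ih =>
    have hb : Store.Bdd B (Function.update s i l) :=
      h.update i (by have := h.of_cons hl; omega)
    refine .loopN (s' := Function.update s i l) (by simp [hl]) ?_
      ((ih hb (by simp)).congr (by simp))
    cases b
    · exact .popF hl h (.skip hb)
    · exact .popT hl h (.skip hb)

/-- Pour the contents of a register into another one. -/
def pour (i j : ℕ) : Cmd := .loop i (.pop i .skip (.push j false) (.push j true))

theorem exec_pour {B i j : ℕ} (hij : i ≠ j) {s : Store} (h : s.Bdd B)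
    (hB : (s i).length + (s j).length ≤ B) : Exec B (pour i j) s
      (Function.update (Function.update s i []) j ((s i).reverse ++ s j)) := by
  generalize hl : s i = l at hB
  induction l generalizing s with
  | nil =>
    refine (Exec.loopE hl h).congr ?_
    rw [← hl, Function.update_eq_self, hl]
    simp
  | cons b l ih =>
    have hb : Store.Bdd B (Function.update s i l) :=
      h.update i (by have := h.of_cons hl; omega)
    simp only [List.length_cons] at hB
    have hb' : Store.Bdd B (Function.update (Function.update s i l) j (b :: s j)) :=
      hb.update j (by simp; omega)
    have hu : Function.update s i l j = s j := Function.update_of_ne hij.symm _ _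
    refine .loopN (s' := Function.update (Function.update s i l) j (b :: s j)) (by simp [hl]) ?_
      ((ih hb' (by simp [hij]) (by simp; omega)).congr ?_)
    · cases b
      · exact .popF hl h (hu ▸ .push hb (by rwa [hu]))
      · exact .popT hl h (hu ▸ .push hb (by rwa [hu]))
    · funext x
      simp only [Function.update_apply]
      split_ifs <;> simp

/-- Move the contents of a register to an empty register, through register `0`. -/
def move (i j : ℕ) : Cmd := .seq (pour i 0) (pour 0 j)

theorem exec_move {B i j : ℕ} (hi : i ≠ 0) (hj : j ≠ 0) {s : Store} (h : s.Bdd B)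
    (h0 : s 0 = []) (hsj : s j = []) :
    Exec B (move i j) s (Function.update (Function.update s i []) j (s i)) := by
  have h₁ := exec_pour hi h (by simpa [h0] using h i)
  by_cases hij : i = j
  · subst hij
    refine .seq h₁ ((exec_pour hj.symm h₁.bdd_right (by simp [hj, hsj, h0])).congr ?_)
    funext x
    simp only [Function.update_apply]
    split_ifs <;> simp_all
  · refine .seq h₁ ((exec_pour hj.symm h₁.bdd_right ?_).congr ?_)
    · simpa [h0, hj, hsj, Function.update_apply, Ne.symm hij] using h i
    · funext x
      simp only [Function.update_apply]
      split_ifs <;> simp_all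

/-- Pour register `0` into two registers. -/
def pourTwo (i j : ℕ) : Cmd :=
  .loop 0 (.pop 0 .skip (.seq (.push i false) (.push j false)) (.seq (.push i true) (.push j true)))

theorem exec_pourTwo {B i j : ℕ} (hi : i ≠ 0) (hj : j ≠ 0) (hij : i ≠ j) {s : Store} (h : s.Bdd B)
    (hBi : (s 0).length + (s i).length ≤ B) (hBj : (s 0).length + (s j).length ≤ B) :
    Exec B (pourTwo i j) s (Function.update (Function.update (Function.update s 0 []) i
      ((s 0).reverse ++ s i)) j ((s 0).reverse ++ s j)) := by
  generalize hl : s 0 = l at hBi hBj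
  induction l generalizing s with
  | nil =>
    refine (Exec.loopE hl h).congr ?_
    rw [← hl, Function.update_eq_self, hl]
    simp
  | cons b l ih =>
    have hb : Store.Bdd B (Function.update s 0 l) :=
      h.update 0 (by have := h.of_cons hl; omega)
    simp only [List.length_cons] at hBi hBj
    have hb₁ : Store.Bdd B (Function.update (Function.update s 0 l) i (b :: s i)) :=
      hb.update i (by simp; omega)
    have hb₂ : Store.Bdd B (Function.update (Function.update (Function.update s 0 l) i (b :: s i))
      j (b :: s j)) := hb₁.update j (by simp; omega)
    have hu : Function.update s 0 l i = s i := Function.update_of_ne hi _ _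
    have hu' : Function.update (Function.update s 0 l) i (b :: s i) j = s j := by
      simp [hij.symm, hj]
    refine .loopN (s' := Function.update (Function.update (Function.update s 0 l) i (b :: s i))
      j (b :: s j)) (by simp [hl]) ?_ ((ih hb₂ (by simp [hi.symm, hj.symm])
        (by simp [hij]; omega) (by simp; omega)).congr ?_)
    · have := Exec.seq (Exec.push (i := i) (b := b) hb (by rwa [hu]))
        (Exec.push (i := j) (b := b) (by rwa [hu]) (by rwa [hu, hu']))
      rw [hu, hu'] at this
      cases b
      · exact .popF hl h this
      · exact .popT hl h this
    · funext x
      simp only [Function.update_apply]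
      split_ifs <;> simp_all

/-- Copy the contents of a register to an empty register, through register `0`. -/
def copy (i j : ℕ) : Cmd := .seq (pour i 0) (pourTwo i j)

theorem exec_copy {B i j : ℕ} (hi : i ≠ 0) (hj : j ≠ 0) (hij : i ≠ j) {s : Store} (h : s.Bdd B)
    (h0 : s 0 = []) (hsj : s j = []) :
    Exec B (copy i j) s (Function.update s j (s i)) := by
  have h₁ := exec_pour hi h (by simpa [h0] using h i)
  have := h i
  refine .seq h₁ ((exec_pourTwo hi hj hij h₁.bdd_right ?_ ?_).congr ?_)
  · simpa [h0, hi]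
  · simpa [h0, hi, hj, hij.symm, hsj]
  · funext x
    simp only [Function.update_apply]
    split_ifs <;> simp_all

/-- The scan for the successor: register `1` is the flag, register `0` takes the digits `1` that
replace the leading digits `2`. -/
def incScan (i : ℕ) : Cmd :=
  .loop 1 (.pop i (.seq (clear 1) (.push i false)) (.seq (clear 1) (.push i true)) (.push 0 false))

/-- The carry passes through the leading digits `2`. They become the block `z` of digits `1`, which
waits in reverse on register `0`, while `l'` starts with the digit where the carry stops. Pouring
register `0` back yields `z ++ l'`. -/
theorem exec_incScan {B i : ℕ} (hi : 2 ≤ i) {s : Store} (h : s.Bdd B) (h1 : s 1 = [true])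
    (hB : (s 0).length + (incL (s i)).length ≤ B) : ∃ z l', incL (s i) = z ++ l' ∧
      Exec B (incScan i) s (Function.update (Function.update (Function.update s 1 []) i l') 0
        (z.reverse ++ s 0)) := by
  have hi0 : i ≠ 0 := by omega
  have hi1 : i ≠ 1 := by omega
  generalize hl : s i = l at hB
  have key : ∀ (b : Bool) (u : List Bool), u.length < B → Exec B (.seq (clear 1) (.push i b))
      (Function.update s i u) (Function.update (Function.update s 1 []) i (b :: u)) := by
    intro b u hu
    have hb : Store.Bdd B (Function.update s i u) := h.update i hu.le
    have h₁ := exec_clear 1 hb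
    refine (Exec.seq h₁ (Exec.push h₁.bdd_right ?_)).congr ?_
    · simpa [hi1] using h₁.bdd_right.update i (l := b :: u) hu
    · funext x
      simp only [Function.update_apply]
      split_ifs <;> simp_all
  have hend : ∀ u : List Bool, u.length ≤ B → Exec B (incScan i)
      (Function.update (Function.update s 1 []) i u)
      (Function.update (Function.update (Function.update s 1 []) i u) 0 (s 0)) := by
    intro u hu
    refine (Exec.loopE (by simp [hi1.symm]) ((h.update 1 (by simp)).update i hu)).congr ?_
    funext x
    simp only [Function.update_apply]
    split_ifs <;> simp_all
  induction l generalizing s with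
  | nil =>
    simp only [incL, List.length_singleton] at hB
    have := key false [] (by simp; omega)
    rw [← hl, Function.update_eq_self, hl] at this
    exact ⟨[], [false], rfl, .loopN (by simp [h1]) (.popE hl this) (hend _ (by simp; omega))⟩
  | cons b l ih =>
    cases b
    · simp only [incL, List.length_cons] at hB
      exact ⟨[], true :: l, rfl, .loopN (by simp [h1]) (.popF hl h (key true l (by omega)))
        (hend _ (by simp; omega))⟩
    · simp only [incL, List.length_cons] at hB
      have hb : Store.Bdd B (Function.update s i l) :=
        h.update i (by have := h.of_cons hl; omega)
      have hb' : Store.Bdd B (Function.update (Function.update s i l) 0 (false :: s 0)) :=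
        hb.update 0 (by simp; omega)
      have hu : Function.update s i l 0 = s 0 := by simp [hi0.symm]
      obtain ⟨z, l', hz, he⟩ := ih hb' (by simp [h1, hi1.symm]) (by simp [hi0]) (by simp; omega)
        -- `key` and `hend` mention the store, so the induction hypothesis asks for them again at
        -- the new store.
        (fun b u hu => by
          refine (Exec.seq (exec_clear 1 (hb'.update i hu.le)) (.push ?_ ?_)).congr ?_
          · exact (hb'.update i hu.le).update 1 (by simp)
          · exact ((hb'.update i hu.le).update 1 (by simp)).update i (by simpa [hi1] using hu)
          · funext x
            simp only [Function.update_apply]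
            split_ifs <;> simp_all)
        (fun u hu => by
          refine (Exec.loopE (by simp [hi1.symm]) ((hb'.update 1 (by simp)).update i hu)).congr ?_
          funext x
          simp only [Function.update_apply]
          split_ifs <;> simp_all)
      refine ⟨false :: z, l', by simp [incL, hz], .loopN (by simp [h1])
        (.popT hl h (.push hb (by rwa [hu]))) ((hu ▸ he).congr ?_)⟩
      funext x
      simp only [Function.update_apply]
      split_ifs <;> simp_all

/-- Increment a register. -/
def inc (i : ℕ) : Cmd := .seq (.push 1 true) (.seq (incScan i) (pour 0 i))

theorem exec_inc {B i n : ℕ} (hi : 2 ≤ i) {s : Store} (h : s.Bdd B) (h0 : s 0 = []) (h1 : s 1 = [])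
    (hn : s i = enc n) (hB : blen (n + 1) ≤ B) :
    Exec B (inc i) s (Function.update s i (enc (n + 1))) := by
  have hi0 : i ≠ 0 := by omega
  have hi1 : i ≠ 1 := by omega
  have hpos : 1 ≤ blen (n + 1) := List.length_pos_of_ne_nil (enc_succ_ne_nil n)
  have hb : Store.Bdd B (Function.update s 1 [true]) := h.update 1 (by simp; omega)
  have hlen : (incL (enc n)).length ≤ B := hB
  obtain ⟨z, l', hz, he⟩ := exec_incScan hi hb (by simp) (by simpa [h0, hi1, hn] using hlen)
  simp only [ne_eq, hi1, not_false_eq_true, Function.update_of_ne, hn] at hz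
  refine .seq (h1 ▸ .push h (by rwa [h1])) (.seq he ((exec_pour hi0.symm he.bdd_right ?_).congr ?_))
  · rw [hz] at hlen
    simpa [h0, hi0] using hlen
  · funext x
    simp only [Function.update_apply, enc, hz]
    split_ifs <;> simp_all

/-- The scan for the predecessor: register `1` is the flag, register `0` takes the digits `2` that
replace the leading digits `1`. -/
def decScan (i : ℕ) : Cmd :=
  .loop 1 (.pop i (.seq (clear 1) (.pop 0 .skip .skip .skip)) (.push 0 true)
    (.seq (clear 1) (.push i false)))

/-- The borrow passes through the leading digits `1`, which become `2`, up to the first digit `2`,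
which becomes `1`. If there is none, all digits were `1` and the predecessor is one digit shorter;
this is why the program then discards one digit from register `0`. -/
theorem exec_decScan {B i : ℕ} (hi : 2 ≤ i) {s : Store} (h : s.Bdd B) (h1 : s 1 = [true])
    {m : List Bool} (hm : s i = incL m) (hB : (s 0).length + (incL m).length ≤ B) :
    ∃ z l', m = z.reverse ++ l' ∧
      Exec B (decScan i) s (Function.update (Function.update (Function.update s 1 []) i l') 0
        (z ++ s 0)) := by
  have hi0 : i ≠ 0 := by omega
  have hi1 : i ≠ 1 := by omega
  have hend : ∀ {t : Store}, t.Bdd B → t 1 = [] → Exec B (decScan i) t t :=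
    fun ht ht1 => .loopE ht1 ht
  induction m generalizing s with
  | nil =>
    simp only [incL, List.length_singleton] at hB hm
    have hb : Store.Bdd B (Function.update s i []) := h.update i (by simp)
    have hb' : Store.Bdd B (Function.update (Function.update s i []) 0 (true :: s 0)) :=
      hb.update 0 (by simp; omega)
    have hu : Function.update s i [] 0 = s 0 := by simp [hi0.symm]
    have hc := exec_clear 1 hb'
    refine ⟨[], [], rfl, .loopN (by simp [h1]) (.popF hm h (.push hb (by rwa [hu])))
      (.loopN (by simp [hi1.symm, h1]) (.popE (by simp [hi0]) (.seq (hu ▸ hc)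
        (.popT (l := s 0) (by simp) hc.bdd_right (.skip ?_)))) ((hend ?_ (by simp)).congr ?_))⟩
    · exact hc.bdd_right.update 0 (h 0)
    · exact hc.bdd_right.update 0 (h 0)
    · funext x
      simp only [Function.update_apply]
      split_ifs <;> simp_all
  | cons b m ih =>
    cases b
    · simp only [incL, List.length_cons] at hB hm
      have hb : Store.Bdd B (Function.update s i m) := h.update i (by omega)
      have hc := exec_clear 1 hb
      have hb' : Store.Bdd B (Function.update (Function.update (Function.update s i m) 1 [])
        i (false :: m)) := hc.bdd_right.update i (by simp; omega)
      have hu : Function.update (Function.update s i m) 1 [] i = m := by simp [hi1]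
      refine ⟨[], false :: m, rfl, .loopN (by simp [h1]) (.popT hm h
        (.seq hc (.push hc.bdd_right (by rwa [hu])))) ((hend (by rwa [hu]) ?_).congr ?_)⟩
      · simp [hi1.symm]
      · funext x
        simp only [Function.update_apply]
        split_ifs <;> simp_all
    · simp only [incL, List.length_cons] at hB hm
      have hb : Store.Bdd B (Function.update s i (incL m)) := h.update i (by omega)
      have hb' : Store.Bdd B (Function.update (Function.update s i (incL m)) 0 (true :: s 0)) :=
        hb.update 0 (by simp; omega)
      have hu : Function.update s i (incL m) 0 = s 0 := by simp [hi0.symm]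
      obtain ⟨z, l', hz, he⟩ := ih hb' (by simp [h1, hi1.symm]) (by simp [hi0])
        (by simp; omega)
      refine ⟨z ++ [true], l', by simp [hz], .loopN (by simp [h1])
        (.popF hm h (.push hb (by rwa [hu]))) ((hu ▸ he).congr ?_)⟩
      funext x
      simp only [Function.update_apply]
      split_ifs <;> simp_all

/-- Decrement a nonempty register. -/
def dec (i : ℕ) : Cmd := .seq (.push 1 true) (.seq (decScan i) (pour 0 i))

theorem exec_dec {B i n : ℕ} (hi : 2 ≤ i) {s : Store} (h : s.Bdd B) (h0 : s 0 = []) (h1 : s 1 = [])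
    (hn : s i = enc (n + 1)) : Exec B (dec i) s (Function.update s i (enc n)) := by
  have hi0 : i ≠ 0 := by omega
  have hi1 : i ≠ 1 := by omega
  have hlen : (enc (n + 1)).length ≤ B := by simpa [hn] using h i
  have hpos : 1 ≤ (enc (n + 1)).length := List.length_pos_of_ne_nil (enc_succ_ne_nil n)
  have hb : Store.Bdd B (Function.update s 1 [true]) := h.update 1 (by simp; omega)
  obtain ⟨z, l', hz, he⟩ := exec_decScan hi hb (by simp) (m := enc n) (by simpa [hi1])
    (by simpa [h0] using show (incL (enc n)).length ≤ B from hlen)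
  refine .seq (h1 ▸ .push h (by rwa [h1])) (.seq he ((exec_pour hi0.symm he.bdd_right ?_).congr ?_))
  · have := congrArg List.length hz
    have hle : (enc n).length ≤ (enc (n + 1)).length := blen_mono (Nat.le_succ n)
    simp only [List.length_append, List.length_reverse] at this
    simp [h0, hi0]
    omega
  · funext x
    simp only [Function.update_apply, hz]
    split_ifs <;> simp_all

/-! ## Functions between tuples of numbers that are computable in polynomial space -/

/-- Types whose elements are tuples of numbers. -/
class Ctx (α : Type) where
  /-- the number of components -/
  len : ℕ
  /-- the components -/
  get : α → ℕ → ℕ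

/-- A number is a tuple with one component. -/
instance Ctx.nat : Ctx ℕ := ⟨1, fun n _ => n⟩

/-- Tuples are concatenated. -/
instance Ctx.prod {α β : Type} [Ctx α] [Ctx β] : Ctx (α × β) :=
  ⟨len α + len β, fun x i => if i < len α then get x.1 i else get x.2 (i - len α)⟩

open Ctx

section

variable {α β γ : Type} [Ctx α] [Ctx β] [Ctx γ]

/-- The number of digits of the largest component. -/
def size (a : α) : ℕ := (Finset.range (len α)).sup fun i => blen (get a i)

theorem blen_get_le_size (a : α) {i : ℕ} (hi : i < len α) : blen (get a i) ≤ size a :=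
  Finset.le_sup (f := fun i => blen (get a i)) (Finset.mem_range.2 hi)

theorem size_le_iff {a : α} {n : ℕ} : size a ≤ n ↔ ∀ i < len α, blen (get a i) ≤ n := by
  simp [size]

@[simp] theorem size_nat (n : ℕ) : size n = blen n := by
  apply le_antisymm
  · exact size_le_iff.2 fun i _ => le_rfl
  · exact blen_get_le_size n (i := 0) Nat.one_pos

@[simp] theorem size_prod (a : α) (b : β) : size (a, b) = max (size a) (size b) := by
  apply le_antisymm
  · refine size_le_iff.2 fun i hi => ?_
    change i < len α + len β at hi
    change blen (if i < len α then get a i else get b (i - len α)) ≤ _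
    split_ifs with h
    · exact (blen_get_le_size a h).trans (le_max_left _ _)
    · exact (blen_get_le_size b (by omega)).trans (le_max_right _ _)
  · refine max_le (size_le_iff.2 fun i hi => ?_) (size_le_iff.2 fun i hi => ?_)
    · have := blen_get_le_size (a, b) (i := i) (show i < len α + len β by omega)
      change blen (if i < len α then get a i else get b (i - len α)) ≤ _ at this
      rwa [if_pos hi] at this
    · have := blen_get_le_size (a, b) (i := len α + i) (show len α + i < len α + len β by omega)
      change blen (if len α + i < len α then get a (len α + i) else get b (len α + i - len α)) ≤ _
        at this
      rwa [if_neg (by omega), Nat.add_sub_cancel_left] at this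

/-- Write a tuple into the registers from `o` on. -/
def Store.write (s : Store) (o : ℕ) (b : β) : Store :=
  fun j => if o ≤ j ∧ j < o + len β then enc (get b (j - o)) else s j

/-- Put empty words into `n` registers from `o` on. -/
def Store.erase (s : Store) (o n : ℕ) : Store :=
  fun j => if o ≤ j ∧ j < o + n then [] else s j

/-- The registers from `d` on hold a tuple. -/
def Store.Reads (s : Store) (d : ℕ) (a : α) : Prop := ∀ i < len α, s (d + i) = enc (get a i)

/-- A tuple of numbers as a function of a tuple of numbers is computable in polynomial space: there
is a program with inputs in registers from `d` on, outputs in registers from `o` on, and workspace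
from `w` on, which in addition uses the registers `0` and `1`. -/
def PS (f : α → β) : Prop :=
  ∃ (c : ℕ → ℕ → ℕ → Cmd) (e : ℕ), ∀ d o w, 2 ≤ d → 2 ≤ o → d + len α ≤ w → o + len β ≤ w →
    (d + len α ≤ o ∨ o + len β ≤ d) → ∀ (a : α) (s : Store) (B : ℕ), (size a + 2) ^ e ≤ B →
      s.Bdd B → s 0 = [] → s 1 = [] → s.Reads d a → (∀ j, o ≤ j → j < o + len β → s j = []) →
        (∀ j, w ≤ j → s j = []) → Exec B (c d o w) s (s.write o (f a))

theorem Store.write_of_not {s : Store} {o : ℕ} {b : β} {j : ℕ} (h : ¬(o ≤ j ∧ j < o + len β)) :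
    s.write o b j = s j := if_neg h

theorem Store.reads_write (s : Store) (o : ℕ) (b : β) : (s.write o b).Reads o b := by
  intro i hi
  rw [Store.write, if_pos (by omega), Nat.add_sub_cancel_left]

theorem Store.Reads.congr {s t : Store} {d : ℕ} {a : α} (h : s.Reads d a)
    (ht : ∀ j, d ≤ j → j < d + len α → t j = s j) : t.Reads d a :=
  fun i hi => (ht _ (by omega) (by omega)).trans (h i hi)

theorem le_pow_add_two (n e : ℕ) : n ≤ (n + 2) ^ (e + 1) := by
  calc n ≤ (n + 2) ^ 1 := by rw [pow_one]; omega
    _ ≤ _ := Nat.pow_le_pow_right (by omega) (by omega)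

/-- Polynomial bounds compose: since the base is at least `2`, the summand `2` is absorbed by a
factor `(n + 2) ^ 2`. -/
theorem pow_le_pow_of_le {n m e e' : ℕ} (h : m ≤ (n + 2) ^ e) :
    (m + 2) ^ e' ≤ (n + 2) ^ ((e + 2) * e') := by
  rw [pow_mul]
  refine Nat.pow_le_pow_left ?_ _
  have h₁ : 1 ≤ (n + 2) ^ e := Nat.one_le_pow _ _ (by omega)
  have h₂ : (n + 2) ^ e * 2 ^ 2 ≤ (n + 2) ^ e * (n + 2) ^ 2 :=
    Nat.mul_le_mul_left _ (Nat.pow_le_pow_left (by omega) _)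
  rw [pow_add]
  omega

theorem pow_le_pow_max_left (n e e' : ℕ) : (n + 2) ^ e ≤ (n + 2) ^ (max e e') :=
  Nat.pow_le_pow_right (by omega) (le_max_left _ _)

theorem pow_le_pow_max_right (n e e' : ℕ) : (n + 2) ^ e' ≤ (n + 2) ^ (max e e') :=
  Nat.pow_le_pow_right (by omega) (le_max_right _ _)

/-- The values of a function that is computable in polynomial space have polynomial length. -/
theorem PS.growth {f : α → β} (hf : PS f) : ∃ e, ∀ a, size (f a) ≤ (size a + 2) ^ e := by
  obtain ⟨c, e, hc⟩ := hf
  refine ⟨e + 1, fun a => size_le_iff.2 fun i hi => ?_⟩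
  have hB := le_pow_add_two (size a) e
  -- Run the program on a store that holds only the input. The results are in registers at the end,
  -- so they obey the space bound. The exponent `e + 1` leaves room for the input itself even if `e
  -- = 0`.
  set s : Store := Store.write (fun _ => []) 2 a with hs
  have hb : s.Bdd ((size a + 2) ^ (e + 1)) := by
    intro j
    rw [hs, Store.write]
    split_ifs with h
    · exact (blen_get_le_size a (by omega)).trans hB
    · simp
  have := (hc 2 (2 + len α) (2 + len α + len β) le_rfl (by omega) (by omega) le_rfl (by omega) a s
    _ (Nat.pow_le_pow_right (by omega) (Nat.le_succ e)) hb (Store.write_of_not (by omega))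
    (Store.write_of_not (by omega)) (Store.reads_write _ _ _)
    (fun j h _ => Store.write_of_not (by omega)) (fun j h => Store.write_of_not (by omega))).bdd_right
    (2 + len α + i)
  rwa [Store.reads_write _ _ _ i hi] at this

/-! ### Programs for blocks of registers -/

/-- Clear `n` registers. -/
def clearBlock (o : ℕ) : ℕ → Cmd
  | 0 => .skip
  | n + 1 => .seq (clearBlock o n) (clear (o + n))

theorem exec_clearBlock {B : ℕ} (o n : ℕ) {s : Store} (h : s.Bdd B) :
    Exec B (clearBlock o n) s (s.erase o n) := by
  induction n with
  | zero => exact (Exec.skip h).congr (by funext j; rw [Store.erase, if_neg (by omega)])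
  | succ n ih =>
    refine .seq ih ((exec_clear _ ih.bdd_right).congr ?_)
    funext j
    simp only [Function.update_apply, Store.erase]
    split_ifs <;> first | rfl | omega

/-- Copy `n` registers. -/
def copyBlock (d o : ℕ) : ℕ → Cmd
  | 0 => .skip
  | n + 1 => .seq (copyBlock d o n) (copy (d + n) (o + n))

theorem exec_copyBlock {B d o n : ℕ} (hd : 2 ≤ d) (ho : 2 ≤ o) (hdo : d + n ≤ o ∨ o + n ≤ d)
    {s : Store} (h : s.Bdd B) (h0 : s 0 = []) (hs : ∀ j, o ≤ j → j < o + n → s j = []) :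
    Exec B (copyBlock d o n) s (fun j => if o ≤ j ∧ j < o + n then s (d + (j - o)) else s j) := by
  induction n with
  | zero => exact (Exec.skip h).congr (by funext j; rw [if_neg (by omega)])
  | succ n ih =>
    have ih := ih (by omega) fun j h₁ h₂ => hs j h₁ (by omega)
    refine .seq ih ((exec_copy (by omega) (by omega) (by omega) ih.bdd_right ?_ ?_).congr ?_)
    · rw [if_neg (by omega), h0]
    · simpa using hs (o + n) (by omega) (by omega)
    · funext j
      rw [Function.update_apply]
      by_cases hj : j = o + n
      · subst hj
        rw [if_pos rfl, if_neg (by omega), if_pos (by omega), Nat.add_sub_cancel_left]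
      · rw [if_neg hj]
        exact if_congr (by omega) rfl rfl

/-- Move `n` registers. -/
def moveBlock (d o : ℕ) : ℕ → Cmd
  | 0 => .skip
  | n + 1 => .seq (moveBlock d o n) (move (d + n) (o + n))

theorem exec_moveBlock {B d o n : ℕ} (hd : 2 ≤ d) (ho : 2 ≤ o) (hdo : d + n ≤ o ∨ o + n ≤ d)
    {s : Store} (h : s.Bdd B) (h0 : s 0 = []) (hs : ∀ j, o ≤ j → j < o + n → s j = []) :
    Exec B (moveBlock d o n) s (fun j => if o ≤ j ∧ j < o + n then s (d + (j - o)) else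
      if d ≤ j ∧ j < d + n then [] else s j) := by
  induction n with
  | zero => exact (Exec.skip h).congr (by funext j; rw [if_neg (by omega), if_neg (by omega)])
  | succ n ih =>
    have ih := ih (by omega) fun j h₁ h₂ => hs j h₁ (by omega)
    refine .seq ih ((exec_move (by omega) (by omega) ih.bdd_right ?_ ?_).congr ?_)
    · rw [if_neg (by omega), if_neg (by omega), h0]
    · rw [if_neg (by omega), if_neg (by omega), hs (o + n) (by omega) (by omega)]
    · funext j
      simp only [Function.update_apply]
      by_cases hj : j = o + n
      · subst hj
        rw [if_pos rfl, if_neg (by omega), if_neg (by omega), if_pos (by omega),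
          Nat.add_sub_cancel_left]
      · rw [if_neg hj]
        by_cases hj' : j = d + n
        · rw [if_pos hj', if_neg (by omega), if_pos (by omega)]
        · rw [if_neg hj']
          exact if_congr (by omega) rfl (if_congr (by omega) rfl rfl)

/-! ### Closure properties -/

/-- A block of the input is computable. -/
theorem PS.block {f : α → β} (k : ℕ) (hk : k + len β ≤ len α)
    (h : ∀ a, ∀ i < len β, get (f a) i = get a (k + i)) : PS f := by
  refine ⟨fun d o w => copyBlock (d + k) o (len β), 0, ?_⟩
  intro d o w hd ho hdw how hdo a s B _ hs h0 h1 hr hso hsw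
  refine (exec_copyBlock (by omega) ho (by omega) hs h0 hso).congr ?_
  funext j
  rw [Store.write]
  split_ifs with hj
  · rw [h a _ (by omega), ← hr _ (by omega)]
    congr 1
    omega
  · rfl

theorem PS.id : PS (fun a : α => a) := PS.block 0 (by omega) (by simp)

theorem PS.fst' : PS (fun x : α × β => x.1) := by
  refine PS.block 0 (show 0 + len α ≤ len α + len β by omega) fun a i hi => ?_
  change _ = if 0 + i < len α then _ else _
  rw [Nat.zero_add, if_pos hi]

theorem PS.snd' : PS (fun x : α × β => x.2) := by
  refine PS.block (len α) (show len α + len β ≤ len α + len β by omega) fun a i hi => ?_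
  change _ = if len α + i < len α then _ else _
  rw [if_neg (by omega), Nat.add_sub_cancel_left]

theorem PS.zero : PS (fun _ : α => 0) := by
  refine ⟨fun d o w => .skip, 0, ?_⟩
  intro d o w hd ho hdw how hdo a s B _ hs h0 h1 hr hso hsw
  refine (Exec.skip hs).congr ?_
  funext j
  rw [Store.write]
  split_ifs with hj
  · exact hso j hj.1 hj.2
  · rfl

theorem PS.succ' : PS Nat.succ := by
  refine ⟨fun d o w => .seq (copy d o) (inc o), 1, ?_⟩
  intro d o w hd ho hdw how hdo a s B hB hs h0 h1 hr hso hsw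
  have hl : len ℕ = 1 := rfl
  rw [hl] at hdw how hdo hso
  have h₁ := exec_copy (i := d) (j := o) (by omega) (by omega) (by omega) hs h0
    (hso o le_rfl (by omega))
  have ha : s d = enc a := hr 0 Nat.one_pos
  refine .seq h₁ ((exec_inc ho h₁.bdd_right (n := a) ?_ ?_ ?_ ?_).congr ?_)
  · simpa [show 0 ≠ o by omega] using h0
  · simpa [show 1 ≠ o by omega] using h1
  · simpa using ha
  · refine le_trans (blen_le_of_lt ?_) hB
    have := lt_two_pow_blen a
    rw [size_nat, pow_one, pow_succ]
    omega
  · funext j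
    rw [Store.write, hl, Function.update_apply, Function.update_apply]
    split_ifs <;> first | rfl | omega

/-- A program changes nothing but its output block, so the second one again finds the input in place
and the workspace empty. -/
theorem PS.pair {f : α → β} {g : α → γ} (hf : PS f) (hg : PS g) : PS (fun a => (f a, g a)) := by
  obtain ⟨cf, ef, hcf⟩ := hf
  obtain ⟨cg, eg, hcg⟩ := hg
  refine ⟨fun d o w => .seq (cf d o w) (cg d (o + len β) w), max ef eg, ?_⟩
  have hl : len (β × γ) = len β + len γ := rfl
  intro d o w hd ho hdw how hdo a s B hB hs h0 h1 hr hso hsw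
  rw [hl] at how hdo hso
  have h₁ := hcf d o w hd ho hdw (by omega) (by omega) a s B
    ((pow_le_pow_max_left _ _ _).trans hB) hs h0 h1 hr (fun j _ _ => hso j (by omega) (by omega)) hsw
  refine .seq h₁ ((hcg d (o + len β) w hd (by omega) hdw (by omega) (by omega) a _ B
    ((pow_le_pow_max_right _ _ _).trans hB) h₁.bdd_right ?_ ?_
    (hr.congr fun j _ _ => Store.write_of_not (by omega)) (fun j _ _ => ?_) (fun j _ => ?_)).congr ?_)
  · rw [Store.write_of_not (by omega), h0]
  · rw [Store.write_of_not (by omega), h1]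
  · rw [Store.write_of_not (by omega), hso j (by omega) (by omega)]
  · rw [Store.write_of_not (by omega), hsw j (by omega)]
  · funext j
    simp only [Store.write]
    change _ = if o ≤ j ∧ j < o + (len β + len γ) then enc (if j - o < len β then get (f a) (j - o) else
      get (g a) (j - o - len β)) else _
    rw [Nat.sub_sub]
    split_ifs <;> first | rfl | omega

/-- The intermediate value is kept at the start of the workspace and erased at the end. By
`PS.growth` its length is polynomial in that of the input, so the space bound for `f` stays
polynomial. -/
theorem PS.comp {f : β → γ} {g : α → β} (hf : PS f) (hg : PS g) : PS (fun a => f (g a)) := by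
  obtain ⟨e, he⟩ := hg.growth
  obtain ⟨cf, ef, hcf⟩ := hf
  obtain ⟨cg, eg, hcg⟩ := hg
  refine ⟨fun d o w => .seq (cg d w (w + len β)) (.seq (cf w o (w + len β)) (clearBlock w (len β))),
    max eg ((e + 2) * ef), ?_⟩
  intro d o w hd ho hdw how hdo a s B hB hs h0 h1 hr hso hsw
  have h₁ := hcg d w (w + len β) hd (by omega) (by omega) (by omega) (by omega) a s B
    ((pow_le_pow_max_left _ _ _).trans hB) hs h0 h1 hr (fun j _ _ => hsw j (by omega))
    (fun j _ => hsw j (by omega))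
  have h₂ := hcf w o (w + len β) (by omega) ho (by omega) (by omega) (by omega) (g a) _ B
    ((pow_le_pow_of_le (he a)).trans ((pow_le_pow_max_right _ _ _).trans hB)) h₁.bdd_right
    (by rw [Store.write_of_not (by omega), h0]) (by rw [Store.write_of_not (by omega), h1])
    (Store.reads_write _ _ _)
    (fun j _ _ => by rw [Store.write_of_not (by omega), hso j (by omega) (by omega)])
    (fun j _ => by rw [Store.write_of_not (by omega), hsw j (by omega)])
  refine .seq h₁ (.seq h₂ ((exec_clearBlock _ _ h₂.bdd_right).congr ?_))
  funext j
  simp only [Store.write, Store.erase]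
  split_ifs <;> first | rfl | omega | (rw [hsw j (by omega)])

theorem PS.fst {f : α → β × γ} (hf : PS f) : PS (fun a => (f a).1) := PS.fst'.comp hf

theorem PS.snd {f : α → β × γ} (hf : PS f) : PS (fun a => (f a).2) := PS.snd'.comp hf

theorem PS.succ {f : α → ℕ} (hf : PS f) : PS (fun a => f a + 1) := PS.succ'.comp hf

theorem PS.const (n : ℕ) : PS (fun _ : α => n) := by
  induction n with
  | zero => exact .zero
  | succ n ih => exact ih.succ

/-- The store of the loop for an iteration: the parameters, the state and the counter. -/
def loopStore (s : Store) (w : ℕ) (a : α) (b : β) (n : ℕ) : Store := s.write w ((a, b), n)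

/-- The workspace holds the parameters, the current state and a counter in base two; the next state
is computed behind them and then moved over the current one. Only the lengths of the states matter:
the number of rounds can be exponential. -/
theorem PS.iterate_aux {f : α × β → β} {n : α → ℕ} {g : α → β} (hf : PS f) (hg : PS g) (hn : PS n)
    (hb : ∃ e, ∀ a, ∀ i ≤ n a, size ((fun b => f (a, b))^[i] (g a)) ≤ (size a + 2) ^ e) :
    PS (fun a => (fun b => f (a, b))^[n a] (g a)) := by
  obtain ⟨e, he⟩ := hb
  obtain ⟨cf, ef, hcf⟩ := hf
  have hst : PS (fun a => ((a, g a), n a)) := (PS.id.pair hg).pair hn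
  obtain ⟨ci, ei, hci⟩ := hst
  set A := len α with hA
  set S := len β with hS
  have hl : len ((α × β) × ℕ) = A + S + 1 := rfl
  have hl' : len (α × β) = A + S := rfl
  refine ⟨fun d o w => .seq (ci d w (w + (A + S + 1)))
    (.seq (.loop (w + (A + S)) (.seq (dec (w + (A + S))) (.seq
      (cf w (w + (A + S + 1)) (w + (A + S + 1) + S)) (.seq (clearBlock (w + A) S)
        (moveBlock (w + (A + S + 1)) (w + A) S)))))
    (.seq (moveBlock (w + A) o S) (clearBlock w A))), max ei ((e + 1 + 2) * ef), ?_⟩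
  intro d o w hd ho hdw how hdo a s B hB hs h0 h1 hr hso hsw
  have h₁ := hci d w (w + (A + S + 1)) hd (by omega) (by omega) (by omega) (by omega) a s B
    ((pow_le_pow_max_left _ _ _).trans hB) hs h0 h1 hr (fun j _ _ => hsw j (by omega))
    (fun j _ => hsw j (by omega))
  have hval : ∀ (b : β) (k j : ℕ), loopStore s w a b k j =
      if w ≤ j ∧ j < w + A then enc (get a (j - w)) else
      if w + A ≤ j ∧ j < w + (A + S) then enc (get b (j - (w + A))) else
      if j = w + (A + S) then enc k else s j := by
    intro b k j
    rw [loopStore, Store.write]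
    change (if w ≤ j ∧ j < w + (A + S + 1) then
      enc (if j - w < A + S then if j - w < A then get a (j - w) else get b (j - w - A) else k)
      else s j) = _
    rw [Nat.sub_sub]
    split_ifs <;> first | rfl | omega
  have key : ∀ (k : ℕ) (b : β),
      (∀ i ≤ k, size ((fun b => f (a, b))^[i] b) ≤ (size a + 2) ^ e) →
      (loopStore s w a b k).Bdd B →
      Exec B (.loop (w + (A + S)) (.seq (dec (w + (A + S))) (.seq
        (cf w (w + (A + S + 1)) (w + (A + S + 1) + S)) (.seq (clearBlock (w + A) S)
          (moveBlock (w + (A + S + 1)) (w + A) S))))) (loopStore s w a b k)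
        (loopStore s w a ((fun b => f (a, b))^[k] b) 0) := by
    intro k
    induction k with
    | zero =>
      intro b _ hb
      refine .loopE ?_ hb
      rw [hval, if_neg (by omega), if_neg (by omega), if_pos rfl]
      rfl
    | succ k ih =>
      intro b hsz hb
      have hc : loopStore s w a b (k + 1) (w + (A + S)) = enc (k + 1) := by
        rw [hval, if_neg (by omega), if_neg (by omega), if_pos rfl]
      have z0 : ∀ b k, loopStore s w a b k 0 = [] := fun b k => by
        rw [hval, if_neg (by omega), if_neg (by omega), if_neg (by omega), h0]
      have z1 : ∀ b k, loopStore s w a b k 1 = [] := fun b k => by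
        rw [hval, if_neg (by omega), if_neg (by omega), if_neg (by omega), h1]
      have zw : ∀ b k j, w + (A + S + 1) ≤ j → loopStore s w a b k j = [] := fun b k j hj => by
        rw [hval, if_neg (by omega), if_neg (by omega), if_neg (by omega), hsw j (by omega)]
      have e₁ : Exec B (dec (w + (A + S))) (loopStore s w a b (k + 1)) (loopStore s w a b k) := by
        refine (exec_dec (by omega) hb (z0 _ _) (z1 _ _) hc).congr ?_
        funext j
        rw [Function.update_apply, hval, hval]
        split_ifs <;> first | rfl | omega
      have hsize : (size (a, b) + 2) ^ ef ≤ B := by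
        -- The input of `f` is the pair of parameters and state; with exponent `e + 1` one bound
        -- covers both.
        refine le_trans (pow_le_pow_of_le (e := e + 1) ?_) ((pow_le_pow_max_right _ _ _).trans hB)
        rw [size_prod]
        exact max_le (le_pow_add_two _ _) ((hsz 0 (by omega)).trans
          (Nat.pow_le_pow_right (by omega) (by omega)))
      have e₂ := hcf w (w + (A + S + 1)) (w + (A + S + 1) + S) (by omega) (by omega) (by omega)
        (by omega) (by omega) (a, b) (loopStore s w a b k) B hsize e₁.bdd_right (z0 _ _) (z1 _ _)
        (fun i hi => by
          change i < A + S at hi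
          change _ = enc (if i < A then get a i else get b (i - A))
          rw [hval]
          split_ifs <;> first | omega | (congr 2; omega))
        (fun j _ _ => zw _ _ _ (by omega)) (fun j _ => zw _ _ _ (by omega))
      have e₃ := exec_clearBlock (w + A) S e₂.bdd_right
      have e₄ := exec_moveBlock (d := w + (A + S + 1)) (o := w + A) (n := S) (by omega) (by omega)
        (by omega) e₃.bdd_right
        (by rw [Store.erase, if_neg (by omega), Store.write_of_not (by omega), z0])
        (fun j _ _ => by rw [Store.erase, if_pos (by omega)])
      have e₅ := e₄.congr (t' := loopStore s w a (f (a, b)) k) <| by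
        funext j
        simp only [Store.erase, Store.write, hval, ← hS]
        by_cases c₁ : w + A ≤ j ∧ j < w + A + S
        · rw [if_pos c₁, if_neg (by omega), if_pos (by omega), if_neg (by omega), if_pos (by omega)]
          congr 2
          omega
        · rw [if_neg c₁]
          split_ifs <;> first | rfl | omega | rw [hsw j (by omega)]
      refine .loopN (by rw [hc]; exact enc_succ_ne_nil k)
        (.seq e₁ (.seq e₂ (.seq e₃ e₅))) ?_
      rw [Function.iterate_succ_apply]
      exact ih _ (fun i hi => hsz (i + 1) (by omega)) e₅.bdd_right
  have h₂ := key (n a) (g a) (he a) h₁.bdd_right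
  set r := (fun b => f (a, b))^[n a] (g a) with hr'
  have h₃ := exec_moveBlock (d := w + A) (o := o) (n := S) (by omega) ho (by omega) h₂.bdd_right
    (by rw [hval, if_neg (by omega), if_neg (by omega), if_neg (by omega), h0])
    (fun j _ _ => by
      rw [hval, if_neg (by omega), if_neg (by omega), if_neg (by omega), hso j (by omega) (by omega)])
  refine .seq h₁ (.seq h₂ (.seq h₃ ((exec_clearBlock w A h₃.bdd_right).congr ?_)))
  funext j
  simp only [Store.erase, Store.write, hval, ← hS]
  by_cases c₁ : o ≤ j ∧ j < o + S
  · rw [if_neg (by omega), if_pos c₁, if_pos c₁, if_neg (by omega), if_pos (by omega)]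
    congr 2
    omega
  · rw [if_neg c₁, if_neg c₁]
    by_cases c₂ : w ≤ j
    · rw [hsw j c₂]
      split_ifs <;> first | rfl | omega
    · split_ifs <;> first | rfl | omega

end

section

variable {α β γ : Type} [Ctx α] [Ctx β] [Ctx γ]

/-! ### Recursion -/

theorem PS.iterate {f : α → β → β} {n : α → ℕ} {g : α → β} (hf : PS fun x : α × β => f x.1 x.2)
    (hg : PS g) (hn : PS n)
    (hb : ∃ e, ∀ a, ∀ i ≤ n a, size ((f a)^[i] (g a)) ≤ (size a + 2) ^ e) :
    PS fun a => (f a)^[n a] (g a) :=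
  PS.iterate_aux hf hg hn hb

theorem iterate_succ_pair (f : ℕ → ℕ → ℕ) (g n : ℕ) :
    (fun x : ℕ × ℕ => (x.1 + 1, f x.1 x.2))^[n] (0, g) = (n, Nat.rec g f n) := by
  induction n with
  | zero => rfl
  | succ n ih => rw [Function.iterate_succ_apply', ih]

/-- Recursion is iteration on pairs of the index and the value reached. The index needs no more
digits than `n a`. -/
theorem PS.natRec {f : α → ℕ → ℕ → ℕ} {n g : α → ℕ}
    (hf : PS fun x : α × ℕ × ℕ => f x.1 x.2.1 x.2.2) (hg : PS g) (hn : PS n)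
    (hb : ∃ e, ∀ a, ∀ i ≤ n a,
      blen (Nat.rec (motive := fun _ => ℕ) (g a) (f a) i) ≤ (size a + 2) ^ e) :
    PS fun a => Nat.rec (motive := fun _ => ℕ) (g a) (f a) (n a) := by
  obtain ⟨e, he⟩ := hb
  obtain ⟨e', he'⟩ := hn.growth
  have := PS.iterate (f := fun a (x : ℕ × ℕ) => (x.1 + 1, f a x.1 x.2)) (g := fun a => (0, g a))
    ((PS.snd'.fst.succ).pair hf) (PS.zero.pair hg) hn ⟨max e e', fun a i hi => by
      rw [iterate_succ_pair, size_prod, size_nat, size_nat]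
      refine max_le (((blen_mono hi).trans ?_).trans (pow_le_pow_max_right _ _ _))
        ((he a i hi).trans (pow_le_pow_max_left _ _ _))
      simpa using he' a⟩
  refine PS.comp PS.snd' (g := fun a => (n a, Nat.rec (motive := fun _ => ℕ) (g a) (f a) (n a))) ?_
  simpa only [iterate_succ_pair] using this

/-- A computable majorant has polynomial length by `PS.growth`, which supplies the length bound that
`PS.natRec` requires. -/
theorem PS.natRec_le {f : α → ℕ → ℕ → ℕ} {n g : α → ℕ} (b : α → ℕ)
    (hf : PS fun x : α × ℕ × ℕ => f x.1 x.2.1 x.2.2) (hg : PS g) (hn : PS n) (hb : PS b)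
    (h : ∀ a, ∀ i ≤ n a, Nat.rec (motive := fun _ => ℕ) (g a) (f a) i ≤ b a) :
    PS fun a => Nat.rec (motive := fun _ => ℕ) (g a) (f a) (n a) := by
  obtain ⟨e, he⟩ := hb.growth
  exact PS.natRec hf hg hn ⟨e, fun a i hi => (blen_mono (h a i hi)).trans (by simpa using he a)⟩

/-! ### Arithmetic -/

theorem PS.pred {f : α → ℕ} (hf : PS f) : PS fun a => f a - 1 := by
  have h : ∀ n : ℕ, Nat.rec (motive := fun _ => ℕ) 0 (fun i _ => i) n = n - 1 := by
    intro n; cases n <;> rfl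
  have := PS.natRec_le (f := fun (_ : α) i _ => i) f PS.snd'.fst PS.zero hf hf
    fun a i hi => by rw [h]; omega
  simpa only [h] using this

theorem PS.add {f g : α → ℕ} (hf : PS f) (hg : PS g) : PS fun a => f a + g a := by
  have h : ∀ m n : ℕ, Nat.rec (motive := fun _ => ℕ) m (fun _ r => r + 1) n = m + n := by
    intro m n
    induction n with
    | zero => rfl
    | succ n ih => rw [← add_assoc, ← ih]
  have := PS.natRec (f := fun (_ : ℕ × ℕ) _ r => r + 1) (n := fun x => x.2) (g := fun x => x.1)
    PS.snd'.snd.succ PS.fst' PS.snd' ⟨2, fun ⟨x, y⟩ i hi => by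
      rw [h, size_prod, size_nat, size_nat]
      have h₁ := lt_two_pow_blen x
      have h₂ := lt_two_pow_blen y
      have h₃ : 2 ^ (blen x + 1) ≤ 2 ^ (max (blen x) (blen y) + 1) :=
        Nat.pow_le_pow_right (by omega) (by omega)
      have h₄ : 2 ^ (blen y + 1) ≤ 2 ^ (max (blen x) (blen y) + 1) :=
        Nat.pow_le_pow_right (by omega) (by omega)
      refine (blen_le_of_lt (k := max (blen x) (blen y) + 1 + 1) ?_).trans (by nlinarith)
      rw [pow_succ]
      simp only at hi
      omega⟩
  simp only [h] at this
  exact this.comp (hf.pair hg)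

theorem PS.sub {f g : α → ℕ} (hf : PS f) (hg : PS g) : PS fun a => f a - g a := by
  have h : ∀ m n : ℕ, Nat.rec (motive := fun _ => ℕ) m (fun _ r => r - 1) n = m - n := by
    intro m n
    induction n with
    | zero => rfl
    | succ n ih => rw [Nat.sub_add_eq, ← ih]
  have := PS.natRec_le (f := fun (_ : α) _ r => r - 1) f PS.snd'.snd.pred hf hg hf
    fun a i hi => by rw [h]; omega
  simpa only [h] using this

theorem blen_mul_le (x y : ℕ) : blen (x * y) ≤ blen x + blen y + 2 := by
  refine blen_le_of_lt ?_
  have h₁ := lt_two_pow_blen x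
  have h₂ := lt_two_pow_blen y
  calc x * y ≤ x * 2 ^ (blen y + 1) := Nat.mul_le_mul_left _ (by omega)
    _ < 2 ^ (blen x + 1) * 2 ^ (blen y + 1) := Nat.mul_lt_mul_of_pos_right (by omega) (by positivity)
    _ = _ := by rw [← pow_add]; congr 1; omega

theorem PS.mul {f g : α → ℕ} (hf : PS f) (hg : PS g) : PS fun a => f a * g a := by
  have h : ∀ m n : ℕ, Nat.rec (motive := fun _ => ℕ) 0 (fun _ r => r + m) n = m * n := by
    intro m n
    induction n with
    | zero => rfl
    | succ n ih => rw [mul_add, mul_one, ← ih]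
  have := PS.natRec (f := fun (x : ℕ × ℕ) _ r => r + x.1) (n := fun x => x.2) (g := fun x => 0)
    (PS.snd'.snd.add PS.fst'.fst) PS.zero PS.snd' ⟨2, fun ⟨x, y⟩ i hi => by
      rw [h, size_prod, size_nat, size_nat]
      have h₁ := blen_mul_le x i
      have h₂ : blen i ≤ blen y := blen_mono hi
      have h₃ := le_max_left (blen x) (blen y)
      have h₄ := le_max_right (blen x) (blen y)
      nlinarith⟩
  simp only [h] at this
  exact this.comp (hf.pair hg)

/-! ### Predicates -/

open Classical in
/-- The truth value of a proposition. -/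
noncomputable def ind (p : Prop) : ℕ := if p then 1 else 0

theorem ind_pos {p : Prop} (h : p) : ind p = 1 := if_pos h

theorem ind_neg {p : Prop} (h : ¬p) : ind p = 0 := if_neg h

/-- A predicate that is decidable in polynomial space. -/
def PSp (p : α → Prop) : Prop := PS fun a => ind (p a)

theorem PSp.comp {p : β → Prop} (hp : PSp p) {f : α → β} (hf : PS f) : PSp fun a => p (f a) :=
  PS.comp (f := fun b => ind (p b)) hp hf

theorem PSp.of_eq {p q : α → Prop} (hp : PSp p) (h : ∀ a, p a ↔ q a) : PSp q := by
  have : p = q := funext fun a => propext (h a)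
  exact this ▸ hp

theorem PS.of_eq {f g : α → β} (hf : PS f) (h : ∀ a, f a = g a) : PS g := by
  have : f = g := funext h
  exact this ▸ hf

theorem PSp.le {f g : α → ℕ} (hf : PS f) (hg : PS g) : PSp fun a => f a ≤ g a := by
  refine PS.of_eq ((PS.const 1).sub (hf.sub hg)) fun a => ?_
  by_cases h : f a ≤ g a
  · rw [ind_pos h]; omega
  · rw [ind_neg h]; omega

theorem PSp.not {p : α → Prop} (hp : PSp p) : PSp fun a => ¬p a := by
  refine PS.of_eq ((PS.const 1).sub hp) fun a => ?_
  by_cases h : p a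
  · rw [ind_pos h, ind_neg (not_not.2 h)]
  · rw [ind_neg h, ind_pos h]

theorem PSp.and {p q : α → Prop} (hp : PSp p) (hq : PSp q) : PSp fun a => p a ∧ q a := by
  refine PS.of_eq (PS.mul hp hq) fun a => ?_
  by_cases h : p a <;> by_cases h' : q a <;> simp [ind, h, h']

theorem PSp.or {p q : α → Prop} (hp : PSp p) (hq : PSp q) : PSp fun a => p a ∨ q a :=
  (hp.not.and hq.not).not.of_eq fun a => by tauto

theorem PSp.imp {p q : α → Prop} (hp : PSp p) (hq : PSp q) : PSp fun a => p a → q a :=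
  (hp.not.or hq).of_eq fun a => by tauto

theorem PSp.lt {f g : α → ℕ} (hf : PS f) (hg : PS g) : PSp fun a => f a < g a :=
  (PSp.le hg hf).not.of_eq fun a => by omega

theorem PSp.eq {f g : α → ℕ} (hf : PS f) (hg : PS g) : PSp fun a => f a = g a :=
  ((PSp.le hf hg).and (PSp.le hg hf)).of_eq fun a => by omega

theorem PSp.ne {f g : α → ℕ} (hf : PS f) (hg : PS g) : PSp fun a => f a ≠ g a :=
  (PSp.eq hf hg).not

theorem PS.ite {p : α → Prop} [DecidablePred p] {f g : α → ℕ} (hp : PSp p) (hf : PS f)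
    (hg : PS g) : PS fun a => if p a then f a else g a := by
  refine PS.of_eq ((PS.mul hp hf).add (PS.mul hp.not hg)) fun a => ?_
  by_cases h : p a <;> simp [ind, h]

open Classical in
-- A search reuses its space for each candidate and remembers only one truth value, so its range may
-- be exponentially large.
theorem PSp.ex {p : α → ℕ → Prop} {n : α → ℕ} (hn : PS n) (hp : PSp fun x : α × ℕ => p x.1 x.2) :
    PSp fun a => ∃ i < n a, p a i := by
  have h : ∀ a n, Nat.rec (motive := fun _ => ℕ) 0 (fun i r => if p a i then 1 else r) n =
      ind (∃ i < n, p a i) := by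
    intro a n
    induction n with
    | zero => simp [ind]
    | succ n ih =>
      simp only [ih]
      by_cases hpn : p a n
      · rw [if_pos hpn, ind_pos ⟨n, by omega, hpn⟩]
      · rw [if_neg hpn]
        congr 1
        refine propext ⟨fun ⟨i, hi, h⟩ => ⟨i, by omega, h⟩, fun ⟨i, hi, h⟩ => ⟨i, ?_, h⟩⟩
        rcases Nat.lt_succ_iff_lt_or_eq.1 hi with hi | rfl
        exacts [hi, absurd h hpn]
  have := PS.natRec_le (f := fun a i r => if p a i then 1 else r) (g := fun _ => 0) (fun _ => 1)
    (PS.ite (p := fun x : α × ℕ × ℕ => p x.1 x.2.1) (hp.comp (PS.fst'.pair PS.snd'.fst))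
      (PS.const 1) PS.snd'.snd) PS.zero hn (PS.const 1)
    fun a i hi => by rw [h, ind]; split_ifs <;> omega
  exact PS.of_eq this fun a => h a _

theorem PSp.all {p : α → ℕ → Prop} {n : α → ℕ} (hn : PS n) (hp : PSp fun x : α × ℕ => p x.1 x.2) :
    PSp fun a => ∀ i < n a, p a i :=
  (PSp.ex (p := fun a i => ¬p a i) hn hp.not).not.of_eq fun a => by simp

/-- A function with a graph that is decidable in polynomial space. -/
theorem PS.of_graph {f b : α → ℕ} (hb : PS b) (hf : PSp fun x : α × ℕ => x.2 = f x.1)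
    (h : ∀ a, f a ≤ b a) : PS f := by
  have h' : ∀ a n, Nat.rec (motive := fun _ => ℕ) 0 (fun i r => if i = f a then i else r) n =
      if f a < n then f a else 0 := by
    intro a n
    induction n with
    | zero => simp
    | succ n ih =>
      simp only [ih]
      split_ifs <;> omega
  -- The search tries all indices up to and including `b a`, hence the successor in the number of
  -- rounds.
  have := PS.natRec_le (f := fun a i r => if i = f a then i else r) (g := fun _ => 0) b
    (PS.ite (p := fun x : α × ℕ × ℕ => x.2.1 = f x.1) (hf.comp (PS.fst'.pair PS.snd'.fst))
      PS.snd'.fst PS.snd'.snd) PS.zero hb.succ hb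
    fun a i hi => by rw [h']; have := h a; split_ifs <;> omega
  refine this.of_eq fun a => ?_
  exact (h' a _).trans (if_pos (Nat.lt_succ_of_le (h a)))

theorem PS.div {f g : α → ℕ} (hf : PS f) (hg : PS g) : PS fun a => f a / g a := by
  refine PS.of_graph hf ?_ fun a => Nat.div_le_self _ _
  have hf' : PS fun x : α × ℕ => f x.1 := hf.comp PS.fst'
  have hg' : PS fun x : α × ℕ => g x.1 := hg.comp PS.fst'
  have hy : PS fun x : α × ℕ => x.2 := PS.snd'
  -- The usual inequalities pin down the quotient only for a positive divisor; division by zero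
  -- gives `0`.
  refine (((PSp.eq hg' PS.zero).and (PSp.eq hy PS.zero)).or ((PSp.ne hg' PS.zero).and
    ((PSp.le (hy.mul hg') hf').and (PSp.lt hf' (hy.succ.mul hg'))))).of_eq fun ⟨a, y⟩ => ?_
  simp only
  rcases Nat.eq_zero_or_pos (g a) with h | h
  · simp [h]
  · have : y = f a / g a ↔ y * g a ≤ f a ∧ f a < (y + 1) * g a := by
      rw [← Nat.le_div_iff_mul_le h, ← Nat.div_lt_iff_lt_mul h]
      omega
    rw [this]
    simp [h.ne']

theorem PS.mod {f g : α → ℕ} (hf : PS f) (hg : PS g) : PS fun a => f a % g a :=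
  (hf.sub (hg.mul (hf.div hg))).of_eq fun a => by
    have := Nat.div_add_mod (f a) (g a)
    omega

/-! ### Digits -/

/-- The number without its first `i` digits. -/
def dropDigits (x i : ℕ) : ℕ := val ((enc x).drop i)

theorem dropDigits_zero (x : ℕ) : dropDigits x 0 = x := by simp [dropDigits]

/-- The numbers `2 * v + 1` and `2 * v + 2` both lose their first digit to become `v`; truncated
subtraction takes care of the empty word. This makes digits accessible to arithmetic. -/
theorem val_tail (l : List Bool) : val l.tail = (val l - 1) / 2 := by
  rcases l with _ | ⟨_ | _, l⟩ <;> simp [val]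
  omega

theorem dropDigits_succ (x i : ℕ) : dropDigits x (i + 1) = (dropDigits x i - 1) / 2 := by
  rw [dropDigits, dropDigits, ← val_tail, List.tail_drop]

theorem dropDigits_le (x i : ℕ) : dropDigits x i ≤ x := by
  induction i with
  | zero => rw [dropDigits_zero]
  | succ i ih => rw [dropDigits_succ]; omega

theorem PS.dropDigits {f g : α → ℕ} (hf : PS f) (hg : PS g) :
    PS fun a => dropDigits (f a) (g a) := by
  have h : ∀ x i, Nat.rec (motive := fun _ => ℕ) x (fun _ r => (r - 1) / 2) i =
      StackProg.dropDigits x i := by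
    intro x i
    induction i with
    | zero => exact (dropDigits_zero x).symm
    | succ i ih => rw [dropDigits_succ, ← ih]
  have := PS.natRec_le (f := fun (_ : α) _ r => (r - 1) / 2) f
    (PS.snd'.snd.pred.div (PS.const 2)) hf hg hf fun a i hi => by rw [h]; exact dropDigits_le _ _
  simpa only [h] using this

theorem dropDigits_eq_zero_iff (x i : ℕ) : dropDigits x i = 0 ↔ blen x ≤ i := by
  rw [dropDigits, blen, ← List.drop_eq_nil_iff]
  constructor
  · intro h
    exact val_injective h
  · intro h
    rw [h, val]

/-- The number of digits is the least number of digits whose removal leaves zero, so its graph is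
decidable with a bounded quantifier. -/
theorem PS.blen {f : α → ℕ} (hf : PS f) : PS fun a => blen (f a) := by
  refine PS.of_graph hf ?_ fun a => blen_le_self _
  have hf' : PS fun x : α × ℕ => f x.1 := hf.comp PS.fst'
  have hy : PS fun x : α × ℕ => x.2 := PS.snd'
  refine ((PSp.eq (hf'.dropDigits hy) PS.zero).and (PSp.all (p := fun x j =>
    StackProg.dropDigits (f x.1) j ≠ 0) hy
    (PSp.ne ((hf'.comp PS.fst').dropDigits PS.snd') PS.zero))).of_eq fun ⟨a, y⟩ => ?_
  simp only [ne_eq, dropDigits_eq_zero_iff, not_le]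
  refine ⟨fun ⟨h₁, h₂⟩ => le_antisymm ?_ h₁, fun h => ⟨h.ge, fun j hj => h ▸ hj⟩⟩
  by_contra h
  exact lt_irrefl _ (h₂ _ (not_le.1 h))

theorem blen_pow_le (x i : ℕ) : blen (x ^ i) ≤ (blen x + 1) * i + 1 := by
  refine blen_le_of_lt ?_
  have := lt_two_pow_blen x
  rw [pow_succ, pow_mul]
  have h : x ^ i ≤ (2 ^ (blen x + 1)) ^ i := Nat.pow_le_pow_left (by omega) _
  have : 0 < (2 ^ (blen x + 1)) ^ i := by positivity
  omega

/-- Powers in general have exponentially many digits. An exponent that is itself a number of digits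
keeps the length polynomial. -/
theorem PS.pow_blen {f g : α → ℕ} (hf : PS f) (hg : PS g) :
    PS fun a => f a ^ StackProg.blen (g a) := by
  have h : ∀ x i : ℕ, Nat.rec (motive := fun _ => ℕ) 1 (fun _ r => r * x) i = x ^ i := by
    intro x i
    induction i with
    | zero => rfl
    | succ i ih => rw [pow_succ, ← ih]
  have := PS.natRec (f := fun (x : ℕ × ℕ) _ r => r * x.1) (n := fun x => StackProg.blen x.2)
    (g := fun x => 1) (PS.snd'.snd.mul PS.fst'.fst) (PS.const 1) PS.snd'.blen
    ⟨2, fun ⟨x, y⟩ i hi => by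
      rw [h, size_prod, size_nat, size_nat]
      have h₁ := blen_pow_le x i
      simp only at hi
      have h₃ := le_max_left (StackProg.blen x) (StackProg.blen y)
      have h₄ := le_max_right (StackProg.blen x) (StackProg.blen y)
      nlinarith⟩
  simp only [h] at this
  exact this.comp (hf.pair hg)

end

/-! ## Reachability in exponentially large graphs (Savitch's theorem) -/

/-- Steps between numbers below `B`. -/
def BoundedStep (B : ℕ) (E : ℕ → ℕ → Prop) (x y : ℕ) : Prop := x < B ∧ y < B ∧ E x y

/-- There is a path of length at most `2 ^ d` through numbers below `B`. -/
def Midpoint (B : ℕ) (E : ℕ → ℕ → Prop) : ℕ → ℕ → ℕ → Prop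
  | 0, u, v => u = v ∨ E u v
  | d + 1, u, v => ∃ w < B, Midpoint B E d u w ∧ Midpoint B E d w v

theorem Midpoint.reflTransGen {B : ℕ} {E : ℕ → ℕ → Prop} {d u v : ℕ} (h : Midpoint B E d u v)
    (hu : u < B) (hv : v < B) : Relation.ReflTransGen (BoundedStep B E) u v := by
  induction d generalizing u v with
  | zero =>
    rcases h with rfl | h
    exacts [.refl, .single ⟨hu, hv, h⟩]
  | succ d ih =>
    obtain ⟨w, hw, h₁, h₂⟩ := h
    exact (ih h₁ hu hw).trans (ih h₂ hw hv)

/-- Cutting a path in the middle leaves two halves of at most half the permitted length each. A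
short path causes no problem, as level `0` also accepts the empty one. -/
theorem Midpoint.of_path {B : ℕ} {E : ℕ → ℕ → Prop} {d n : ℕ} (f : ℕ → ℕ) (hf : ∀ i ≤ n, f i < B)
    (hE : ∀ i < n, E (f i) (f (i + 1))) (hn : n ≤ 2 ^ d) : Midpoint B E d (f 0) (f n) := by
  induction d generalizing f n with
  | zero =>
    rw [pow_zero] at hn
    interval_cases n
    · exact .inl rfl
    · exact .inr (hE 0 (by omega))
  | succ d ih =>
    rw [pow_succ] at hn
    refine ⟨f (n / 2), hf _ (by omega), ih f (fun i hi => hf i (by omega))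
      (fun i hi => hE i (by omega)) (by omega), ?_⟩
    have := ih (n := n - n / 2) (fun i => f (n / 2 + i)) (fun i hi => hf _ (by omega))
      (fun i hi => hE (n / 2 + i) (by omega)) (by omega)
    simpa [show n / 2 + (n - n / 2) = n by omega] using this

theorem exists_path_of_reflTransGen {B : ℕ} {E : ℕ → ℕ → Prop} {u v : ℕ} (hu : u < B)
    (h : Relation.ReflTransGen (BoundedStep B E) u v) : ∃ (n : ℕ) (f : ℕ → ℕ),
      (∀ i ≤ n, f i < B) ∧ (∀ i < n, E (f i) (f (i + 1))) ∧ f 0 = u ∧ f n = v := by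
  induction h with
  | refl => exact ⟨0, fun _ => u, fun _ _ => hu, fun i hi => absurd hi (by omega), rfl, rfl⟩
  | @tail v w _ hvw ih =>
    obtain ⟨n, f, h₁, h₂, h₃, h₄⟩ := ih
    refine ⟨n + 1, fun i => if i ≤ n then f i else w, fun i hi => ?_, fun i hi => ?_, by simp [h₃],
      by simp⟩
    · dsimp only
      split_ifs with h
      exacts [h₁ i h, hvw.2.1]
    · dsimp only
      rw [if_pos (by omega)]
      split_ifs with h
      · exact h₂ i (by omega)
      · obtain rfl : i = n := by omega
        exact h₄ ▸ hvw.2.2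

/-- A path of minimal length repeats no vertex, because the part between two visits could be cut
out. By the pigeonhole principle it has at most `B` vertices, hence fewer than `B` edges. -/
theorem exists_short_path {B : ℕ} {E : ℕ → ℕ → Prop} {u v : ℕ} (h : ∃ (n : ℕ) (f : ℕ → ℕ),
      (∀ i ≤ n, f i < B) ∧ (∀ i < n, E (f i) (f (i + 1))) ∧ f 0 = u ∧ f n = v) :
    ∃ n < B, ∃ f : ℕ → ℕ,
      (∀ i ≤ n, f i < B) ∧ (∀ i < n, E (f i) (f (i + 1))) ∧ f 0 = u ∧ f n = v := by
  classical
  refine ⟨Nat.find h, ?_, Nat.find_spec h⟩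
  obtain ⟨f, h₁, h₂, h₃, h₄⟩ := Nat.find_spec h
  set n := Nat.find h with hn
  by_contra hB
  obtain ⟨i, hi, j, hj, hij, he⟩ := Finset.exists_ne_map_eq_of_card_lt_of_maps_to
    (s := Finset.range (n + 1)) (t := Finset.range B) (f := f) (by simp; omega)
    (fun i hi => by
      have := h₁ i (by simp at hi; omega)
      simpa using this)
  have key : ∀ i j, i < j → j ≤ n → f i = f j → False := by
    intro i j hij hj he
    refine Nat.find_min h (m := n - (j - i)) (by omega)
      ⟨fun x => if x ≤ i then f x else f (x + (j - i)), fun x hx => ?_, fun x hx => ?_, by simp [h₃],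
        ?_⟩
    · dsimp only
      split_ifs <;> exact h₁ _ (by omega)
    · dsimp only
      split_ifs with c₁ c₂ c₃
      · exact h₂ _ (by omega)
      · obtain rfl : x = i := by omega
        rw [he, show x + 1 + (j - x) = j + 1 by omega]
        exact h₂ _ (by omega)
      · omega
      · rw [show x + 1 + (j - i) = x + (j - i) + 1 by omega]
        exact h₂ _ (by omega)
    · dsimp only
      split_ifs with c
      · rw [show n - (j - i) = i by omega, he, ← h₄]
        congr 1
        omega
      · rw [← h₄]
        congr 1
        omega
  simp only [Finset.mem_range] at hi hj
  rcases lt_or_gt_of_ne hij with h | h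
  · exact key i j h (by omega) he
  · exact key j i h (by omega) he.symm

theorem midpoint_iff {B : ℕ} {E : ℕ → ℕ → Prop} {d u v : ℕ} (hd : B ≤ 2 ^ d) (hu : u < B)
    (hv : v < B) : Midpoint B E d u v ↔ Relation.ReflTransGen (BoundedStep B E) u v := by
  refine ⟨fun h => h.reflTransGen hu hv, fun h => ?_⟩
  obtain ⟨n, hn, f, h₁, h₂, rfl, rfl⟩ := exists_short_path (exists_path_of_reflTransGen hu h)
  exact .of_path f h₁ h₂ (by omega)

/-! ### Evaluation with an explicit stack -/

/-- Put three digits in base `C` on top of a stack. -/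
def pushFrame (C stk u v x : ℕ) : ℕ := ((stk * C + u) * C + v) * C + x

theorem div_mul_add {C : ℕ} (a : ℕ) {b : ℕ} (h : b < C) : (a * C + b) / C = a := by
  rw [Nat.add_comm, Nat.add_mul_div_right _ _ (by omega), Nat.div_eq_of_lt h, Nat.zero_add]

theorem mod_mul_add {C : ℕ} (a : ℕ) {b : ℕ} (h : b < C) : (a * C + b) % C = b := by
  rw [Nat.add_comm, Nat.add_mul_mod_self_right, Nat.mod_eq_of_lt h]

theorem pushFrame_lt {C stk u v x n : ℕ} (hs : stk < C ^ n) (hu : u < C) (hv : v < C) (hx : x < C) :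
    pushFrame C stk u v x < C ^ (n + 3) := by
  have key : ∀ {m s y : ℕ}, s < C ^ m → y < C → s * C + y < C ^ (m + 1) := by
    intro m s y hs hy
    calc s * C + y < (s + 1) * C := by rw [add_mul]; omega
      _ ≤ C ^ m * C := Nat.mul_le_mul_right _ hs
      _ = _ := (pow_succ _ _).symm
  exact key (key (key hs hu) hv) hx

/-- One step of the evaluation. The state consists of the mode (`0` to evaluate, `1` and `2` to
return a truth value), the level, the two arguments, and the stack. A frame on the stack consists of
the arguments one level up and the number `2 * w + i`, where `w` is the current midpoint and `i`
tells which half is being evaluated. -/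
noncomputable def midpointStep (B C D : ℕ) (E : ℕ → ℕ → Prop) (s : ℕ × ℕ × ℕ × ℕ × ℕ) :
    ℕ × ℕ × ℕ × ℕ × ℕ :=
  if s.1 = 0 then
    if s.2.1 = 0 then (1 + ind (s.2.2.1 = s.2.2.2.1 ∨ E s.2.2.1 s.2.2.2.1), 0, 0, 0, s.2.2.2.2)
    else (0, s.2.1 - 1, s.2.2.1, 0, pushFrame C s.2.2.2.2 s.2.2.1 s.2.2.2.1 0)
  -- A result at the top level is a fixed point, so surplus iterations do no harm.
  else if s.2.1 = D then s
  else if s.1 = 2 then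
    -- After success of the second half the caller succeeds; after success of the first half, the
    -- second half is evaluated from the midpoint to the target stored in the frame.
    if s.2.2.2.2 % C % 2 = 1 then (2, s.2.1 + 1, 0, 0, s.2.2.2.2 / C / C / C)
    else (0, s.2.1, s.2.2.2.2 % C / 2, s.2.2.2.2 / C % C,
      pushFrame C (s.2.2.2.2 / C / C / C) (s.2.2.2.2 / C / C % C) (s.2.2.2.2 / C % C)
        (s.2.2.2.2 % C + 1))
  -- After a failure of either half the next midpoint is tried; when none is left, the caller fails.
  else if s.2.2.2.2 % C / 2 + 1 < B then
    (0, s.2.1, s.2.2.2.2 / C / C % C, s.2.2.2.2 % C / 2 + 1,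
      pushFrame C (s.2.2.2.2 / C / C / C) (s.2.2.2.2 / C / C % C) (s.2.2.2.2 / C % C)
        (2 * (s.2.2.2.2 % C / 2 + 1)))
  else (1, s.2.1 + 1, 0, 0, s.2.2.2.2 / C / C / C)

/-- At most `n` iterations of `f` lead from `x` to `y`. -/
def Within {σ : Type} (f : σ → σ) (n : ℕ) (x y : σ) : Prop := ∃ t ≤ n, f^[t] x = y

theorem Within.trans {σ : Type} {f : σ → σ} {m n : ℕ} {x y z : σ} (h₁ : Within f m x y)
    (h₂ : Within f n y z) : Within f (m + n) x z := by
  obtain ⟨s, hs, rfl⟩ := h₁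
  obtain ⟨t, ht, rfl⟩ := h₂
  exact ⟨t + s, by omega, Function.iterate_add_apply _ _ _ _⟩

theorem Within.mono {σ : Type} {f : σ → σ} {m n : ℕ} {x y : σ} (h : Within f m x y) (hmn : m ≤ n) :
    Within f n x y := let ⟨t, ht, h⟩ := h; ⟨t, ht.trans hmn, h⟩

theorem Within.single {σ : Type} {f : σ → σ} {x y : σ} (h : f x = y) : Within f 1 x y :=
  ⟨1, le_rfl, h⟩

/-- A bound on the number of steps to evaluate level `d`. -/
def midpointTime (B : ℕ) : ℕ → ℕ
  | 0 => 1
  | d + 1 => 1 + B * (2 * midpointTime B d + 2)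

theorem midpointTime_le (B d : ℕ) : midpointTime B d ≤ (2 * B + 3) ^ (d + 1) := by
  induction d with
  | zero => simp [midpointTime]
  | succ d ih =>
    rw [midpointTime, pow_succ]
    have : 2 * B + 3 ≤ (2 * B + 3) ^ (d + 1) := Nat.le_self_pow (by omega) _
    nlinarith

section

variable {B C D : ℕ} {E : ℕ → ℕ → Prop}

/-- Evaluation of a level returns its truth value and leaves the stack below as it was; this is what
the induction on the level needs. The condition on `C` makes the entry `2 * w + i` of a frame a
single digit. -/
theorem within_midpointStep (hB : 0 < B) (hC : 2 * B ≤ C) {d : ℕ} (hd : d ≤ D) {u v : ℕ}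
    (stk : ℕ) (hu : u < C) (hv : v < C) : Within (midpointStep B C D E) (midpointTime B d)
      (0, d, u, v, stk) (1 + ind (Midpoint B E d u v), d, 0, 0, stk) := by
  induction d generalizing u v stk with
  | zero => exact .single (by simp [midpointStep, Midpoint])
  | succ d ih =>
    have hdD : d ≠ D := by omega
    have ih := fun {u v} stk => ih (u := u) (v := v) (by omega) stk
    have pops : ∀ x < C, pushFrame C stk u v x % C = x ∧ pushFrame C stk u v x / C % C = v ∧
        pushFrame C stk u v x / C / C % C = u ∧ pushFrame C stk u v x / C / C / C = stk := by
      intro x hx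
      refine ⟨mod_mul_add _ hx, ?_, ?_, ?_⟩ <;> rw [pushFrame, div_mul_add _ hx]
      · rw [mod_mul_add _ hv]
      · rw [div_mul_add _ hv, mod_mul_add _ hu]
      · rw [div_mul_add _ hv, div_mul_add _ hu]
    have fail : ∀ w i, i < 2 → w < B → midpointStep B C D E (1, d, 0, 0,
        pushFrame C stk u v (2 * w + i)) = if w + 1 < B then
          (0, d, u, w + 1, pushFrame C stk u v (2 * (w + 1))) else (1, d + 1, 0, 0, stk) := by
      intro w i hi hw
      obtain ⟨h₁, h₂, h₃, h₄⟩ := pops (2 * w + i) (by omega)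
      simp [midpointStep, hdD, h₁, h₂, h₃, h₄, show (2 * w + i) / 2 = w by omega]
    -- Here `j` counts the midpoints that remain to be tried. Each costs at most two evaluations one
    -- level below and one step after each of them.
    have key : ∀ j w, w < B → B - w = j → Within (midpointStep B C D E)
        (j * (2 * midpointTime B d + 2)) (0, d, u, w, pushFrame C stk u v (2 * w))
        (1 + ind (∃ w', w ≤ w' ∧ w' < B ∧ Midpoint B E d u w' ∧ Midpoint B E d w' v), d + 1, 0, 0,
          stk) := by
      intro j
      induction j with
      | zero => intro w h₁ h₂; omega
      | succ j ihj =>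
        intro w hw hj
        have next : ¬(Midpoint B E d u w ∧ Midpoint B E d w v) → ∀ i < 2,
            Within (midpointStep B C D E) (1 + j * (2 * midpointTime B d + 2))
            (1, d, 0, 0, pushFrame C stk u v (2 * w + i))
            (1 + ind (∃ w', w ≤ w' ∧ w' < B ∧ Midpoint B E d u w' ∧ Midpoint B E d w' v), d + 1, 0,
              0, stk) := by
          intro hn i hi
          have h₁ := fail w i hi hw
          by_cases hw' : w + 1 < B
          · rw [if_pos hw'] at h₁
            have h₂ := ihj (w + 1) hw' (by omega)
            have : (∃ w', w ≤ w' ∧ w' < B ∧ Midpoint B E d u w' ∧ Midpoint B E d w' v) ↔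
                ∃ w', w + 1 ≤ w' ∧ w' < B ∧ Midpoint B E d u w' ∧ Midpoint B E d w' v := by
              refine ⟨fun ⟨w', h, h'⟩ => ⟨w', ?_, h'⟩, fun ⟨w', h, h'⟩ => ⟨w', by omega, h'⟩⟩
              rcases Nat.eq_or_lt_of_le h with rfl | h
              exacts [absurd h'.2 hn, h]
            rw [this]
            exact (Within.single h₁).trans h₂
          · rw [if_neg hw'] at h₁
            rw [ind_neg]
            · exact (Within.single h₁).mono (by omega)
            · rintro ⟨w', h, h', h''⟩
              obtain rfl : w = w' := by omega
              exact hn h''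
        have h₁ := ih (pushFrame C stk u v (2 * w)) hu (show w < C by omega)
        by_cases m₁ : Midpoint B E d u w
        · rw [ind_pos m₁] at h₁
          have h₂ : midpointStep B C D E (1 + 1, d, 0, 0, pushFrame C stk u v (2 * w)) =
              (0, d, w, v, pushFrame C stk u v (2 * w + 1)) := by
            obtain ⟨h₁, h₂, h₃, h₄⟩ := pops (2 * w) (by omega)
            simp [midpointStep, hdD, h₁, h₂, h₃, h₄]
          have h₃ := ih (pushFrame C stk u v (2 * w + 1)) (show w < C by omega) hv
          have h₄ := (h₁.trans (.single h₂)).trans h₃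
          by_cases m₂ : Midpoint B E d w v
          · rw [ind_pos m₂] at h₄
            rw [ind_pos ⟨w, le_rfl, hw, m₁, m₂⟩]
            refine (h₄.trans (.single ?_)).mono (?_ : _ + 1 ≤ _)
            · obtain ⟨h₁, h₂, h₃, h₄⟩ := pops (2 * w + 1) (by omega)
              simp [midpointStep, hdD, h₁, h₄]
            · rw [add_mul]
              omega
          · rw [ind_neg m₂] at h₄
            refine (h₄.trans (next (by tauto) 1 (by omega))).mono ?_
            rw [add_mul]
            omega
        · rw [ind_neg m₁] at h₁
          refine (h₁.trans (next (by tauto) 0 (by omega))).mono ?_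
          rw [add_mul]
          omega
    have h₀ : midpointStep B C D E (0, d + 1, u, v, stk) =
        (0, d, u, 0, pushFrame C stk u v (2 * 0)) := by
      simp [midpointStep]
    have := (Within.single h₀).trans (key B 0 hB rfl)
    simpa [Midpoint, midpointTime] using this

theorem iterate_midpointStep (hB : 0 < B) (hC : 2 * B ≤ C) {u v : ℕ} (hu : u < C) (hv : v < C)
    {n : ℕ} (hn : midpointTime B D ≤ n) : (midpointStep B C D E)^[n] (0, D, u, v, 0) =
      (1 + ind (Midpoint B E D u v), D, 0, 0, 0) := by
  obtain ⟨t, ht, h⟩ := within_midpointStep (E := E) hB hC (le_refl D) 0 hu hv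
  obtain ⟨m, rfl⟩ := Nat.exists_eq_add_of_le (ht.trans hn)
  rw [Nat.add_comm, Function.iterate_add_apply, h]
  refine Function.iterate_fixed ?_ m
  simp [midpointStep]

/-- The states that occur in the evaluation. -/
def MidpointInv (C D : ℕ) (s : ℕ × ℕ × ℕ × ℕ × ℕ) : Prop :=
  s.1 ≤ 2 ∧ s.2.1 ≤ D ∧ s.2.2.1 < C ∧ s.2.2.2.1 < C ∧ s.2.2.2.2 < C ^ (3 * (D - s.2.1))

/-- At level `d` the stack consists of at most `D - d` frames with three digits each, so its length
stays polynomial. -/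
theorem MidpointInv.step (hB : 2 * B < C) (hC : C % 2 = 0) {s : ℕ × ℕ × ℕ × ℕ × ℕ}
    (h : MidpointInv C D s) : MidpointInv C D (midpointStep B C D E s) := by
  obtain ⟨md, d, u, v, stk⟩ := s
  obtain ⟨h₁, h₂, h₃, h₄, h₅⟩ := h
  simp only at h₁ h₂ h₃ h₄ h₅
  have hind : ∀ p, ind p ≤ 1 := fun p => by unfold ind; split_ifs <;> omega
  unfold midpointStep
  simp only
  split_ifs with c₁ c₂ c₃ c₄ c₅ c₆
  · refine ⟨?_, by simp, by simp; omega, by simp; omega, by simpa [c₂] using h₅⟩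
    have := hind (u = v ∨ E u v)
    simp only
    omega
  · refine ⟨by simp, by simp; omega, h₃, by simp; omega, ?_⟩
    have := pushFrame_lt h₅ h₃ h₄ (show 0 < C by omega)
    rwa [show 3 * (D - d) + 3 = 3 * (D - (d - 1)) by omega] at this
  · exact ⟨h₁, h₂, h₃, h₄, h₅⟩
  all_goals
    have hpop : stk / C / C / C < C ^ (3 * (D - (d + 1))) := by
      rw [Nat.div_div_eq_div_mul, Nat.div_div_eq_div_mul]
      refine Nat.div_lt_of_lt_mul ?_
      convert h₅ using 1
      rw [show 3 * (D - d) = 3 * (D - (d + 1)) + 3 by omega]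
      ring
    have hx : stk % C < C := Nat.mod_lt _ (by omega)
    have hv' : stk / C % C < C := Nat.mod_lt _ (by omega)
    have hu' : stk / C / C % C < C := Nat.mod_lt _ (by omega)
    have hpush : ∀ x < C, pushFrame C (stk / C / C / C) (stk / C / C % C) (stk / C % C) x <
        C ^ (3 * (D - d)) := by
      intro x hx
      have := pushFrame_lt hpop hu' hv' hx
      rwa [show 3 * (D - (d + 1)) + 3 = 3 * (D - d) by omega] at this
  · exact ⟨by simp, by simp; omega, by simp; omega, by simp; omega, hpop⟩
  -- The invariant does not record that the last digit encodes a midpoint. But the digit is even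
  -- here and `C` is even, so adding `1` does not reach `C`.
  · exact ⟨by simp, h₂, by simp; omega, hv', hpush _ (by omega)⟩
  · exact ⟨by simp, h₂, hu', by simp; omega, hpush _ (by omega)⟩
  · exact ⟨by simp, by simp; omega, by simp; omega, by simp; omega, hpop⟩

theorem MidpointInv.iterate (hB : 2 * B < C) (hC : C % 2 = 0) {s : ℕ × ℕ × ℕ × ℕ × ℕ}
    (h : MidpointInv C D s) (n : ℕ) : MidpointInv C D ((midpointStep B C D E)^[n] s) := by
  induction n with
  | zero => exact h
  | succ n ih => rw [Function.iterate_succ_apply']; exact ih.step hB hC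

end

/-! ### Computation in polynomial space -/

section

variable {α β : Type} [Ctx α] [Ctx β]

theorem ind_le_one (p : Prop) : ind p ≤ 1 := by
  unfold ind; split_ifs <;> omega

/-- A conditional is an iteration that replaces the value of `g` by that of `f` either once or not
at all. In this way it is available for tuples, not only for numbers. -/
theorem PS.ite' {p : α → Prop} [DecidablePred p] {f g : α → β} (hp : PSp p) (hf : PS f)
    (hg : PS g) : PS fun a => if p a then f a else g a := by
  obtain ⟨e, he⟩ := hf.growth
  obtain ⟨e', he'⟩ := hg.growth
  refine (PS.iterate (f := fun a _ => f a) (n := fun a => ind (p a)) (hf.comp PS.fst') hg hp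
    ⟨max e e', fun a i hi => ?_⟩).of_eq fun a => ?_
  · have := ind_le_one (p a)
    have hi' : i ≤ 1 := hi.trans this
    interval_cases i
    · exact (he' a).trans (pow_le_pow_max_right _ _ _)
    · exact (he a).trans (pow_le_pow_max_left _ _ _)
  · by_cases h : p a
    · rw [ind_pos h, if_pos h]; rfl
    · rw [ind_neg h, if_neg h]; rfl

theorem PS.pushFrame {C s u v x : α → ℕ} (hC : PS C) (hs : PS s) (hu : PS u) (hv : PS v)
    (hx : PS x) : PS fun a => pushFrame (C a) (s a) (u a) (v a) (x a) :=
  (((((hs.mul hC).add hu).mul hC).add hv).mul hC).add hx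

theorem PS.midpointStep {B C D : α → ℕ} {E : α → ℕ → ℕ → Prop} (hB : PS B) (hC : PS C) (hD : PS D)
    (hE : PSp fun x : α × ℕ × ℕ => E x.1 x.2.1 x.2.2) {s : α → ℕ × ℕ × ℕ × ℕ × ℕ} (hs : PS s) :
    PS fun a => midpointStep (B a) (C a) (D a) (E a) (s a) := by
  have h₁ := hs.fst
  have h₂ := hs.snd.fst
  have h₃ := hs.snd.snd.fst
  have h₄ := hs.snd.snd.snd.fst
  have h₅ := hs.snd.snd.snd.snd
  have hE' : PSp fun a => E a (s a).2.2.1 (s a).2.2.2.1 :=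
    hE.comp (PS.id.pair (h₃.pair h₄))
  have c0 : PS fun _ : α => 0 := PS.zero
  have c1 : PS fun _ : α => 1 := PS.const 1
  have c2 : PS fun _ : α => 2 := PS.const 2
  have hx := h₅.mod hC
  have hv := (h₅.div hC).mod hC
  have hu := ((h₅.div hC).div hC).mod hC
  have ht := ((h₅.div hC).div hC).div hC
  have hind : PS fun a => ind ((s a).2.2.1 = (s a).2.2.2.1 ∨ E a (s a).2.2.1 (s a).2.2.2.1) :=
    (PSp.eq h₃ h₄).or hE'
  unfold StackProg.midpointStep
  exact .ite' (.eq h₁ c0)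
    (.ite' (.eq h₂ c0) ((c1.add hind).pair (c0.pair (c0.pair (c0.pair h₅))))
      (c0.pair (h₂.pred.pair (h₃.pair (c0.pair (.pushFrame hC h₅ h₃ h₄ c0))))))
    (.ite' (.eq h₂ hD) hs (.ite' (.eq h₁ c2)
      (.ite' (.eq (hx.mod c2) c1) (c2.pair (h₂.succ.pair (c0.pair (c0.pair ht))))
        (c0.pair (h₂.pair ((hx.div c2).pair (hv.pair (.pushFrame hC ht hu hv hx.succ))))))
      (.ite' (.lt (hx.div c2).succ hB)
        (c0.pair (h₂.pair (hu.pair ((hx.div c2).succ.pair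
          (.pushFrame hC ht hu hv (c2.mul (hx.div c2).succ))))))
        (c1.pair (h₂.succ.pair (c0.pair (c0.pair ht)))))))

/-- Reachability in a graph on an initial segment of the numbers is decidable in polynomial space
if the edge relation is. -/
theorem PSp.reflTransGen {B u v : α → ℕ} {E : α → ℕ → ℕ → Prop} (hB : PS B)
    (hE : PSp fun x : α × ℕ × ℕ => E x.1 x.2.1 x.2.2) (hu : PS u) (hv : PS v) :
    PSp fun a => u a < B a ∧ v a < B a ∧
      Relation.ReflTransGen (BoundedStep (B a) (E a)) (u a) (v a) := by
  -- The base has to be even and above `2 * B a`. It also exceeds `u a` and `v a`, which need not be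
  -- below `B a`, because the length bound must hold for each `a`.
  set C : α → ℕ := fun a => 2 * (B a + u a + v a + 1) with hCdef
  set D : α → ℕ := fun a => blen (B a) + 1 with hDdef
  set M : α → ℕ := fun a => 2 * B a + 3 with hMdef
  -- This is `(2 * B a + 3) ^ (D a + 1)`, the bound from `midpointTime_le`. Likewise `K a ^ D a`
  -- bounds the call stack. The powers are split into factors to fit `PS.pow_blen`.
  set N : α → ℕ := fun a => M a ^ blen (B a) * M a * M a with hNdef
  set K : α → ℕ := fun a => C a * C a * C a with hKdef
  have hC : PS C := (PS.const 2).mul (((hB.add hu).add hv).add (PS.const 1))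
  have hD : PS D := hB.blen.succ
  have hM : PS M := ((PS.const 2).mul hB).add (PS.const 3)
  have hN : PS N := ((hM.pow_blen hB).mul hM).mul hM
  have hK : PS K := (hC.mul hC).mul hC
  have hbound : PS fun a => 2 + D a + C a + K a ^ blen (B a) * K a :=
    (((PS.const 2).add hD).add hC).add ((hK.pow_blen hB).mul hK)
  obtain ⟨e, he⟩ := hbound.growth
  have hit : PS fun a => (StackProg.midpointStep (B a) (C a) (D a) (E a))^[N a]
      (0, D a, u a, v a, 0) := by
    refine PS.iterate (f := fun a => StackProg.midpointStep (B a) (C a) (D a) (E a))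
      (g := fun a => (0, D a, u a, v a, 0))
      (PS.midpointStep (hB.comp PS.fst') (hC.comp PS.fst') (hD.comp PS.fst')
        (E := fun x => E x.1) (hE.comp (PS.fst'.fst.pair PS.snd')) PS.snd')
      (PS.zero.pair (hD.pair (hu.pair (hv.pair PS.zero)))) hN ⟨e, fun a i _ => ?_⟩
    have hC0 : 0 < C a := by simp only [hCdef]; omega
    have hinv : MidpointInv (C a) (D a) (0, D a, u a, v a, 0) :=
      ⟨by simp, le_rfl, by simp [hCdef]; omega, by simp [hCdef]; omega, by simp⟩
    obtain ⟨i₁, i₂, i₃, i₄, i₅⟩ := hinv.iterate (B := B a) (E := E a) (by simp [hCdef]; omega)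
      (by simp [hCdef]) i
    have hstk : (C a) ^ (3 * (D a - ((StackProg.midpointStep (B a) (C a) (D a) (E a))^[i]
        (0, D a, u a, v a, 0)).2.1)) ≤ K a ^ blen (B a) * K a := by
      rw [← pow_succ, show K a = C a ^ 3 by simp only [hKdef]; ring, ← pow_mul]
      exact Nat.pow_le_pow_right hC0 (by simp only [hDdef]; omega)
    have hb := he a
    rw [size_nat] at hb
    generalize (StackProg.midpointStep (B a) (C a) (D a) (E a))^[i] (0, D a, u a, v a, 0) = s at *
    obtain ⟨md, d, x, y, stk⟩ := s
    simp only at i₁ i₂ i₃ i₄ i₅ hstk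
    simp only [size_prod, size_nat, max_le_iff]
    exact ⟨(blen_mono (by omega)).trans hb, (blen_mono (by omega)).trans hb,
      (blen_mono (by omega)).trans hb, (blen_mono (by omega)).trans hb,
      (blen_mono (by omega)).trans hb⟩
  refine ((PSp.lt hu hB).and ((PSp.lt hv hB).and (PSp.eq hit.fst (PS.const 2)))).of_eq fun a => ?_
  refine and_congr_right fun h₁ => and_congr_right fun h₂ => ?_
  have hlt := lt_two_pow_blen (B a)
  rw [← midpoint_iff (d := D a) (by simp only [hDdef]; omega) h₁ h₂,
    iterate_midpointStep (by omega) (by simp only [hCdef]; omega) (by simp only [hCdef]; omega)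
    (by simp only [hCdef]; omega) (by
      have := midpointTime_le (B a) (D a)
      rwa [hDdef, pow_succ, pow_succ] at this)]
  by_cases h : Midpoint (B a) (E a) (D a) (u a) (v a)
  · simp [ind, h]
  · simp [ind, h]

end

/-! ## Lists of numbers in unary notation -/

/-- The number of leading digits `2`. -/
def leadList : List Bool → ℕ
  | true :: l => leadList l + 1
  | _ => 0

/-- The first entry of a list of numbers in unary notation. -/
def lead (x : ℕ) : ℕ := leadList (enc x)

/-- Remove the first entry of a list of numbers in unary notation. -/
def skipEntry (x : ℕ) : ℕ := dropDigits x (lead x + 1)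

/-- The entries of a list of numbers in unary notation. -/
def entry (x j : ℕ) : ℕ := lead (skipEntry^[j] x)

theorem lead_unaryWord (a : ℕ) (l : List ℕ) : lead (val (unaryWord (a :: l))) = a := by
  rw [lead, enc_val, unaryWord, List.flatMap_cons]
  induction a with
  | zero => rfl
  | succ a ih =>
    rw [List.replicate_succ, List.cons_append, List.cons_append, leadList, ih]

theorem skipEntry_unaryWord (a : ℕ) (l : List ℕ) :
    skipEntry (val (unaryWord (a :: l))) = val (unaryWord l) := by
  rw [skipEntry, lead_unaryWord, dropDigits, enc_val, unaryWord, List.flatMap_cons]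
  congr 1
  have : a + 1 = (List.replicate a true ++ [false]).length := by simp
  rw [this, List.drop_left]
  rfl

theorem entry_unaryWord (l : List ℕ) (j : ℕ) : entry (val (unaryWord l)) j = l.getD j 0 := by
  induction l generalizing j with
  | nil =>
    have h : skipEntry^[j] 0 = 0 := Function.iterate_fixed (by rfl) j
    simp only [entry, unaryWord, List.flatMap_nil, val, h]
    rfl
  | cons a l ih =>
    cases j with
    | zero => exact lead_unaryWord a l
    | succ j =>
      rw [entry, Function.iterate_succ_apply, skipEntry_unaryWord, List.getD_cons_succ, ← ih, entry]

theorem leadList_le (l : List Bool) : leadList l ≤ l.length := by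
  induction l with
  | nil => simp [leadList]
  | cons b l ih => cases b <;> simp [leadList, ih]

theorem skipEntry_iterate_le (x j : ℕ) : skipEntry^[j] x ≤ x := by
  induction j with
  | zero => rfl
  | succ j ih =>
    rw [Function.iterate_succ_apply']
    exact (dropDigits_le _ _).trans ih

theorem entry_le_blen (x j : ℕ) : entry x j ≤ blen x :=
  (leadList_le _).trans (blen_mono (skipEntry_iterate_le x j))

theorem entry_le (x j : ℕ) : entry x j ≤ x := (entry_le_blen x j).trans (blen_le_self x)

/-- The length of the leading run is described by tests of single digits under a bounded quantifier,
in the form that `PS.of_graph` needs. -/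
theorem eq_leadList_iff (l : List Bool) (y : ℕ) : y = leadList l ↔
    (l.drop y).head? ≠ some true ∧ ∀ j < y, (l.drop j).head? = some true := by
  induction l generalizing y with
  | nil =>
    simp only [leadList, List.drop_nil, List.head?_nil]
    refine ⟨fun h => by simp [h], fun ⟨_, h⟩ => ?_⟩
    by_contra hy
    simpa using h 0 (by omega)
  | cons b l ih =>
    cases b
    · simp only [leadList]
      refine ⟨fun h => by simp [h], fun ⟨_, h⟩ => ?_⟩
      by_contra hy
      simpa using h 0 (by omega)
    · cases y with
      | zero => simp [leadList]
      | succ y =>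
        rw [leadList, Nat.add_right_cancel_iff, ih]
        refine and_congr Iff.rfl ⟨fun h j hj => ?_, fun h j hj => h (j + 1) (by omega)⟩
        cases j with
        | zero => rfl
        | succ j => exact h j (by omega)

theorem head?_eq_some_true_iff (l : List Bool) :
    l.head? = some true ↔ val l ≠ 0 ∧ val l % 2 = 0 := by
  rcases l with _ | ⟨_ | _, l⟩ <;> simp [val]

/-! ### Positions in the input, and digits of configuration numbers -/

/-- The position of the description of process `p` in the description of a system. -/
def offset (x p : ℕ) : ℕ := Nat.rec 4 (fun _ r => r + 3 + 6 * entry x (r + 2)) p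

theorem offset_succ (x p : ℕ) :
    offset x (p + 1) = offset x p + 3 + 6 * entry x (offset x p + 2) := rfl

theorem offset_le (x p : ℕ) : offset x p ≤ 4 + p * (3 + 6 * x) := by
  induction p with
  | zero => simp [offset]
  | succ p ih =>
    rw [offset_succ]
    have := entry_le x (offset x p + 2)
    nlinarith

/-- The digits of `w` in base `b`. -/
def digit (b w i : ℕ) : ℕ := w / b ^ i % b

section

variable {α : Type} [Ctx α]

theorem PS.lead {f : α → ℕ} (hf : PS f) : PS fun a => lead (f a) := by
  refine PS.of_graph hf ?_ fun a => (leadList_le _).trans (blen_le_self _)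
  have top : ∀ {β : Type} [Ctx β] {g h : β → ℕ}, PS g → PS h →
      PSp fun b => StackProg.dropDigits (g b) (h b) ≠ 0 ∧ StackProg.dropDigits (g b) (h b) % 2 = 0 := fun hg hh =>
    (PSp.ne (hg.dropDigits hh) PS.zero).and (.eq ((hg.dropDigits hh).mod (PS.const 2)) PS.zero)
  have hf' : PS fun x : α × ℕ => f x.1 := hf.comp PS.fst'
  refine (((top hf' PS.snd').not).and (PSp.all (p := fun x j =>
    StackProg.dropDigits (f x.1) j ≠ 0 ∧ StackProg.dropDigits (f x.1) j % 2 = 0) PS.snd' (top (hf'.comp PS.fst') PS.snd'))).of_eq fun x => ?_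
  rw [StackProg.lead, eq_leadList_iff]
  simp only [head?_eq_some_true_iff, StackProg.dropDigits, ne_eq]

theorem PS.entry {f g : α → ℕ} (hf : PS f) (hg : PS g) : PS fun a => entry (f a) (g a) := by
  obtain ⟨e, he⟩ := hf.growth
  refine PS.lead (PS.iterate (f := fun _ => skipEntry) (PS.snd'.dropDigits PS.snd'.lead.succ) hf hg
    ⟨e, fun a i _ => ?_⟩)
  have := he a
  rw [size_nat] at this ⊢
  exact (blen_mono (skipEntry_iterate_le _ _)).trans this

theorem PS.offset {f g : α → ℕ} (hf : PS f) (hg : PS g) : PS fun a => offset (f a) (g a) := by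
  have hf' : PS fun x : α × ℕ × ℕ => f x.1 := hf.comp PS.fst'
  have hr : PS fun x : α × ℕ × ℕ => x.2.2 := PS.snd'.snd
  exact PS.natRec_le (f := fun a _ r => r + 3 + 6 * StackProg.entry (f a) (r + 2)) (g := fun _ => 4)
    (fun a => 4 + g a * (3 + 6 * f a))
    ((hr.add (PS.const 3)).add ((PS.const 6).mul (hf'.entry (hr.add (PS.const 2))))) (PS.const 4) hg
    ((PS.const 4).add (hg.mul ((PS.const 3).add ((PS.const 6).mul hf))))
    fun a i hi => (offset_le (f a) i).trans
      (Nat.add_le_add_left (Nat.mul_le_mul_right _ hi) _)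

theorem PS.digit {f g h : α → ℕ} (hf : PS f) (hg : PS g) (hh : PS h) :
    PS fun a => digit (f a) (g a) (h a) := by
  have key : ∀ b w i : ℕ, Nat.rec (motive := fun _ => ℕ) w (fun _ r => r / b) i = w / b ^ i := by
    intro b w i
    induction i with
    | zero => simp
    | succ i ih => rw [pow_succ, ← Nat.div_div_eq_div_mul, ← ih]
  have := PS.natRec_le (f := fun a _ r => r / f a) g
    (PS.snd'.snd.div (hf.comp PS.fst')) hg hh hg fun a i hi => by
      rw [key]; exact Nat.div_le_self _ _
  simp only [key] at this
  exact this.mod hf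

end

/-! ## The decision procedure on numbers -/

/-- Field `i` of transition `j` of process `p`. -/
def field (x p j i : ℕ) : ℕ := entry x (offset x p + 3 + 6 * j + i)

/-- The number of transitions of process `p`. -/
def numTrans (x p : ℕ) : ℕ := entry x (offset x p + 2)

/-- The control state of process `p` in the configuration with number `w`. -/
def stateCell (x w p : ℕ) : ℕ := digit (x + 2) w p

/-- Position `i` of the channel from `p` to `q` in the configuration with number `w`. -/
def chanCell (x w p q i : ℕ) : ℕ :=
  digit (x + 2) w (entry x 1 + ((p * entry x 1 + q) * entry x 0 + i))

/-- The channel from `p` to `q` in `w'` is the one in `w` after sending the message number `a`. -/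
def SendSlots (x w w' p q a : ℕ) : Prop :=
  ∃ i < entry x 0, chanCell x w p q i = 0 ∧ chanCell x w' p q i = a + 1 ∧
    ∀ j < entry x 0, (j < i → chanCell x w p q j ≠ 0) ∧
      (j ≠ i → chanCell x w' p q j = chanCell x w p q j)

/-- The channel from `p` to `q` in `w'` is the one in `w` after receiving the message number `a`. -/
def RecvSlots (x w w' p q a : ℕ) : Prop :=
  0 < entry x 0 ∧ chanCell x w p q 0 = a + 1 ∧
    ∀ j < entry x 0, (j + 1 < entry x 0 → chanCell x w' p q j = chanCell x w p q (j + 1)) ∧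
      (j + 1 = entry x 0 → chanCell x w' p q j = 0)

/-- Transition `j` of process `p` leads from `w` to `w'`. -/
def NumStep (x p j w w' : ℕ) : Prop :=
  (field x p j 0 = stateCell x w p ∧ field x p j 5 = stateCell x w' p ∧
    ∀ r < entry x 1, r ≠ p → stateCell x w' r = stateCell x w r) ∧
  (∀ r < entry x 1, ∀ s < entry x 1,
    ¬(field x p j 1 < 2 ∧ r = field x p j 2 ∧ s = field x p j 3) →
      ∀ i < entry x 0, chanCell x w' r s i = chanCell x w r s i) ∧
  (field x p j 1 = 0 → SendSlots x w w' (field x p j 2) (field x p j 3) (field x p j 4)) ∧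
  (field x p j 1 = 1 → RecvSlots x w w' (field x p j 2) (field x p j 3) (field x p j 4))

/-- Some transition leads from `w` to `w'`. -/
def NumEdge (x w w' : ℕ) : Prop := ∃ p < entry x 1, ∃ j < numTrans x p, NumStep x p j w w'

/-- A bound for the numbers of configurations. -/
def numBound (x : ℕ) : ℕ :=
  (((x + 2) ^ blen (2 * x + 2)) ^ blen (2 * x + 2)) ^ blen (2 * x + 2)

/-- Reachability between configurations. -/
def NumReaches (x w w' : ℕ) : Prop :=
  w < numBound x ∧ w' < numBound x ∧
    Relation.ReflTransGen (BoundedStep (numBound x) (NumEdge x)) w w'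

/-- Initial configurations. -/
def NumInit (x w : ℕ) : Prop :=
  (∀ p < entry x 1, stateCell x w p = entry x (offset x p + 1)) ∧
    ∀ p < entry x 1, ∀ q < entry x 1, ∀ i < entry x 0, chanCell x w p q i = 0

/-- Configurations that are reachable from an initial one. -/
def NumRS (x w : ℕ) : Prop := ∃ w₀ < numBound x, NumInit x w₀ ∧ NumReaches x w₀ w

/-- From `w` one can reach a configuration in which the communication of kind `κ` of message number
`a` from `p` to `q` is possible. -/
def NumEventually (x κ p q a w : ℕ) : Prop :=
  ∃ w₁ < numBound x, ∃ w₂ < numBound x, NumReaches x w w₁ ∧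
    ∃ r < entry x 1, ∃ j < numTrans x r, field x r j 1 = κ ∧ field x r j 2 = p ∧
      field x r j 3 = q ∧ field x r j 4 = a ∧ NumStep x r j w₁ w₂

/-- The numerical version of eventual reception. -/
def NumReception (x : ℕ) : Prop :=
  ∀ w < numBound x, NumRS x w → ∀ p < entry x 1, ∀ q < entry x 1, p ≠ q → ∀ a < x + 2,
    0 < entry x 0 → chanCell x w p q 0 = a + 1 → NumEventually x 1 p q a w

/-- The numerical version of exhaustivity. -/
def NumExhaustive (x : ℕ) : Prop :=
  ∀ w < numBound x, NumRS x w → ∀ p < entry x 1,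
    (∀ j < numTrans x p, field x p j 0 = stateCell x w p → field x p j 1 ≠ 1) →
      ∀ j < numTrans x p, field x p j 0 = stateCell x w p → field x p j 1 = 0 →
        NumEventually x 0 (field x p j 2) (field x p j 3) (field x p j 4) w

/-! ### Polynomial-space decidability of the numerical conditions -/

section

variable {α : Type} [Ctx α]

theorem PS.field {x p j i : α → ℕ} (hx : PS x) (hp : PS p) (hj : PS j) (hi : PS i) :
    PS fun a => field (x a) (p a) (j a) (i a) :=
  hx.entry ((((hx.offset hp).add (PS.const 3)).add ((PS.const 6).mul hj)).add hi)

theorem PS.numTrans {x p : α → ℕ} (hx : PS x) (hp : PS p) : PS fun a => numTrans (x a) (p a) :=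
  hx.entry ((hx.offset hp).add (PS.const 2))

theorem PS.stateCell {x w p : α → ℕ} (hx : PS x) (hw : PS w) (hp : PS p) :
    PS fun a => stateCell (x a) (w a) (p a) :=
  (hx.add (PS.const 2)).digit hw hp

theorem PS.chanCell {x w p q i : α → ℕ} (hx : PS x) (hw : PS w) (hp : PS p) (hq : PS q)
    (hi : PS i) : PS fun a => chanCell (x a) (w a) (p a) (q a) (i a) :=
  have h0 := hx.entry (PS.const 0)
  have h1 := hx.entry (PS.const 1)
  (hx.add (PS.const 2)).digit hw (h1.add ((((hp.mul h1).add hq).mul h0).add hi))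

theorem PS.numBound {x : α → ℕ} (hx : PS x) : PS fun a => numBound (x a) :=
  have h : PS fun a => 2 * x a + 2 := ((PS.const 2).mul hx).add (PS.const 2)
  (((hx.add (PS.const 2)).pow_blen h).pow_blen h).pow_blen h

/-- The predicate is made of bounded quantifiers, connectives and computable functions, so the
closure properties are applied along its syntax. Packing the arguments into one tuple first makes
each variable a projection. -/
theorem PSp.sendSlots {x w w' p q c : α → ℕ} (hx : PS x) (hw : PS w) (hw' : PS w') (hp : PS p)
    (hq : PS q) (hc : PS c) :
    PSp fun a => SendSlots (x a) (w a) (w' a) (p a) (q a) (c a) := by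
  refine PSp.comp (β := ℕ × ℕ × ℕ × ℕ × ℕ × ℕ)
    (p := fun y => SendSlots y.1 y.2.1 y.2.2.1 y.2.2.2.1 y.2.2.2.2.1 y.2.2.2.2.2)
    (f := fun a => (x a, w a, w' a, p a, q a, c a)) ?_
    (hx.pair (hw.pair (hw'.pair (hp.pair (hq.pair hc)))))
  unfold SendSlots
  repeat' with_reducible first
    | exact PS.const _ | exact PS.id | apply PSp.ex | apply PSp.all | apply PSp.and | apply PSp.ne
    | apply PSp.eq | apply PSp.lt | apply PSp.not | apply PSp.imp | apply PS.entry
    | apply PS.chanCell | apply PS.add | apply PS.fst | apply PS.snd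

theorem PSp.recvSlots {x w w' p q c : α → ℕ} (hx : PS x) (hw : PS w) (hw' : PS w') (hp : PS p)
    (hq : PS q) (hc : PS c) :
    PSp fun a => RecvSlots (x a) (w a) (w' a) (p a) (q a) (c a) := by
  refine PSp.comp (β := ℕ × ℕ × ℕ × ℕ × ℕ × ℕ)
    (p := fun y => RecvSlots y.1 y.2.1 y.2.2.1 y.2.2.2.1 y.2.2.2.2.1 y.2.2.2.2.2)
    (f := fun a => (x a, w a, w' a, p a, q a, c a)) ?_
    (hx.pair (hw.pair (hw'.pair (hp.pair (hq.pair hc)))))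
  unfold RecvSlots
  repeat' with_reducible first
    | exact PS.const _ | exact PS.id | apply PSp.ex | apply PSp.all | apply PSp.and | apply PSp.ne
    | apply PSp.eq | apply PSp.lt | apply PSp.not | apply PSp.imp | apply PS.entry
    | apply PS.chanCell | apply PS.add | apply PS.fst | apply PS.snd

theorem PSp.numStep {x p j w w' : α → ℕ} (hx : PS x) (hp : PS p) (hj : PS j) (hw : PS w)
    (hw' : PS w') : PSp fun a => NumStep (x a) (p a) (j a) (w a) (w' a) := by
  refine PSp.comp (β := ℕ × ℕ × ℕ × ℕ × ℕ)
    (p := fun y => NumStep y.1 y.2.1 y.2.2.1 y.2.2.2.1 y.2.2.2.2)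
    (f := fun a => (x a, p a, j a, w a, w' a)) ?_
    (hx.pair (hp.pair (hj.pair (hw.pair hw'))))
  unfold NumStep
  repeat' with_reducible first
    | exact PS.const _ | exact PS.id | apply PSp.ex | apply PSp.all | apply PSp.and | apply PSp.ne
    | apply PSp.eq | apply PSp.lt | apply PSp.not | apply PSp.sendSlots | apply PSp.recvSlots
    | apply PSp.imp | apply PS.entry | apply PS.field | apply PS.stateCell
    | apply PS.chanCell | apply PS.add | apply PS.fst | apply PS.snd

theorem PSp.numReaches {x w w' : α → ℕ} (hx : PS x) (hw : PS w) (hw' : PS w') :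
    PSp fun a => NumReaches (x a) (w a) (w' a) := by
  refine PSp.reflTransGen (E := fun a => NumEdge (x a)) hx.numBound ?_ hw hw'
  refine PSp.comp (β := ℕ × ℕ × ℕ) (p := fun y => NumEdge y.1 y.2.1 y.2.2)
    (f := fun a : α × ℕ × ℕ => (x a.1, a.2)) ?_
    ((hx.comp PS.fst').pair PS.snd')
  unfold NumEdge
  repeat' with_reducible first
    | exact PS.const _ | exact PS.id | apply PSp.ex | apply PSp.numStep | apply PS.entry
    | apply PS.numTrans | apply PS.fst | apply PS.snd

theorem PSp.numRS {x w : α → ℕ} (hx : PS x) (hw : PS w) : PSp fun a => NumRS (x a) (w a) := by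
  refine PSp.comp (β := ℕ × ℕ) (p := fun y => NumRS y.1 y.2)
    (f := fun a => (x a, w a)) ?_ (hx.pair hw)
  unfold NumRS NumInit
  repeat' with_reducible first
    | exact PS.const _ | exact PS.id | apply PSp.ex | apply PSp.all | apply PSp.and | apply PSp.eq
    | apply PSp.numReaches | apply PS.numBound | apply PS.offset | apply PS.entry
    | apply PS.stateCell | apply PS.chanCell | apply PS.add | apply PS.fst | apply PS.snd

theorem PSp.numEventually {x κ p q c w : α → ℕ} (hx : PS x) (hκ : PS κ) (hp : PS p) (hq : PS q)
    (hc : PS c) (hw : PS w) :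
    PSp fun a => NumEventually (x a) (κ a) (p a) (q a) (c a) (w a) := by
  refine PSp.comp (β := ℕ × ℕ × ℕ × ℕ × ℕ × ℕ)
    (p := fun y => NumEventually y.1 y.2.1 y.2.2.1 y.2.2.2.1 y.2.2.2.2.1 y.2.2.2.2.2)
    (f := fun a => (x a, κ a, p a, q a, c a, w a)) ?_
    (hx.pair (hκ.pair (hp.pair (hq.pair (hc.pair hw)))))
  unfold NumEventually
  repeat' with_reducible first
    | exact PS.const _ | exact PS.id | apply PSp.ex | apply PSp.and | apply PSp.eq
    | apply PSp.numReaches | apply PSp.numStep | apply PS.numBound | apply PS.numTrans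
    | apply PS.field | apply PS.entry | apply PS.fst | apply PS.snd

theorem PSp.numReception : PSp NumReception := by
  unfold NumReception
  repeat' with_reducible first
    | exact PS.const _ | exact PS.id | apply PSp.all | apply PSp.ne | apply PSp.eq | apply PSp.lt
    | apply PSp.numRS | apply PSp.numEventually | apply PSp.imp | apply PS.numBound
    | apply PS.chanCell | apply PS.entry | apply PS.add | apply PS.fst | apply PS.snd

theorem PSp.numExhaustive : PSp NumExhaustive := by
  unfold NumExhaustive
  repeat' with_reducible first
    | exact PS.const _ | exact PS.id | apply PSp.all | apply PSp.ne | apply PSp.eq | apply PSp.lt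
    | apply PSp.numRS | apply PSp.numEventually | apply PSp.imp | apply PS.numBound
    | apply PS.numTrans | apply PS.field | apply PS.stateCell | apply PS.entry | apply PS.add
    | apply PS.fst | apply PS.snd

end

/-! ### From predicates on numbers to languages -/

/-- Languages that are given by predicates on numbers that are decidable in polynomial space. -/
theorem mem_PSPACE_of_PSp {p : ℕ → Prop} (hp : PSp p) : ({x | p (val x)} : Language Bool) ∈ PSPACE := by
  -- Adding `1` turns the truth values into the numbers `1` and `2`, whose words `[false]` and
  -- `[true]` are the required outputs.
  obtain ⟨c, e, hc⟩ := PS.succ hp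
  -- The input is cleared because the final configuration may contain nothing but the output.
  have key : ∀ x : List Bool, Exec ((x.length + 2) ^ (e + 1)) (.seq (c 2 3 4) (clear 2)) (single 2 x)
      (single 3 (enc (ind (p (val x)) + 1))) := by
    intro x
    have hx : size (val x) = x.length := by rw [size_nat, blen, enc_val]
    have h := hc 2 3 4 le_rfl (by omega) (show 2 + 1 ≤ 4 by omega) (show 3 + 1 ≤ 4 by omega)
      (.inl (show 2 + 1 ≤ 3 by omega)) (val x) (single 2 x)
      ((x.length + 2) ^ (e + 1)) (by rw [hx]; exact Nat.pow_le_pow_right (by omega) (by omega))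
      (fun i => by
        rw [single, Function.update_apply]
        split_ifs
        · exact le_pow_add_two _ _
        · simp)
      (by simp [single]) (by simp [single])
      (fun i hi => by
        obtain rfl : i = 0 := Nat.lt_one_iff.1 hi
        change single 2 x 2 = enc (val x)
        simp [single])
      (fun j h₁ h₂ => by simp [single, show j ≠ 2 by omega])
      (fun j h₁ => by simp [single, show j ≠ 2 by omega])
    refine .seq h ((exec_clear 2 h.bdd_right).congr ?_)
    funext j
    have hl : len ℕ = 1 := rfl
    simp only [single, Function.update_apply, Store.write, hl]
    split_ifs <;> first | rfl | omega
  refine mem_PSPACE_of_exec (.seq (c 2 3 4) (clear 2)) ((Polynomial.X + 2) ^ (e + 1)) ?_ ?_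
  · intro x hx
    have := key x
    rw [ind_pos (show p (val x) from hx)] at this
    simpa [enc, incL] using this
  · intro x hx
    have := key x
    rw [ind_neg (show ¬p (val x) from hx)] at this
    simpa [enc, incL] using this

/-! ## The description of a system as a number -/

section

variable {n m t : ℕ}

theorem Msg.code_injective : Function.Injective (Msg.code (m := m)) := by
  rintro (a | _) (b | _) h
  · congr 1
    exact Fin.ext (by simpa [Msg.code] using h)
  · simp [Msg.code] at h
  · simp [Msg.code] at h
  · rfl

theorem IntName.code_injective : Function.Injective (IntName.code (t := t)) := by
  rintro (a | _) (b | _) h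
  · congr 1
    exact Fin.ext (by simpa [IntName.code] using h)
  · simp [IntName.code] at h
  · simp [IntName.code] at h
  · rfl

theorem Channel.ext' {c d : Channel n} (h₁ : (c.src : ℕ) = d.src) (h₂ : (c.dst : ℕ) = d.dst) :
    c = d := Subtype.ext (Prod.ext (Fin.ext h₁) (Fin.ext h₂))

theorem FIFOAction.code_injective : Function.Injective (FIFOAction.code (n := n) (m := m) (t := t)) := by
  rintro (⟨c, a⟩ | ⟨c, a⟩ | ⟨p, i⟩) (⟨d, b⟩ | ⟨d, b⟩ | ⟨q, j⟩) h <;>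
    simp only [FIFOAction.code, List.cons.injEq, and_true, OfNat.zero_ne_ofNat,
      OfNat.ofNat_ne_zero, one_ne_zero, zero_ne_one, OfNat.one_ne_ofNat, OfNat.ofNat_ne_one,
      false_and, true_and] at h
  · rw [Channel.ext' h.1 h.2.1, Msg.code_injective h.2.2]
  · rw [Channel.ext' h.1 h.2.1, Msg.code_injective h.2.2]
  · rw [Fin.ext h.1, IntName.code_injective h.2.2]

/-- The description of a transition. -/
def transCode {S : FIFOSystem n m t} {p : Fin n} (τ : S.Trans p) : List ℕ :=
  (τ.1 : ℕ) :: (τ.2.1.code ++ [(τ.2.2 : ℕ)])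

theorem length_transCode {S : FIFOSystem n m t} {p : Fin n} (τ : S.Trans p) :
    (transCode τ).length = 6 := by
  obtain ⟨q, a, q'⟩ := τ
  cases a <;> rfl

/-- The description of a process. -/
def procCode (S : FIFOSystem n m t) (p : Fin n) : List ℕ :=
  S.numStates p :: (S.init p : ℕ) :: (S.trans p).length :: (S.trans p).flatMap transCode

theorem drop_flatMap {α β : Type*} {f : α → List β} {r : ℕ} (l : List α)
    (h : ∀ a ∈ l, (f a).length = r) (j : ℕ) : (l.flatMap f).drop (r * j) = (l.drop j).flatMap f := by
  induction j generalizing l with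
  | zero => simp
  | succ j ih =>
    cases l with
    | nil => simp
    | cons a l =>
      rw [List.flatMap_cons, List.drop_succ_cons, ← ih l fun b hb => h b (List.mem_cons_of_mem _ hb),
        mul_add, mul_one, Nat.add_comm, ← List.drop_drop, ← h a List.mem_cons_self, List.drop_left]

theorem length_flatMap_of_forall {α β : Type*} {f : α → List β} {r : ℕ} (l : List α)
    (h : ∀ a ∈ l, (f a).length = r) : (l.flatMap f).length = r * l.length := by
  induction l with
  | nil => simp
  | cons a l ih =>
    rw [List.flatMap_cons, List.length_append, ih fun b hb => h b (List.mem_cons_of_mem _ hb),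
      h a List.mem_cons_self, List.length_cons]
    ring

/-- The number for a system and a bound. -/
def sysNum (S : FIFOSystem n m t) (k : ℕ) : ℕ := val (S.inputWord k)

variable (S : FIFOSystem n m t) (k : ℕ)

theorem entry_sysNum (j : ℕ) : entry (sysNum S k) j =
    (k :: n :: m :: t :: (List.finRange n).flatMap (procCode S)).getD j 0 :=
  entry_unaryWord _ _

theorem entry_zero : entry (sysNum S k) 0 = k := entry_sysNum S k 0

theorem entry_one : entry (sysNum S k) 1 = n := entry_sysNum S k 1

theorem entry_two : entry (sysNum S k) 2 = m := entry_sysNum S k 2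

theorem getD_of_drop {l r : List ℕ} {o : ℕ} (h : l.drop o = r) (i : ℕ) :
    l.getD (o + i) 0 = r.getD i 0 := by
  rw [← h, List.getD_eq_getElem?_getD, List.getD_eq_getElem?_getD, List.getElem?_drop]

/-- The offset starts at `4`, behind `k`, `n`, `m` and `t`. The block of a process has three header
entries and six entries for each transition, and the number of transitions is read from the block
itself. -/
theorem drop_offset {p : ℕ} (hp : p ≤ n) :
    (k :: n :: m :: t :: (List.finRange n).flatMap (procCode S)).drop (offset (sysNum S k) p) =
      ((List.finRange n).drop p).flatMap (procCode S) := by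
  induction p with
  | zero => rfl
  | succ p ih =>
    have hpn : p < n := hp
    have ih := ih hpn.le
    have hd : (List.finRange n).drop p = ⟨p, hpn⟩ :: (List.finRange n).drop (p + 1) := by
      rw [List.drop_eq_getElem_cons (by simpa using hpn)]
      simp
    rw [hd, List.flatMap_cons] at ih
    have hl : (procCode S ⟨p, hpn⟩).length = 3 + 6 * (S.trans ⟨p, hpn⟩).length := by
      rw [procCode]
      simp only [List.length_cons]
      rw [length_flatMap_of_forall _ fun τ _ => length_transCode τ]
      omega
    have hc : entry (sysNum S k) (offset (sysNum S k) p + 2) = (S.trans ⟨p, hpn⟩).length := by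
      rw [entry_sysNum, getD_of_drop ih]
      rfl
    rw [offset_succ, hc, add_assoc, ← List.drop_drop, ih, ← hl, List.drop_left]

theorem drop_offset_fin (p : Fin n) : ∃ r,
    (k :: n :: m :: t :: (List.finRange n).flatMap (procCode S)).drop (offset (sysNum S k) p) =
      procCode S p ++ r := by
  have hd : (List.finRange n).drop p = p :: (List.finRange n).drop (p + 1) := by
    rw [List.drop_eq_getElem_cons (by simp)]
    simp
  rw [drop_offset S k p.2.le, hd, List.flatMap_cons]
  exact ⟨_, rfl⟩

theorem entry_numStates (p : Fin n) :
    entry (sysNum S k) (offset (sysNum S k) p) = S.numStates p := by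
  obtain ⟨r, hr⟩ := drop_offset_fin S k p
  rw [entry_sysNum, ← Nat.add_zero (offset _ _), getD_of_drop hr]
  rfl

theorem entry_init (p : Fin n) :
    entry (sysNum S k) (offset (sysNum S k) p + 1) = S.init p := by
  obtain ⟨r, hr⟩ := drop_offset_fin S k p
  rw [entry_sysNum, getD_of_drop hr]
  rfl

theorem numTrans_sysNum (p : Fin n) : numTrans (sysNum S k) p = (S.trans p).length := by
  obtain ⟨r, hr⟩ := drop_offset_fin S k p
  rw [numTrans, entry_sysNum, getD_of_drop hr]
  rfl

theorem field_sysNum (p : Fin n) {j : ℕ} (hj : j < (S.trans p).length) {i : ℕ} (hi : i < 6) :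
    field (sysNum S k) p j i = (transCode (S.trans p)[j]).getD i 0 := by
  obtain ⟨r, hr⟩ := drop_offset_fin S k p
  have h₁ : (k :: n :: m :: t :: (List.finRange n).flatMap (procCode S)).drop
      (offset (sysNum S k) p + 3 + 6 * j) = ((S.trans p).drop j).flatMap transCode ++ r := by
    rw [← List.drop_drop, ← List.drop_drop, hr]
    change ((S.trans p).flatMap transCode ++ r).drop (6 * j) = _
    rw [List.drop_append_of_le_length, drop_flatMap _ fun τ _ => length_transCode τ]
    rw [length_flatMap_of_forall _ fun τ _ => length_transCode τ]
    omega
  rw [field, entry_sysNum, getD_of_drop h₁, List.drop_eq_getElem_cons hj, List.flatMap_cons,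
    List.append_assoc]
  exact List.getD_append _ _ _ _ (by rw [length_transCode]; exact hi)

/-- The number of control states is an entry of the input, and no entry exceeds the number of the
whole input. So the input number plus `2` is a base large enough for all cells. -/
theorem state_lt (p : Fin n) (q : S.State p) : (q : ℕ) < sysNum S k + 2 := by
  have h₁ := entry_le (sysNum S k) (offset (sysNum S k) p)
  rw [entry_numStates] at h₁
  omega

theorem code_lt (a : Msg m) : a.code + 1 < sysNum S k + 2 := by
  have h₁ := entry_le (sysNum S k) 2
  rw [entry_two] at h₁
  have h₂ : a.code ≤ m := by
    cases a
    · exact Fin.is_lt _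
    · exact Nat.zero_le _
  omega

/-! ## Configurations as numbers -/

/-- The number at a position of a channel: `0` if it is empty. -/
def slot (l : List (Msg m)) (i : ℕ) : ℕ := (l[i]?).elim 0 fun a => a.code + 1

theorem slot_eq_zero_iff {l : List (Msg m)} {i : ℕ} : slot l i = 0 ↔ l.length ≤ i := by
  rw [slot, ← List.getElem?_eq_none_iff]
  cases l[i]? <;> simp

theorem slot_append_left {l r : List (Msg m)} {i : ℕ} (h : i < l.length) :
    slot (l ++ r) i = slot l i := by
  rw [slot, List.getElem?_append_left h, slot]

theorem slot_append_length (l : List (Msg m)) (a : Msg m) :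
    slot (l ++ [a]) l.length = a.code + 1 := by
  simp [slot]

theorem slot_lt (l : List (Msg m)) (i : ℕ) : slot l i < sysNum S k + 2 := by
  rw [slot]
  cases l[i]? with
  | none => simp
  | some a => exact code_lt S k a

variable {k}

/-- The position `i` is forced to be the first free slot, namely `l.length`. Its existence below `k`
says precisely that the channel is still within the bound after the send. -/
theorem send_slots_iff {l : List (Msg m)} (hl : l.length ≤ k) {f f' : ℕ → ℕ}
    (hf : ∀ i < k, f i = slot l i) (a : Msg m) :
    (∃ i < k, f i = 0 ∧ f' i = a.code + 1 ∧ ∀ j < k, (j < i → f j ≠ 0) ∧ (j ≠ i → f' j = f j)) ↔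
      l.length < k ∧ ∀ i < k, f' i = slot (l ++ [a]) i := by
  constructor
  · rintro ⟨i, hi, h₁, h₂, h₃⟩
    rw [hf i hi, slot_eq_zero_iff] at h₁
    obtain rfl : i = l.length := by
      by_contra h
      have := (h₃ l.length (by omega)).1 (by omega)
      rw [hf _ (by omega)] at this
      exact this (slot_eq_zero_iff.2 le_rfl)
    refine ⟨hi, fun j hj => ?_⟩
    rcases lt_trichotomy j l.length with h | rfl | h
    · rw [(h₃ j hj).2 h.ne, hf j hj, slot_append_left h]
    · rw [h₂, slot_append_length]
    · rw [(h₃ j hj).2 h.ne', hf j hj, slot_eq_zero_iff.2 h.le, slot_eq_zero_iff.2 (by simpa using h)]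
  · rintro ⟨h, h'⟩
    refine ⟨l.length, h, by rw [hf _ h, slot_eq_zero_iff.2 le_rfl],
      by rw [h' _ h, slot_append_length], fun j hj => ⟨fun h₁ => ?_, fun h₁ => ?_⟩⟩
    · rw [hf j hj, Ne, slot_eq_zero_iff]
      omega
    · rw [hf j hj, h' j hj]
      rcases lt_or_gt_of_ne h₁ with h₁ | h₁
      · rw [slot_append_left h₁]
      · rw [slot_eq_zero_iff.2 h₁.le, slot_eq_zero_iff.2 (by simpa using h₁)]

theorem slot_zero_eq_iff {l : List (Msg m)} {b : ℕ} :
    slot l 0 = b + 1 ↔ ∃ a u, l = a :: u ∧ a.code = b := by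
  cases l with
  | nil => simp [slot]
  | cons a l => simp [slot]

/-- A reception shifts the cells by one. The last cell becomes free since at most `k` messages were
there. -/
theorem recv_slots_iff {l : List (Msg m)} (hl : l.length ≤ k) {f f' : ℕ → ℕ}
    (hf : ∀ i < k, f i = slot l i) (a : Msg m) :
    (0 < k ∧ f 0 = a.code + 1 ∧ ∀ j < k, (j + 1 < k → f' j = f (j + 1)) ∧ (j + 1 = k → f' j = 0)) ↔
      ∃ u, l = a :: u ∧ ∀ i < k, f' i = slot u i := by
  constructor
  · rintro ⟨h₀, h₁, h₂⟩
    rw [hf 0 h₀, slot_zero_eq_iff] at h₁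
    obtain ⟨b, u, rfl, hb⟩ := h₁
    obtain rfl := Msg.code_injective hb
    refine ⟨u, rfl, fun j hj => ?_⟩
    rcases Nat.lt_or_eq_of_le (Nat.succ_le_of_lt hj) with h | h
    · rw [(h₂ j hj).1 h, hf _ h]
      simp [slot]
    · rw [(h₂ j hj).2 h, slot_eq_zero_iff.2]
      simp only [List.length_cons] at hl
      omega
  · rintro ⟨u, rfl, h⟩
    simp only [List.length_cons] at hl
    refine ⟨by omega, by rw [hf 0 (by omega)]; simp [slot], fun j hj => ⟨fun h₁ => ?_, fun h₁ => ?_⟩⟩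
    · rw [h j hj, hf _ h₁]
      simp [slot]
    · rw [h j hj, slot_eq_zero_iff]
      omega

/-- The contents of the channel between the processes with two given numbers. -/
def chanWord (w : Channel n → List (Msg m)) (p q : ℕ) : List (Msg m) :=
  if h : ∃ (hp : p < n) (hq : q < n), (⟨p, hp⟩ : Fin n) ≠ ⟨q, hq⟩ then
    w ⟨(⟨p, h.1⟩, ⟨q, h.2.1⟩), h.2.2⟩ else []

theorem chanWord_channel (w : Channel n → List (Msg m)) (c : Channel n) :
    chanWord w c.src c.dst = w c := dif_pos ⟨c.src.2, c.dst.2, c.2⟩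

theorem chanWord_congr {w w' : Channel n → List (Msg m)} {p q : ℕ}
    (h : ∀ d : Channel n, (d.src : ℕ) = p → (d.dst : ℕ) = q → w' d = w d) :
    chanWord w' p q = chanWord w p q := by
  unfold chanWord
  split_ifs with h'
  exacts [h _ rfl rfl, rfl]

variable {S}

/-- The number `w` represents the bounded configuration `γ`. -/
structure Represents (k : ℕ) (w : ℕ) (γ : S.Config) : Prop where
  lt : w < numBound (sysNum S k)
  bounded : γ.Bounded k
  state : ∀ p : Fin n, stateCell (sysNum S k) w p = γ.state p
  -- The pairs with `p = q` are not channels; by the default in `chanWord` their cells are empty.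
  chan : ∀ p < n, ∀ q < n, ∀ i < k, chanCell (sysNum S k) w p q i = slot (chanWord γ.chan p q) i

theorem exists_digits {b : ℕ} (N : ℕ) (f : ℕ → ℕ) (hf : ∀ i, f i < b) :
    ∃ w < b ^ N, ∀ i < N, digit b w i = f i := by
  induction N generalizing f with
  | zero => exact ⟨0, by simp, fun i hi => absurd hi (Nat.not_lt_zero i)⟩
  | succ N ih =>
    obtain ⟨w, hw, h⟩ := ih (fun i => f (i + 1)) fun i => hf _
    refine ⟨w * b + f 0, ?_, fun i hi => ?_⟩
    · calc w * b + f 0 < (w + 1) * b := by rw [add_mul]; have := hf 0; omega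
        _ ≤ b ^ N * b := Nat.mul_le_mul_right _ hw
        _ = _ := (pow_succ _ _).symm
    · cases i with
      | zero => rw [digit, pow_zero, Nat.div_one, mod_mul_add _ (hf 0)]
      | succ i =>
        rw [digit, pow_succ', ← Nat.div_div_eq_div_mul, div_mul_add _ (hf 0)]
        exact h i (by omega)

/-- With `L` the number of digits of `2 * x + 2`, where `x` is the input number, the exponent of
`numBound` is `L * L * L`. Both `n` and `k` are entries in unary, hence at most the length of the
input, which is less than `L`. -/
theorem pow_le_numBound (S : FIFOSystem n m t) (k : ℕ) :
    (sysNum S k + 2) ^ (n + n * n * k) ≤ numBound (sysNum S k) := by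
  rw [numBound, ← pow_mul, ← pow_mul]
  refine Nat.pow_le_pow_right (by omega) ?_
  have h₁ := entry_le_blen (sysNum S k) 0
  have h₂ := entry_le_blen (sysNum S k) 1
  rw [entry_zero] at h₁
  rw [entry_one] at h₂
  have h₃ : blen (sysNum S k) < blen (2 * sysNum S k + 2) := by
    have e₁ := two_pow_blen_le (sysNum S k)
    have e₂ := lt_two_pow_blen (2 * sysNum S k + 2)
    have : 2 ^ (blen (sysNum S k) + 1) < 2 ^ (blen (2 * sysNum S k + 2) + 1) := by
      rw [pow_succ]; omega
    have := (Nat.pow_lt_pow_iff_right (by norm_num : 1 < 2)).1 this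
    omega
  generalize blen (2 * sysNum S k + 2) = L at *
  obtain ⟨L, rfl⟩ := Nat.exists_eq_add_of_lt (Nat.zero_lt_of_lt h₃)
  have hn : n ≤ L := by omega
  have hk : k ≤ L := by omega
  have : n * n * k ≤ L * L * L := Nat.mul_le_mul (Nat.mul_le_mul hn hn) hk
  nlinarith

/-- The digits come first from the states and then from the channel cells, whose indices are
recovered from the position by division with remainder. Such a number need not be unique, as
`numBound` may leave room for further digits; hence a relation is used instead of a coding function.
-/
theorem exists_represents {γ : S.Config} (h : γ.Bounded k) : ∃ w, Represents k w γ := by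
  obtain ⟨w, hw, hd⟩ := exists_digits (b := sysNum S k + 2) (n + n * n * k)
    (fun i => if hi : i < n then γ.state ⟨i, hi⟩ else
      slot (chanWord γ.chan ((i - n) / k / n) ((i - n) / k % n)) ((i - n) % k)) fun i => by
        split_ifs
        exacts [state_lt S k _ _, slot_lt S k _ _]
  refine ⟨w, hw.trans_le (pow_le_numBound S k), h, fun p => ?_, fun p hp q hq i hi => ?_⟩
  · rw [stateCell, hd p (by have := p.2; omega), dif_pos p.2]
  · have hlt : (p * n + q) * k + i < n * n * k := by
      calc (p * n + q) * k + i < (p * n + q + 1) * k := by rw [add_mul _ 1]; omega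
        _ ≤ n * n * k := Nat.mul_le_mul_right _ (by nlinarith)
    rw [chanCell, entry_one, entry_zero, hd _ (by omega), dif_neg (by omega),
      Nat.add_sub_cancel_left, div_mul_add _ hi, mod_mul_add _ hi, div_mul_add _ hq,
      mod_mul_add _ hq]

theorem Represents.of_numInit {w : ℕ} (hw : w < numBound (sysNum S k))
    (h : NumInit (sysNum S k) w) : Represents k w S.initConfig := by
  refine ⟨hw, fun c => Nat.zero_le _, fun p => ?_, fun p hp q hq i hi => ?_⟩
  · rw [h.1 p (by rw [entry_one]; exact p.2), entry_init]
    rfl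
  · rw [h.2 p (by rwa [entry_one]) q (by rwa [entry_one]) i (by rwa [entry_zero])]
    refine (slot_eq_zero_iff.2 ?_).symm
    unfold chanWord
    split_ifs <;> simp [FIFOSystem.initConfig]

theorem Represents.numInit {w : ℕ} (h : Represents k w S.initConfig) : NumInit (sysNum S k) w := by
  refine ⟨fun p hp => ?_, fun p hp q hq i hi => ?_⟩
  · rw [entry_one] at hp
    rw [h.state ⟨p, hp⟩]
    exact (entry_init S k ⟨p, hp⟩).symm
  · rw [entry_one] at hp hq
    rw [entry_zero] at hi
    rw [h.chan p hp q hq i hi, slot_eq_zero_iff]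
    unfold chanWord
    split_ifs <;> simp [FIFOSystem.initConfig]

end

/-! ### Steps and runs in configurations and in numbers -/

section

variable {n m t : ℕ} {S : FIFOSystem n m t} {k : ℕ}

/-- The transition `τ` leads from `γ` to `γ'`. -/
def Fires (γ γ' : S.Config) {p : Fin n} (τ : S.Trans p) : Prop :=
  γ.state p = τ.1 ∧ γ'.state = Function.update γ.state p τ.2.2 ∧
    FIFOSystem.ChanEffect τ.2.1 γ.chan γ'.chan

/-- `Step` finds the process through the action, whereas the numerical version enumerates processes
and their transitions; `actor_eq` reconciles the two. -/
theorem step_iff {γ γ' : S.Config} {a : FIFOAction n m t} :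
    S.Step γ a γ' ↔ ∃ p, ∃ τ ∈ S.trans p, τ.2.1 = a ∧ Fires γ γ' τ := by
  constructor
  · rintro ⟨q', h₁, h₂, h₃⟩
    exact ⟨a.actor, _, h₁, rfl, rfl, h₂, h₃⟩
  · rintro ⟨p, ⟨q, a, q'⟩, h₁, rfl, h₂, h₃, h₄⟩
    obtain rfl : a.actor = p := S.actor_eq p _ h₁
    obtain rfl : γ.state a.actor = q := h₂
    exact ⟨q', h₁, h₃, h₄⟩

theorem field_source (p : Fin n) {j : ℕ} (hj : j < (S.trans p).length) :
    field (sysNum S k) p j 0 = (S.trans p)[j].1 := field_sysNum S k p hj (by omega)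

theorem field_target (p : Fin n) {j : ℕ} (hj : j < (S.trans p).length) :
    field (sysNum S k) p j 5 = (S.trans p)[j].2.2 := by
  rw [field_sysNum S k p hj (by omega)]
  obtain ⟨q, a, q'⟩ := (S.trans p)[j]
  cases a <;> rfl

theorem field_action (p : Fin n) {j : ℕ} (hj : j < (S.trans p).length) {i : ℕ} (hi : i < 4) :
    field (sysNum S k) p j (i + 1) = (S.trans p)[j].2.1.code.getD i 0 := by
  rw [field_sysNum S k p hj (by omega)]
  obtain ⟨q, a, q'⟩ := (S.trans p)[j]
  cases a <;> interval_cases i <;> rfl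

theorem stateCells_iff {w w' : ℕ} {γ : S.Config} (h : Represents k w γ) (p : Fin n) {j : ℕ}
    (hj : j < (S.trans p).length) :
    (field (sysNum S k) p j 0 = stateCell (sysNum S k) w p ∧
      field (sysNum S k) p j 5 = stateCell (sysNum S k) w' p ∧
      ∀ r < n, r ≠ p → stateCell (sysNum S k) w' r = stateCell (sysNum S k) w r) ↔
    γ.state p = (S.trans p)[j].1 ∧ ∀ r : Fin n, stateCell (sysNum S k) w' r =
      (Function.update γ.state p (S.trans p)[j].2.2 r : ℕ) := by
  rw [field_source, field_target, h.state, Fin.val_inj, eq_comm]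
  refine and_congr_right fun _ => ⟨?_, fun h₁ => ⟨?_, fun r hr hrp => ?_⟩⟩
  · rintro ⟨h₁, h₂⟩ r
    by_cases hr : r = p
    · subst hr
      rw [Function.update_self, h₁]
    · rw [Function.update_of_ne hr, h₂ r r.2 (fun h => hr (Fin.ext h)), h.state]
  · rw [h₁ p, Function.update_self]
  · have := h₁ ⟨r, hr⟩
    rw [Function.update_of_ne (fun h => hrp (congrArg Fin.val h)), ← h.state] at this
    exact this

/-- The channels change as under the action `a`. -/
def ChanCells (x : ℕ) (a : FIFOAction n m t) (w w' : ℕ) : Prop :=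
  (∀ r < entry x 1, ∀ s < entry x 1,
    ¬(a.code.getD 0 0 < 2 ∧ r = a.code.getD 1 0 ∧ s = a.code.getD 2 0) →
      ∀ i < entry x 0, chanCell x w' r s i = chanCell x w r s i) ∧
  (a.code.getD 0 0 = 0 → SendSlots x w w' (a.code.getD 1 0) (a.code.getD 2 0) (a.code.getD 3 0)) ∧
  (a.code.getD 0 0 = 1 → RecvSlots x w w' (a.code.getD 1 0) (a.code.getD 2 0) (a.code.getD 3 0))

/-- The bound on the new contents is part of the equivalence: a send into a full channel finds no
free slot. So numerical steps are automatically steps between bounded configurations. The auxiliary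
fact `glue` separates the channel acted upon from all others. -/
theorem chanCells_iff {w w' : ℕ} {γ : S.Config} (h : Represents k w γ) (a : FIFOAction n m t) :
    ChanCells (sysNum S k) a w w' ↔ ∃ ch, FIFOSystem.ChanEffect a γ.chan ch ∧
      (∀ c, (ch c).length ≤ k) ∧ ∀ r < n, ∀ s < n, ∀ i < k,
        chanCell (sysNum S k) w' r s i = slot (chanWord ch r s) i := by
  have hcell : ∀ c : Channel n, ∀ i < k,
      chanCell (sysNum S k) w c.src c.dst i = slot (γ.chan c) i := fun c i hi => by
    rw [h.chan _ c.src.2 _ c.dst.2 i hi, chanWord_channel]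
  have other : ∀ (c : Channel n) (ch : Channel n → List (Msg m)), (∀ d, d ≠ c → ch d = γ.chan d) →
      ∀ r s : ℕ, ¬(r = (c.src : ℕ) ∧ s = c.dst) → chanWord ch r s = chanWord γ.chan r s :=
    fun c ch hch r s hrs => chanWord_congr fun d h₁ h₂ => hch d fun hd => hrs (by
      subst hd; exact ⟨h₁.symm, h₂.symm⟩)
  have glue : ∀ (c : Channel n) (ch : Channel n → List (Msg m)), (∀ d, d ≠ c → ch d = γ.chan d) →
      ((∀ r < n, ∀ s < n, ∀ i < k, chanCell (sysNum S k) w' r s i = slot (chanWord ch r s) i) ↔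
        (∀ r < n, ∀ s < n, ¬(r = (c.src : ℕ) ∧ s = c.dst) → ∀ i < k,
          chanCell (sysNum S k) w' r s i = chanCell (sysNum S k) w r s i) ∧
        ∀ i < k, chanCell (sysNum S k) w' c.src c.dst i = slot (ch c) i) := by
    intro c ch hch
    refine ⟨fun h₁ => ⟨fun r hr s hs hrs i hi => ?_, fun i hi => ?_⟩, fun ⟨h₁, h₂⟩ r hr s hs i hi => ?_⟩
    · rw [h₁ r hr s hs i hi, h.chan r hr s hs i hi, other c ch hch r s hrs]
    · rw [h₁ _ c.src.2 _ c.dst.2 i hi, chanWord_channel]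
    · by_cases hrs : r = (c.src : ℕ) ∧ s = c.dst
      · rw [hrs.1, hrs.2, h₂ i hi, chanWord_channel]
      · rw [h₁ r hr s hs hrs i hi, h.chan r hr s hs i hi, other c ch hch r s hrs]
  unfold ChanCells SendSlots RecvSlots
  rw [entry_one, entry_zero]
  cases a with
  | send c b =>
    have key := send_slots_iff (h.bounded c) (hcell c) b
      (f' := fun i => chanCell (sysNum S k) w' c.src c.dst i)
    have hne : ∀ d, d ≠ c →
        Function.update γ.chan c (γ.chan c ++ [b]) d = γ.chan d :=
      fun d hd => Function.update_of_ne hd _ _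
    simp only [FIFOAction.code, List.getD_cons_zero, List.getD_cons_succ, FIFOSystem.ChanEffect,
      Nat.zero_lt_two, true_and, forall_const, zero_ne_one, false_implies, and_true,
      exists_eq_left]
    rw [key, glue c _ hne, Function.update_self]
    constructor
    · rintro ⟨h₁, h₂, h₃⟩
      refine ⟨fun d => ?_, h₁, h₃⟩
      by_cases hd : d = c
      · subst hd
        simpa using h₂
      · rw [hne d hd]
        exact h.bounded d
    · rintro ⟨h₁, h₂, h₃⟩
      have := h₁ c
      simp only [Function.update_self, List.length_append, List.length_singleton] at this
      exact ⟨h₂, this, h₃⟩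
  | recv c b =>
    have key := recv_slots_iff (h.bounded c) (hcell c) b
      (f' := fun i => chanCell (sysNum S k) w' c.src c.dst i)
    simp only [FIFOAction.code, List.getD_cons_zero, List.getD_cons_succ, FIFOSystem.ChanEffect,
      Nat.one_lt_two, true_and, forall_const, one_ne_zero, false_implies]
    rw [key]
    constructor
    · rintro ⟨h₁, u, hu, h₂⟩
      have hne : ∀ d, d ≠ c → Function.update γ.chan c u d = γ.chan d :=
        fun d hd => Function.update_of_ne hd _ _
      refine ⟨Function.update γ.chan c u, ⟨by rw [Function.update_self, hu], hne⟩, fun d => ?_,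
        (glue c _ hne).2 ⟨h₁, by rwa [Function.update_self]⟩⟩
      by_cases hd : d = c
      · subst hd
        have := h.bounded d
        rw [hu, List.length_cons] at this
        rw [Function.update_self]
        omega
      · rw [hne d hd]
        exact h.bounded d
    · rintro ⟨ch, ⟨h₁, h₂⟩, -, h₃⟩
      obtain ⟨h₄, h₅⟩ := (glue c ch h₂).1 h₃
      exact ⟨h₄, ch c, h₁, h₅⟩
  | internal p b =>
    simp only [FIFOAction.code, List.getD_cons_zero, List.getD_cons_succ, FIFOSystem.ChanEffect,
      lt_irrefl, false_and, not_false_eq_true, forall_const, OfNat.ofNat_ne_zero,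
      OfNat.ofNat_ne_one, false_implies, and_true, exists_eq_left]
    refine ⟨fun h₁ => ⟨h.bounded, fun r hr s hs i hi => ?_⟩, fun ⟨_, h₁⟩ r hr s hs i hi => ?_⟩
    · rw [h₁ r hr s hs i hi, h.chan r hr s hs i hi]
    · rw [h₁ r hr s hs i hi, h.chan r hr s hs i hi]

theorem numStep_iff {w w' : ℕ} (p : Fin n) {j : ℕ} (hj : j < (S.trans p).length) :
    NumStep (sysNum S k) p j w w' ↔
      (field (sysNum S k) p j 0 = stateCell (sysNum S k) w p ∧
        field (sysNum S k) p j 5 = stateCell (sysNum S k) w' p ∧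
        ∀ r < n, r ≠ p → stateCell (sysNum S k) w' r = stateCell (sysNum S k) w r) ∧
      ChanCells (sysNum S k) (S.trans p)[j].2.1 w w' := by
  have f := fun {i} => field_action (S := S) (k := k) p hj (i := i)
  have f0 := f (i := 0) (by omega)
  have f1 := f (i := 1) (by omega)
  have f2 := f (i := 2) (by omega)
  have f3 := f (i := 3) (by omega)
  unfold NumStep ChanCells
  simp only [Nat.zero_add, Nat.reduceAdd] at f0 f1 f2 f3
  rw [f0, f1, f2, f3, entry_one]

/-- The cells of `w'` are prescribed by those of `w` and the transition, so it need not be assumed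
that `w'` represents a configuration. -/
theorem NumStep.exists_fires {w w' : ℕ} {γ : S.Config} (h : Represents k w γ)
    (hw' : w' < numBound (sysNum S k)) {p : Fin n} {j : ℕ} (hj : j < (S.trans p).length)
    (hs : NumStep (sysNum S k) p j w w') :
    ∃ γ', Represents k w' γ' ∧ Fires γ γ' (S.trans p)[j] := by
  rw [numStep_iff p hj, stateCells_iff h p hj, chanCells_iff h] at hs
  obtain ⟨⟨h₁, h₂⟩, ch, h₃, h₄, h₅⟩ := hs
  exact ⟨⟨Function.update γ.state p (S.trans p)[j].2.2, ch⟩, ⟨hw', h₄, h₂, h₅⟩, h₁, rfl, h₃⟩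

theorem Fires.numStep {w w' : ℕ} {γ γ' : S.Config} (h : Represents k w γ)
    (h' : Represents k w' γ') {p : Fin n} {j : ℕ} (hj : j < (S.trans p).length)
    (hf : Fires γ γ' (S.trans p)[j]) : NumStep (sysNum S k) p j w w' := by
  rw [numStep_iff p hj, stateCells_iff h, chanCells_iff h]
  exact ⟨⟨hf.1, fun r => by rw [h'.state, hf.2.1]⟩, γ'.chan, hf.2.2, h'.bounded, h'.chan⟩

theorem Represents.kStep_of_numEdge {w w' : ℕ} {γ : S.Config} (h : Represents k w γ)
    (hw' : w' < numBound (sysNum S k)) (he : NumEdge (sysNum S k) w w') :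
    ∃ a γ', S.KStep k γ a γ' ∧ Represents k w' γ' := by
  obtain ⟨p, hp, j, hj, hs⟩ := he
  rw [entry_one] at hp
  have hj' : j < (S.trans ⟨p, hp⟩).length := by rwa [← numTrans_sysNum S k]
  obtain ⟨γ', h₁, h₂⟩ := NumStep.exists_fires (p := ⟨p, hp⟩) h hw' hj' hs
  exact ⟨_, γ', ⟨h.bounded, step_iff.2 ⟨_, _, List.getElem_mem hj', rfl, h₂⟩, h₁.bounded⟩, h₁⟩

theorem Represents.numEdge_of_kStep {w w' : ℕ} {γ γ' : S.Config} (h : Represents k w γ)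
    (h' : Represents k w' γ') {a : FIFOAction n m t} (hs : S.KStep k γ a γ') :
    NumEdge (sysNum S k) w w' := by
  obtain ⟨p, τ, hτ, -, hf⟩ := step_iff.1 hs.2.1
  obtain ⟨j, hj, rfl⟩ := List.getElem_of_mem hτ
  exact ⟨p, by rw [entry_one]; exact p.2, j, by rwa [numTrans_sysNum], hf.numStep h h' hj⟩

theorem Represents.kReaches_of_numReaches {w w' : ℕ} {γ : S.Config} (h : Represents k w γ)
    (hr : NumReaches (sysNum S k) w w') : ∃ γ', S.KReaches k γ γ' ∧ Represents k w' γ' := by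
  obtain ⟨-, -, hr⟩ := hr
  induction hr with
  | refl => exact ⟨γ, .refl, h⟩
  | tail _ hs ih =>
    obtain ⟨γ₁, h₁, h₂⟩ := ih
    obtain ⟨a, γ₂, h₃, h₄⟩ := h₂.kStep_of_numEdge hs.2.1 hs.2.2
    exact ⟨γ₂, h₁.tail ⟨a, h₃⟩, h₄⟩

/-- Each configuration on the run is bounded and so has a number; any choice of these numbers gives
a path. -/
theorem Represents.numReaches_of_kReaches {w : ℕ} {γ γ' : S.Config} (h : Represents k w γ)
    (hr : S.KReaches k γ γ') : ∃ w', NumReaches (sysNum S k) w w' ∧ Represents k w' γ' := by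
  induction hr with
  | refl => exact ⟨w, ⟨h.lt, h.lt, .refl⟩, h⟩
  | tail _ hs ih =>
    obtain ⟨w₁, h₁, h₂⟩ := ih
    obtain ⟨a, hs⟩ := hs
    obtain ⟨w₂, h₃⟩ := exists_represents hs.2.2
    exact ⟨w₂, ⟨h.lt, h₃.lt, h₁.2.2.tail ⟨h₂.lt, h₃.lt, h₂.numEdge_of_kStep h₃ hs⟩⟩, h₃⟩

theorem NumRS.exists_represents {w : ℕ} (h : NumRS (sysNum S k) w) :
    ∃ γ ∈ S.RS k, Represents k w γ := by
  obtain ⟨w₀, h₀, h₁, h₂⟩ := h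
  exact (Represents.of_numInit h₀ h₁).kReaches_of_numReaches h₂

theorem exists_numRS {γ : S.Config} (h : γ ∈ S.RS k) :
    ∃ w, NumRS (sysNum S k) w ∧ Represents k w γ := by
  obtain ⟨w₀, h₀⟩ := StackProg.exists_represents (γ := S.initConfig) (k := k) fun c => Nat.zero_le _
  obtain ⟨w, h₁, h₂⟩ := h₀.numReaches_of_kReaches h
  exact ⟨w, ⟨w₀, h₀.lt, h₀.numInit, h₁⟩, h₂⟩

/-- The four numbers of a code determine the action by `FIFOAction.code_injective`, so comparing
fields of transitions amounts to comparing actions. -/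
theorem numEventually_iff {w : ℕ} {γ : S.Config} (h : Represents k w γ) {a : FIFOAction n m t}
    {κ p q b : ℕ} (ha : a.code = [κ, p, q, b]) : NumEventually (sysNum S k) κ p q b w ↔
      ∃ γ₁ γ₂, S.KReaches k γ γ₁ ∧ S.KStep k γ₁ a γ₂ := by
  constructor
  · rintro ⟨w₁, _, w₂, hw₂, hr, r, hrn, j, hj, e₁, e₂, e₃, e₄, hs⟩
    rw [entry_one] at hrn
    have hj' : j < (S.trans ⟨r, hrn⟩).length := by rwa [← numTrans_sysNum S k]
    obtain ⟨γ₁, h₁, h₂⟩ := h.kReaches_of_numReaches hr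
    obtain ⟨γ₂, h₃, h₄⟩ := NumStep.exists_fires (p := ⟨r, hrn⟩) h₂ hw₂ hj' hs
    refine ⟨γ₁, γ₂, h₁, h₂.bounded, step_iff.2 ⟨_, _, List.getElem_mem hj', ?_, h₄⟩, h₃.bounded⟩
    have f := fun {i} => field_action (S := S) (k := k) ⟨r, hrn⟩ hj' (i := i)
    have f0 := f (i := 0) (by omega)
    have f1 := f (i := 1) (by omega)
    have f2 := f (i := 2) (by omega)
    have f3 := f (i := 3) (by omega)
    simp only [Nat.zero_add, Nat.reduceAdd] at f0 f1 f2 f3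
    rw [e₁] at f0
    rw [e₂] at f1
    rw [e₃] at f2
    rw [e₄] at f3
    refine FIFOAction.code_injective ?_
    rw [ha, f0, f1, f2, f3]
    cases (S.trans ⟨r, hrn⟩)[j].2.1 <;> rfl
  · rintro ⟨γ₁, γ₂, h₁, h₂⟩
    obtain ⟨w₁, hr, h₃⟩ := h.numReaches_of_kReaches h₁
    obtain ⟨w₂, h₄⟩ := exists_represents h₂.2.2
    obtain ⟨r, τ, hτ, rfl, hf⟩ := step_iff.1 h₂.2.1
    obtain ⟨j, hj, rfl⟩ := List.getElem_of_mem hτ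
    have f := fun {i} => field_action (S := S) (k := k) r hj (i := i)
    rw [ha] at f
    exact ⟨w₁, h₃.lt, w₂, h₄.lt, hr, r, by rw [entry_one]; exact r.2, j, by rwa [numTrans_sysNum],
      f (i := 0) (by omega), f (i := 1) (by omega), f (i := 2) (by omega), f (i := 3) (by omega),
      hf.numStep h₃ h₄ hj⟩

/-! ### The two conditions of `k`-weak multiparty compatibility -/

theorem numReception_iff : NumReception (sysNum S k) ↔ S.EventualReception k := by
  constructor
  · intro h γ hγ c a u hc
    obtain ⟨w, h₁, h₂⟩ := exists_numRS hγ
    -- The first message is read from cell `0`, which exists only for positive `k`; a nonempty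
    -- bounded channel ensures this.
    have hk : 0 < k := by
      have := h₂.bounded c
      rw [hc, List.length_cons] at this
      omega
    have hcell : chanCell (sysNum S k) w c.src c.dst 0 = a.code + 1 := by
      rw [h₂.chan _ c.src.2 _ c.dst.2 0 hk, chanWord_channel, hc]
      rfl
    exact (numEventually_iff h₂ (a := .recv c a) rfl).1 (h w h₂.lt h₁ c.src
      (by rw [entry_one]; exact c.src.2) c.dst (by rw [entry_one]; exact c.dst.2)
      (fun h => c.2 (Fin.ext h)) a.code (by have := code_lt S k a; omega) (by rwa [entry_zero]) hcell)
  · intro h w _ hw p hp q hq hpq b _ hk hcell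
    rw [entry_one] at hp hq
    rw [entry_zero] at hk
    obtain ⟨γ, hγ, h₁⟩ := hw.exists_represents
    set c : Channel n := ⟨(⟨p, hp⟩, ⟨q, hq⟩), fun h => hpq (congrArg Fin.val h)⟩ with hc
    rw [h₁.chan p hp q hq 0 hk, show chanWord γ.chan p q = γ.chan c from chanWord_channel γ.chan c,
      slot_zero_eq_iff] at hcell
    obtain ⟨a, u, hau, rfl⟩ := hcell
    exact (numEventually_iff h₁ (a := .recv c a) rfl).2 (h γ hγ c a u hau)

theorem isSending_iff {w : ℕ} {γ : S.Config} (h : Represents k w γ) (p : Fin n) :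
    (∀ j < numTrans (sysNum S k) p, field (sysNum S k) p j 0 = stateCell (sysNum S k) w p →
      field (sysNum S k) p j 1 ≠ 1) ↔ S.IsSending (S.delta p) (γ.state p) := by
  rw [numTrans_sysNum]
  constructor
  · intro h₁ c a q' hτ
    obtain ⟨j, hj, hjτ⟩ := List.getElem_of_mem (show _ ∈ S.trans p from hτ)
    refine h₁ j hj ?_ ?_
    · rw [field_source p hj, h.state, hjτ]
    · rw [field_action p hj (i := 0) (by omega), hjτ]
      rfl
  · intro h₁ j hj h₂ h₃
    rw [field_source p hj, h.state, Fin.val_inj] at h₂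
    rw [field_action p hj (i := 0) (by omega)] at h₃
    have hmem := List.getElem_mem hj
    generalize (S.trans p)[j] = τ at h₂ h₃ hmem
    obtain ⟨q, a, q'⟩ := τ
    obtain rfl : q = γ.state p := h₂
    cases a with
    | recv c a => exact h₁ c a q' hmem
    | send c a => simp [FIFOAction.code] at h₃
    | internal p a => simp [FIFOAction.code] at h₃

theorem numExhaustive_iff : NumExhaustive (sysNum S k) ↔ S.Exhaustive k := by
  constructor
  · intro h γ hγ c hc a q' hτ
    obtain ⟨w, h₁, h₂⟩ := exists_numRS hγ
    obtain ⟨j, hj, hjτ⟩ := List.getElem_of_mem (show _ ∈ S.trans c.src from hτ)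
    have f := fun {i} => field_action (S := S) (k := k) c.src hj (i := i)
    rw [hjτ] at f
    have := h w h₂.lt h₁ c.src (by rw [entry_one]; exact c.src.2) ((isSending_iff h₂ c.src).2 hc) j
      (by rwa [numTrans_sysNum]) (by rw [field_source _ hj, h₂.state, hjτ]) (f (i := 0) (by omega))
    rw [f (i := 1) (by omega), f (i := 2) (by omega), f (i := 3) (by omega)] at this
    exact (numEventually_iff h₂ (a := .send c a) rfl).1 this
  · intro h w _ hw p hp hsend j hj h₂ h₃
    rw [entry_one] at hp
    obtain ⟨γ, hγ, h₁⟩ := hw.exists_represents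
    have hs := (isSending_iff h₁ ⟨p, hp⟩).1 hsend
    have hj : j < (S.trans ⟨p, hp⟩).length := by rwa [← numTrans_sysNum S k]
    have f := fun {i} => field_action (S := S) (k := k) ⟨p, hp⟩ hj (i := i)
    have f0 := f (i := 0) (by omega)
    have f1 := f (i := 1) (by omega)
    have f2 := f (i := 2) (by omega)
    have f3 := f (i := 3) (by omega)
    simp only [Nat.zero_add, Nat.reduceAdd] at f0 f1 f2 f3
    have h₂ : (S.trans ⟨p, hp⟩)[j].1 = γ.state ⟨p, hp⟩ := by
      rw [← Fin.val_inj, ← h₁.state, ← h₂]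
      exact (field_source ⟨p, hp⟩ hj).symm
    rw [h₃] at f0
    rw [f1, f2, f3]
    have hmem := List.getElem_mem hj
    clear f f1 f2 f3
    generalize (S.trans ⟨p, hp⟩)[j] = τ at h₂ f0 hmem ⊢
    obtain ⟨q, a, q'⟩ := τ
    cases a with
    | recv c a => simp [FIFOAction.code] at f0
    | internal p a => simp [FIFOAction.code] at f0
    | send c a =>
      -- Exhaustivity speaks of the sender of a channel, the numerical version of the process that
      -- owns the transition; they coincide.
      have hact : c.src = ⟨p, hp⟩ := S.actor_eq _ _ hmem
      generalize (⟨p, hp⟩ : Fin n) = P at *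
      subst hact
      obtain rfl : q = γ.state c.src := h₂
      exact (numEventually_iff h₁ (a := .send c a) rfl).2 (h γ hγ c hs a q' hmem)

end

end StackProg

open StackProg in
/-- Checking `k`-weak multiparty compatibility of crash-handling systems generated from
communicating session automata is decidable, and can be done in polynomial space. -/
theorem theorem5 :
    ∃ L : Language Bool, L ∈ DecidableLanguages ∧ L ∈ PSPACE ∧
      ∀ (n m t : ℕ) (S : FIFOSystem n m t) (R : Set (Fin n))
        (cls : ∀ p, S.State p → StateClass),
        S.IsCrashHandling R cls → S.GeneratedFromCSA →
          ∀ k : ℕ, S.inputWord k ∈ L ↔ S.IsKWMC k := by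
  have h := mem_PSPACE_of_PSp (PSp.numReception.and PSp.numExhaustive)
  exact ⟨_, mem_DecidableLanguages_of_mem_PSPACE h, h, fun n m t S _ _ _ _ k =>
    and_congr numReception_iff numExhaustive_iff⟩
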